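/- **Definitions.** Let $d>0$ and $g\ge 0$ be integers. *Plane tropical curves.* A tropical curve $C$ is a finite graph without loops, with every vertex of valency at least $3$, whose bounded edges have positive real lengths and which may have unbounded edges (of infinite length, with a single endpoint). It is irreducible if it is connected, and its genus is its first Betti number. A plane tropical curve is a map $h:C\to\mathbb R^2$ that is affine on each edge, $h(c)=h(a)+\ell(a,c)\,\Delta_a(e)$ for $c$ in an edge $e$ with endpoint $a$ (where $\ell$ is the length along $e$), with nonzero integer vectors $\Delta_a(e)$ such that $\sum_{e\ni a}\Delta_a(e)=0$ at every vertex $a$. The weight of $e$ is the gcd of the coordinates of $\Delta_a(e)$. The degree of $h$ is $\sum\max(p,q,0)$ over the vectors $(p,q)$ of the unbounded edges. The curve passes through $\mathcal P\subset\mathbb R^2$ if $h(C)\supset\mathcal P$. Plane tropical curves are considered up to isometries of $C$ commuting with the maps to $\mathbb R^2$. *Floors and elevators.* An elevator of $h$ is a (bounded or unbounded) edge with vertical image. A floor is a connected component of the union of all edges that are not elevators. The floor diagram $\mathcal D(h)$ is the weighted oriented graph obtained from $C$ by removing the unbounded edges, collapsing each floor to a vertex, and orienting the remaining edges (the bounded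 elevators) downwards, keeping their weights. *Marked floor diagrams.* A labeled floor diagram $\mathcal D$ of degree $d$ and genus $g$ is a connected oriented graph (multiple edges allowed) on a linearly ordered set $V$ of $d$ vertices, with $d+g-1$ edges carrying positive integer weights, such that each edge goes from a smaller to a larger vertex, and for each vertex $v$ the total weight $\operatorname{div}(v)$ of outgoing minus incoming edges is at most $1$. Its extended graph $\widetilde G=(\widetilde V,\widetilde E)$ is obtained by attaching to each $v\in V$, by edges of weight $1$ directed away from $v$, $1-\operatorname{div}(v)$ new vertices, and by inserting a new vertex in the middle of each original edge, both halves inheriting orientation and weight. A marking of $\mathcal D$ is a linear order on $\widetilde V$ that extends the order of $V$ and for which every edge goes from a smaller to a larger vertex. A marked floor diagram of degree $d$ and genus $g$ is a labeled floor diagram with a marking, up to order-preserving isomorphisms of the weighted oriented graphs $\widetilde G$ that respect the subsets $V$. *Vertically stretched configurations.* A set $\mathcal P=\{(x_i,y_i)\}_{1\le i\le 3d-1+g}\subset\mathbb R^2$ is a vertically stretched $(d,g)$-configuration if $x_1<x_2<\cdots$, $y_1<y_2<\cdots$, and $\min_{i\ne j}|y_i-y_j|>(d^3+d)\max_{i\ne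 j}|x_i-x_j|$. It is ordered downwards, higher points preceding lower ones. **Theorem.** Let $\mathcal P$ be a vertically stretched $(d,g)$-configuration. For every irreducible plane tropical curve $h$ of degree $d$ and genus $g$ passing through $\mathcal P$, each floor and each elevator of $h$ contains a unique point of $\mathcal P$, and the downwards order of these points makes $\mathcal D(h)$ a labeled floor diagram of degree $d$ and genus $g$ and gives a marking $\widetilde{\mathcal D}(h,\mathcal P)$ of it (bounded elevators corresponding to the midpoints of edges, and unbounded elevators, which all have weight $1$ and are directed downwards, to the other new vertices). The map $h\mapsto\widetilde{\mathcal D}(h,\mathcal P)$ is a bijection from the set of irreducible plane tropical curves of degree $d$ and genus $g$ passing through $\mathcal P$ to the set of marked floor diagrams of degree $d$ and genus $g$. -/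

import Mathlib

/-! ### Weighted oriented graphs -/

/-- An oriented graph with weighted edges; multiple edges are allowed. -/
structure WeightedDigraph where
  V : Type
  E : Type
  src : E → V
  tgt : E → V
  wt : E → ℕ

namespace WeightedDigraph

/-- The underlying simple graph (used for connectedness only). -/
def toSimple (G : WeightedDigraph) : SimpleGraph G.V :=
  SimpleGraph.fromRel fun u v => ∃ e, G.src e = u ∧ G.tgt e = v

open Classical in
/-- The divergence of a vertex: total outgoing weight minus total incoming weight. -/
noncomputable def div (G : WeightedDigraph) [Fintype G.E] (v : G.V) : ℤ :=
  (∑ e with G.src e = v, (G.wt e : ℤ)) - (∑ e with G.tgt e = v, (G.wt e : ℤ))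

/-- An isomorphism of weighted oriented graphs. -/
structure Iso (G H : WeightedDigraph) where
  onV : G.V ≃ H.V
  onE : G.E ≃ H.E
  src_eq : ∀ e, H.src (onE e) = onV (G.src e)
  tgt_eq : ∀ e, H.tgt (onE e) = onV (G.tgt e)
  wt_eq : ∀ e, H.wt (onE e) = G.wt e

namespace Iso

def refl (G : WeightedDigraph) : Iso G G where
  onV := Equiv.refl _
  onE := Equiv.refl _
  src_eq _ := rfl
  tgt_eq _ := rfl
  wt_eq _ := rfl

def symm {G H : WeightedDigraph} (f : Iso G H) : Iso H G where
  onV := f.onV.symm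
  onE := f.onE.symm
  src_eq e := by rw [Equiv.eq_symm_apply, ← f.src_eq, Equiv.apply_symm_apply]
  tgt_eq e := by rw [Equiv.eq_symm_apply, ← f.tgt_eq, Equiv.apply_symm_apply]
  wt_eq e := by rw [← f.wt_eq, Equiv.apply_symm_apply]

def trans {G H K : WeightedDigraph} (f : Iso G H) (k : Iso H K) : Iso G K where
  onV := f.onV.trans k.onV
  onE := f.onE.trans k.onE
  src_eq e := by simp [k.src_eq, f.src_eq]
  tgt_eq e := by simp [k.tgt_eq, f.tgt_eq]
  wt_eq e := by simp [k.wt_eq, f.wt_eq]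

end Iso

end WeightedDigraph

/-! ### Labeled floor diagrams and their markings -/

/-- A (connected) labeled floor diagram of degree `d` and genus `g`. -/
structure LabeledFloorDiagram (d g : ℕ) extends WeightedDigraph where
  [fintypeV : Fintype V]
  [fintypeE : Fintype E]
  [orderV : LinearOrder V]
  card_V : Fintype.card V = d
  /-- There are `d + g - 1` edges. -/
  card_E : Fintype.card E + 1 = d + g
  connected : toWeightedDigraph.toSimple.Connected
  wt_pos : ∀ e, 0 < wt e
  src_lt_tgt : ∀ e, src e < tgt e
  div_le_one : ∀ v, toWeightedDigraph.div v ≤ 1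

attribute [instance] LabeledFloorDiagram.fintypeV LabeledFloorDiagram.fintypeE
  LabeledFloorDiagram.orderV

namespace LabeledFloorDiagram

variable {d g : ℕ}

/-- The number `1 - div v` of new vertices attached to `v` (it is nonnegative). -/
noncomputable def leafCount (D : LabeledFloorDiagram d g) (v : D.V) : ℕ :=
  (1 - D.toWeightedDigraph.div v).toNat

/-- The vertices of the extended graph: the original vertices, a midpoint of every original edge,
and `1 - div v` new vertices for every original vertex `v`. -/
inductive ExtVertex (D : LabeledFloorDiagram d g) : Type
  | orig (v : D.V)
  | mid (e : D.E)
  | leaf (v : D.V) (k : Fin (D.leafCount v))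

/-- The edges of the extended graph: the two halves of every original edge, and one edge from `v`
to each of the new vertices attached to `v`. -/
inductive ExtEdge (D : LabeledFloorDiagram d g) : Type
  | firstHalf (e : D.E)
  | secondHalf (e : D.E)
  | toLeaf (v : D.V) (k : Fin (D.leafCount v))

/-- The extended graph. Halves inherit orientation and weight; the edges to the new
vertices are directed away from the original ones and have weight `1`. -/
def extGraph (D : LabeledFloorDiagram d g) : WeightedDigraph where
  V := D.ExtVertex
  E := D.ExtEdge
  src
    | .firstHalf e => .orig (D.src e)
    | .secondHalf e => .mid e
    | .toLeaf v _ => .orig v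
  tgt
    | .firstHalf e => .mid e
    | .secondHalf e => .orig (D.tgt e)
    | .toLeaf v k => .leaf v k
  wt
    | .firstHalf e => D.wt e
    | .secondHalf e => D.wt e
    | .toLeaf _ _ => 1

/-- The original vertices, as a subset of the vertices of the extended graph. -/
def origSet (D : LabeledFloorDiagram d g) : Set D.extGraph.V :=
  Set.range ExtVertex.orig

end LabeledFloorDiagram

/-- A labeled floor diagram together with a linear order on the vertices of the extended
graph, which extends the given order and is compatible with all edges. -/
structure FloorMarking (d g : ℕ) where
  diagram : LabeledFloorDiagram d g
  [order : LinearOrder diagram.extGraph.V]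
  extends_order : ∀ u v : diagram.V, u < v →
    order.lt (LabeledFloorDiagram.ExtVertex.orig u) (LabeledFloorDiagram.ExtVertex.orig v)
  src_lt_tgt : ∀ e, diagram.extGraph.src e < diagram.extGraph.tgt e

attribute [instance] FloorMarking.order

namespace FloorMarking

variable {d g : ℕ}

/-- Two markings are the same if there is an isomorphism of the extended weighted oriented
graphs that respects the linear orders and the sets of original vertices (hence, for a
fixed labeled floor diagram, fixes each original vertex). -/
def Equivalent (M M₂ : FloorMarking d g) : Prop :=
  ∃ f : M.diagram.extGraph.Iso M₂.diagram.extGraph,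
    (∀ a b, a < b ↔ f.onV a < f.onV b) ∧
    ∀ a, a ∈ M.diagram.origSet ↔ f.onV a ∈ M₂.diagram.origSet

instance setoid (d g : ℕ) : Setoid (FloorMarking d g) where
  r := Equivalent
  iseqv :=
    { refl := fun M => ⟨.refl _, fun _ _ => Iff.rfl, fun _ => Iff.rfl⟩
      symm := by
        rintro M M₂ ⟨f, h1, h2⟩
        refine ⟨f.symm, fun a b => ?_, fun a => ?_⟩
        · rw [h1]; simp [WeightedDigraph.Iso.symm]
        · rw [h2]; simp [WeightedDigraph.Iso.symm]
      trans := by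
        rintro M M₂ M₃ ⟨f, h1, h2⟩ ⟨k, k1, k2⟩
        refine ⟨f.trans k, fun a b => ?_, fun a => ?_⟩
        · rw [h1, k1]; rfl
        · rw [h2, k2]; rfl }

end FloorMarking

/-- Marked floor diagrams of degree `d` and genus `g`. -/
def MarkedFloorDiagram (d g : ℕ) : Type 1 := Quotient (FloorMarking.setoid d g)

/-! ### Tropical curves -/

/-- An abstract tropical curve, i.e. a finite metric graph with unbounded edges. `V` are the
vertices (the univalent ones being removed), `E` the bounded edges, joining `fst e` to `snd e`
and of length `len e`, and `U` the unbounded edges, of infinite length and starting at `root u`.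
There are no loops, and every vertex is at least trivalent. -/
structure TropicalCurve where
  V : Type
  E : Type
  U : Type
  [fintypeV : Fintype V]
  [fintypeE : Fintype E]
  [fintypeU : Fintype U]
  fst : E → V
  snd : E → V
  root : U → V
  len : E → ℝ
  fst_ne_snd : ∀ e, fst e ≠ snd e
  len_pos : ∀ e, 0 < len e
  three_le_valency : ∀ v, 3 ≤ Nat.card {e // fst e = v} + Nat.card {e // snd e = v} +
    Nat.card {u // root u = v}

attribute [instance] TropicalCurve.fintypeV TropicalCurve.fintypeE TropicalCurve.fintypeU

namespace TropicalCurve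

/-- The points of the curve: vertices, interior points of bounded edges (at distance `t` from
`fst e`), and interior points of unbounded edges (at distance `t` from `root u`). -/
inductive Point (C : TropicalCurve) : Type
  | vertex (v : C.V)
  | onEdge (e : C.E) (t : ℝ) (pos : 0 < t) (lt : t < C.len e)
  | onRay (u : C.U) (t : ℝ) (pos : 0 < t)

/-- The closed bounded edge `e`. -/
def closedEdge (C : TropicalCurve) (e : C.E) : Set C.Point :=
  {x | x = .vertex (C.fst e) ∨ x = .vertex (C.snd e) ∨ ∃ t h0 h1, x = .onEdge e t h0 h1}

/-- The unbounded edge `u` together with its endpoint. -/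
def closedRay (C : TropicalCurve) (u : C.U) : Set C.Point :=
  {x | x = .vertex (C.root u) ∨ ∃ t h0, x = .onRay u t h0}

/-- Adjacency of vertices through bounded edges. -/
def toSimple (C : TropicalCurve) : SimpleGraph C.V :=
  SimpleGraph.fromRel fun v w => ∃ e, C.fst e = v ∧ C.snd e = w

/-- The curve is connected (and nonempty). -/
def IsIrreducible (C : TropicalCurve) : Prop := C.toSimple.Connected

/-- The first Betti number (unbounded edges are contractible and do not contribute). -/
noncomputable def genus (C : TropicalCurve) : ℤ :=
  (Fintype.card C.E : ℤ) - Fintype.card C.V + Nat.card C.toSimple.ConnectedComponent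

end TropicalCurve

/-- The inclusion of integer vectors in the plane. -/
def latticeVec (v : ℤ × ℤ) : ℝ × ℝ := ((v.1 : ℝ), (v.2 : ℝ))

open Classical in
/-- A (parametrized) plane tropical curve, i.e. a tropical morphism from a tropical curve to the
plane: `pos` gives the images of the vertices, `dir e` is the integer vector `Δ_a(e)` at the
endpoint `a = fst e` (so that the vector at `snd e` is `- dir e`), and `rayDir u` is `Δ(u)`.
The vectors are nonzero, as the edges have positive integer weights. -/
structure PlaneTropicalCurve extends TropicalCurve where
  pos : V → ℝ × ℝ
  dir : E → ℤ × ℤ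
  rayDir : U → ℤ × ℤ
  dir_ne_zero : ∀ e, dir e ≠ 0
  rayDir_ne_zero : ∀ u, rayDir u ≠ 0
  pos_snd : ∀ e, pos (snd e) = pos (fst e) + len e • latticeVec (dir e)
  balanced : ∀ v, (∑ e with fst e = v, dir e) + (∑ e with snd e = v, -dir e) +
    (∑ u with root u = v, rayDir u) = 0

namespace PlaneTropicalCurve

/-- The map from the curve to the plane. -/
def map (h : PlaneTropicalCurve) : h.Point → ℝ × ℝ
  | .vertex v => h.pos v
  | .onEdge e t _ _ => h.pos (h.fst e) + t • latticeVec (h.dir e)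
  | .onRay u t _ => h.pos (h.root u) + t • latticeVec (h.rayDir u)

/-- The weight of a bounded edge. -/
def edgeWeight (h : PlaneTropicalCurve) (e : h.E) : ℕ := Int.gcd (h.dir e).1 (h.dir e).2

/-- The weight of an unbounded edge. -/
def rayWeight (h : PlaneTropicalCurve) (u : h.U) : ℕ := Int.gcd (h.rayDir u).1 (h.rayDir u).2

/-- The (projective) degree: the sum of `max(p, q, 0)` over the vectors `(p, q)` of the
unbounded edges. -/
def degree (h : PlaneTropicalCurve) : ℤ :=
  ∑ u, max (max (h.rayDir u).1 (h.rayDir u).2) 0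

/-- An isomorphism of plane tropical curves: an isometry of the underlying curves that commutes
with the maps to the plane. -/
structure Iso (h k : PlaneTropicalCurve) where
  onV : h.V ≃ k.V
  onE : h.E ≃ k.E
  onU : h.U ≃ k.U
  ends_eq : ∀ e, s(k.fst (onE e), k.snd (onE e)) = s(onV (h.fst e), onV (h.snd e))
  root_eq : ∀ u, k.root (onU u) = onV (h.root u)
  len_eq : ∀ e, k.len (onE e) = h.len e
  pos_eq : ∀ v, k.pos (onV v) = h.pos v
  rayDir_eq : ∀ u, k.rayDir (onU u) = h.rayDir u

/-- Plane tropical curves are considered up to isomorphism. -/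
instance setoid : Setoid PlaneTropicalCurve where
  r h k := Nonempty (Iso h k)
  iseqv :=
    { refl := fun h => ⟨⟨.refl _, .refl _, .refl _, fun _ => rfl, fun _ => rfl, fun _ => rfl,
        fun _ => rfl, fun _ => rfl⟩⟩
      symm := by
        rintro h k ⟨f⟩
        refine ⟨⟨f.onV.symm, f.onE.symm, f.onU.symm, fun e => ?_, fun u => ?_, fun e => ?_,
          fun v => ?_, fun u => ?_⟩⟩
        · have := f.ends_eq (f.onE.symm e)
          rw [Equiv.apply_symm_apply] at this
          have h2 := congrArg (Sym2.map f.onV.symm) this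
          simpa using h2.symm
        · rw [Equiv.eq_symm_apply, ← f.root_eq, Equiv.apply_symm_apply]
        · rw [← f.len_eq, Equiv.apply_symm_apply]
        · rw [← f.pos_eq, Equiv.apply_symm_apply]
        · rw [← f.rayDir_eq, Equiv.apply_symm_apply]
      trans := by
        rintro h k l ⟨f⟩ ⟨f₂⟩
        refine ⟨⟨f.onV.trans f₂.onV, f.onE.trans f₂.onE, f.onU.trans f₂.onU, fun e => ?_,
          fun u => ?_, fun e => ?_, fun v => ?_, fun u => ?_⟩⟩
        · have h2 := congrArg (Sym2.map f₂.onV) (f.ends_eq e)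
          rw [Sym2.map_mk, Sym2.map_mk] at h2
          exact (f₂.ends_eq (f.onE e)).trans h2
        · simp [f₂.root_eq, f.root_eq]
        · simp [f₂.len_eq, f.len_eq]
        · simp [f₂.pos_eq, f.pos_eq]
        · simp [f₂.rayDir_eq, f.rayDir_eq] }

/-! ### Elevators, floors and the floor diagram -/

/-- A bounded edge is an elevator if its image is vertical. -/
def IsElevator (h : PlaneTropicalCurve) (e : h.E) : Prop := (h.dir e).1 = 0

/-- An unbounded edge is an elevator if its image is vertical. -/
def IsUnboundedElevator (h : PlaneTropicalCurve) (u : h.U) : Prop := (h.rayDir u).1 = 0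

/-- Two vertices are identified if they are joined by a path of bounded edges that are
not elevators. -/
def floorSetoid (h : PlaneTropicalCurve) : Setoid h.V :=
  Relation.EqvGen.setoid fun v w => ∃ e, ¬ h.IsElevator e ∧ h.fst e = v ∧ h.snd e = w

/-- The vertices of the curve after collapsing each floor to a single vertex. -/
abbrev Floor (h : PlaneTropicalCurve) : Type := Quotient h.floorSetoid

/-- The floor through a vertex. -/
def floorOf (h : PlaneTropicalCurve) (v : h.V) : h.Floor := Quotient.mk h.floorSetoid v

/-- The floor as a subset of the curve: a connected component of the union of all edges (bounded
or unbounded) that are not elevators. (It is empty for a vertex that lies on elevators only.) -/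
def floorSet (h : PlaneTropicalCurve) (F : h.Floor) : Set h.Point :=
  {x | (∃ e, ¬ h.IsElevator e ∧ h.floorOf (h.fst e) = F ∧ x ∈ h.closedEdge e) ∨
    ∃ u, ¬ h.IsUnboundedElevator u ∧ h.floorOf (h.root u) = F ∧ x ∈ h.closedRay u}

/-- The upper endpoint of a bounded elevator. -/
def upper (h : PlaneTropicalCurve) (e : h.E) : h.V :=
  if (h.dir e).2 < 0 then h.fst e else h.snd e

/-- The lower endpoint of a bounded elevator. -/
def lower (h : PlaneTropicalCurve) (e : h.E) : h.V :=
  if (h.dir e).2 < 0 then h.snd e else h.fst e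

/-- The floor diagram of a plane tropical curve: unbounded edges are removed, floors
collapsed, and bounded elevators oriented downwards, keeping their weights. -/
def floorDiagram (h : PlaneTropicalCurve) : WeightedDigraph where
  V := h.Floor
  E := {e // h.IsElevator e}
  src e := h.floorOf (h.upper e)
  tgt e := h.floorOf (h.lower e)
  wt e := h.edgeWeight e

/-! ### Point configurations and the marking that they induce -/

/-- `M` is (a representative of) the marking of the floor diagram of `h` that is induced by the
configuration `P`: the floor diagram of `h` is identified with the labeled floor diagram underlying
`M`, and the unbounded elevators, all of weight `1` and directed downwards, with the added
vertices of `M`, in such a way that each floor and each elevator contains a unique point of `P`,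
and that the linear order of `M` is the downwards order of these points. -/
def InducesMarking (h : PlaneTropicalCurve) {N d g : ℕ} (P : Fin N → ℝ × ℝ)
    (M : FloorMarking d g) : Prop :=
  ∃ (f : h.floorDiagram.Iso M.diagram.toWeightedDigraph)
    (l : {u // h.IsUnboundedElevator u} ≃ Σ v : M.diagram.V, Fin (M.diagram.leafCount v))
    (pt : M.diagram.extGraph.V → Fin N),
    (∀ u, (l u).1 = f.onV (h.floorOf (h.root u))) ∧
    (∀ u : {u // h.IsUnboundedElevator u}, h.rayWeight u = 1 ∧ (h.rayDir u).2 < 0) ∧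
    (∀ (F : h.Floor) (i : Fin N), P i ∈ h.map '' h.floorSet F ↔ i = pt (.orig (f.onV F))) ∧
    (∀ (e : {e // h.IsElevator e}) (i : Fin N),
      P i ∈ h.map '' h.closedEdge e ↔ i = pt (.mid (f.onE e))) ∧
    (∀ (u : {u // h.IsUnboundedElevator u}) (i : Fin N),
      P i ∈ h.map '' h.closedRay u ↔ i = pt (.leaf (l u).1 (l u).2)) ∧
    ∀ a b, a < b ↔ (P (pt b)).2 < (P (pt a)).2

/-- `h` is an irreducible plane tropical curve of degree `d` and genus `g` whose image contains
all points of the configuration `P`. -/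
def IsCurveThrough (h : PlaneTropicalCurve) (d g : ℕ) {N : ℕ} (P : Fin N → ℝ × ℝ) : Prop :=
  h.IsIrreducible ∧ h.degree = d ∧ h.genus = g ∧ ∀ i, P i ∈ Set.range h.map

end PlaneTropicalCurve

/-- The set of (isomorphism classes of) irreducible plane tropical curves of degree `d` and
genus `g` passing through `P`. -/
def tropicalCurvesThrough (d g : ℕ) {N : ℕ} (P : Fin N → ℝ × ℝ) :
    Set (Quotient PlaneTropicalCurve.setoid) :=
  {H | ∃ h : PlaneTropicalCurve, h.IsCurveThrough d g P ∧ Quotient.mk _ h = H}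

/-- Vertically stretched `(d, g)`-configurations of `3d - 1 + g` points, listed from bottom
to top. -/
def IsVerticallyStretched (d g : ℕ) (P : Fin (3 * d - 1 + g) → ℝ × ℝ) : Prop :=
  StrictMono (fun i => (P i).1) ∧ StrictMono (fun i => (P i).2) ∧
    ∀ i j k l, i ≠ j → k ≠ l →
      ((d : ℝ) ^ 3 + d) * |(P k).1 - (P l).1| < |(P i).2 - (P j).2|

/-!
Fix a vertically stretched configuration of `3d - 1 + g` points and an irreducible curve of degree
`d` and genus `g` through it. The proof is a count of points; it never uses that the configuration
is generic in any other sense.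

*Every curve is floor decomposed.* Let `φ` be the total horizontal momentum of the rays going to
the left, and `n₀` the number of vertices all of whose edges are vertical. Balancing gives `φ ≤ d`,
bounds all slopes by `d`, and shows that a floor with total left momentum `φ_F` is crossed by every
vertical line with total momentum `φ_F` (`IsNormalized.sum_crosses`). Hence:

* at most `φ` points lie on floors: walk from each of them to the right inside its floor, up to
  the vertical line through the rightmost point; since slopes are at most `d` and the
  configuration is stretched, different points arrive at different crossings
  (`IsNormalized.card_points_on_floors_le`);
* at most `b + u - 3n₀/2` points lie on elevators, where `b` and `u` count the bounded and the
  unbounded elevators: the points have different abscissas, and a vertical line that contains an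
  elevator contains one whose lower (and one whose upper) end is not among the `n₀` vertices
  (`IsNormalized.card_points_on_elevators_le`);
* `b ≤ g - 1 + #floors ≤ g - 1 + φ + n₀` by the Euler characteristic, and `u ≤ 2d - φ` by
  balancing the rays.

The sum of these bounds is `φ + 2d + g - 1 - n₀/2 ≤ 3d - 1 + g`, so all of them are equalities
(`IsNormalized.isFloorDecomposed`): there are `d` floors, each of which is the graph of a piecewise
linear function with slope `0` on the far left and `1` on the far right, `d + g - 1` bounded
elevators and `d` unbounded ones, all of weight `1` and directed downwards, and each floor and
elevator contains exactly one point (`IsFloorDecomposed.exists_equiv`). Over the strip that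
contains the points a floor stays closer to its own point than any other point does, so the
downward order of the points is a marking (`IsFloorDecomposed.exists_inducesMarking`). The marking
is unique up to equivalence and invariant under isomorphism of curves.

*The inverse.* A marked floor diagram and the configuration assign a point to each floor and each
elevator. The elevators are then vertical lines through their points, the ends of which have to
attach to the floors; the floor `v` must be the graph of the function that starts with slope `0`,
changes its slope at each attached end by the weight of the elevator, with a sign, and passes
through the point of `v` (`Placement.floorY`). Stretching makes the elevators end on the floors on
the correct side of their points, so these data define a curve (`Placement.curve`), which passes
through the points and induces the marking (`Placement.inducesMarking_curve`). Conversely, balancing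
over the part of a floor on the left of a vertical line shows that the slopes of the floors of any
curve with this marking are the prescribed ones, whence the curve is isomorphic to the constructed
one (`Placement.Realization.nonempty_iso`). This gives surjectivity and injectivity.
-/

/-! ### Images of edges, rays and floors -/

namespace PlaneTropicalCurve

theorem latticeVec_injective : Function.Injective latticeVec := by
  rintro ⟨a, b⟩ ⟨c, d⟩ hv
  simp only [latticeVec, Prod.mk.injEq, Int.cast_inj] at hv
  exact Prod.ext hv.1 hv.2

theorem latticeVec_neg (v : ℤ × ℤ) : latticeVec (-v) = -latticeVec v := by
  simp [latticeVec]

theorem mem_image_closedEdge (h : PlaneTropicalCurve) {e : h.E} {p : ℝ × ℝ} :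
    p ∈ h.map '' h.closedEdge e ↔
      ∃ t : ℝ, 0 ≤ t ∧ t ≤ h.len e ∧ p = h.pos (h.fst e) + t • latticeVec (h.dir e) := by
  constructor
  · rintro ⟨x, hx, rfl⟩
    rcases hx with rfl | rfl | ⟨t, h0, h1, rfl⟩
    · exact ⟨0, le_rfl, (h.len_pos e).le, by simp [map]⟩
    · exact ⟨h.len e, (h.len_pos e).le, le_rfl, by simp [map, h.pos_snd]⟩
    · exact ⟨t, h0.le, h1.le, rfl⟩
  · rintro ⟨t, h0, h1, rfl⟩
    rcases h0.eq_or_lt with rfl | h0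
    · exact ⟨_, Or.inl rfl, by simp [map]⟩
    rcases h1.eq_or_lt with rfl | h1
    · exact ⟨_, Or.inr (Or.inl rfl), by simp [map, h.pos_snd]⟩
    exact ⟨_, Or.inr (Or.inr ⟨t, h0, h1, rfl⟩), rfl⟩

theorem mem_image_closedRay (h : PlaneTropicalCurve) {u : h.U} {p : ℝ × ℝ} :
    p ∈ h.map '' h.closedRay u ↔
      ∃ t : ℝ, 0 ≤ t ∧ p = h.pos (h.root u) + t • latticeVec (h.rayDir u) := by
  constructor
  · rintro ⟨x, hx, rfl⟩
    rcases hx with rfl | ⟨t, h0, rfl⟩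
    · exact ⟨0, le_rfl, by simp [map]⟩
    · exact ⟨t, h0.le, rfl⟩
  · rintro ⟨t, h0, rfl⟩
    rcases h0.eq_or_lt with rfl | h0
    · exact ⟨_, Or.inl rfl, by simp [map]⟩
    exact ⟨_, Or.inr ⟨t, h0, rfl⟩, rfl⟩

theorem mem_image_floorSet (h : PlaneTropicalCurve) {F : h.Floor} {p : ℝ × ℝ} :
    p ∈ h.map '' h.floorSet F ↔
      (∃ e, ¬ h.IsElevator e ∧ h.floorOf (h.fst e) = F ∧ p ∈ h.map '' h.closedEdge e) ∨
      ∃ u, ¬ h.IsUnboundedElevator u ∧ h.floorOf (h.root u) = F ∧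
        p ∈ h.map '' h.closedRay u := by
  constructor
  · rintro ⟨x, ⟨e, h1, h2, h3⟩ | ⟨u, h1, h2, h3⟩, rfl⟩
    · exact Or.inl ⟨e, h1, h2, x, h3, rfl⟩
    · exact Or.inr ⟨u, h1, h2, x, h3, rfl⟩
  · rintro (⟨e, h1, h2, x, h3, rfl⟩ | ⟨u, h1, h2, x, h3, rfl⟩)
    · exact ⟨x, Or.inl ⟨e, h1, h2, h3⟩, rfl⟩
    · exact ⟨x, Or.inr ⟨u, h1, h2, h3⟩, rfl⟩

theorem exists_edge_or_ray_at (h : PlaneTropicalCurve) (v : h.V) :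
    (∃ e, h.fst e = v) ∨ (∃ e, h.snd e = v) ∨ ∃ u, h.root u = v := by
  by_contra hcon
  push Not at hcon
  obtain ⟨h1, h2, h3⟩ := hcon
  have := h.three_le_valency v
  have e1 : IsEmpty {e // h.fst e = v} := ⟨fun e => h1 e.1 e.2⟩
  have e2 : IsEmpty {e // h.snd e = v} := ⟨fun e => h2 e.1 e.2⟩
  have e3 : IsEmpty {u // h.root u = v} := ⟨fun e => h3 e.1 e.2⟩
  simp at this

theorem mem_range_map (h : PlaneTropicalCurve) {p : ℝ × ℝ} :
    p ∈ Set.range h.map ↔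
      (∃ e, p ∈ h.map '' h.closedEdge e) ∨ ∃ u, p ∈ h.map '' h.closedRay u := by
  constructor
  · rintro ⟨x, rfl⟩
    cases x with
    | vertex v =>
      rcases h.exists_edge_or_ray_at v with ⟨e, rfl⟩ | ⟨e, rfl⟩ | ⟨u, rfl⟩
      · exact Or.inl ⟨e, _, Or.inl rfl, rfl⟩
      · exact Or.inl ⟨e, _, Or.inr (Or.inl rfl), rfl⟩
      · exact Or.inr ⟨u, _, Or.inl rfl, rfl⟩
    | onEdge e t h0 h1 => exact Or.inl ⟨e, _, Or.inr (Or.inr ⟨t, h0, h1, rfl⟩), rfl⟩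
    | onRay u t h0 => exact Or.inr ⟨u, _, Or.inr ⟨t, h0, rfl⟩, rfl⟩
  · rintro (⟨e, x, -, rfl⟩ | ⟨u, x, -, rfl⟩) <;> exact ⟨x, rfl⟩

theorem floorOf_fst_eq_snd (h : PlaneTropicalCurve) {e : h.E} (he : ¬ h.IsElevator e) :
    h.floorOf (h.fst e) = h.floorOf (h.snd e) :=
  Quotient.sound (Relation.EqvGen.rel _ _ ⟨e, he, rfl, rfl⟩)

/-! ### Invariance under isomorphism -/

/-- An isomorphism matches each edge together with its direction, or reverses both. -/
theorem Iso.orient {h k : PlaneTropicalCurve} (f : Iso h k) (e : h.E) :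
    (k.fst (f.onE e) = f.onV (h.fst e) ∧ k.snd (f.onE e) = f.onV (h.snd e) ∧
      k.dir (f.onE e) = h.dir e) ∨
    (k.fst (f.onE e) = f.onV (h.snd e) ∧ k.snd (f.onE e) = f.onV (h.fst e) ∧
      k.dir (f.onE e) = -h.dir e) := by
  have hl := (h.len_pos e).ne'
  have h1 := k.pos_snd (f.onE e)
  have h2 := h.pos_snd e
  rw [f.len_eq] at h1
  rcases Sym2.eq_iff.1 (f.ends_eq e) with ⟨ha, hb⟩ | ⟨ha, hb⟩
  · refine Or.inl ⟨ha, hb, latticeVec_injective ?_⟩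
    rw [ha, hb, f.pos_eq, f.pos_eq, h2] at h1
    exact (smul_right_injective _ hl (add_left_cancel h1)).symm
  · refine Or.inr ⟨ha, hb, latticeVec_injective ?_⟩
    rw [ha, hb, f.pos_eq, f.pos_eq, h2, add_assoc] at h1
    have h3 := eq_neg_of_add_eq_zero_right (left_eq_add.1 h1)
    rw [← smul_neg, ← latticeVec_neg] at h3
    rw [smul_right_injective _ hl h3]

theorem image_closedEdge_eq_segment (h : PlaneTropicalCurve) (e : h.E) :
    h.map '' h.closedEdge e = segment ℝ (h.pos (h.fst e)) (h.pos (h.snd e)) := by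
  ext p
  have hl := h.len_pos e
  rw [mem_image_closedEdge, segment_eq_image']
  constructor
  · rintro ⟨t, h0, h1, rfl⟩
    refine ⟨t / h.len e, ⟨by positivity, (div_le_one hl).2 h1⟩, ?_⟩
    simp only [h.pos_snd, add_sub_cancel_left, smul_smul]
    rw [div_mul_cancel₀ _ hl.ne']
  · rintro ⟨t, ⟨h0, h1⟩, rfl⟩
    refine ⟨t * h.len e, by positivity, by nlinarith, ?_⟩
    simp only [h.pos_snd, add_sub_cancel_left, smul_smul]

namespace Iso

variable {h k : PlaneTropicalCurve} (f : Iso h k)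

theorem image_closedEdge (e : h.E) :
    k.map '' k.closedEdge (f.onE e) = h.map '' h.closedEdge e := by
  rw [image_closedEdge_eq_segment, image_closedEdge_eq_segment]
  rcases f.orient e with ⟨h1, h2, -⟩ | ⟨h1, h2, -⟩
  · rw [h1, h2, f.pos_eq, f.pos_eq]
  · rw [h1, h2, f.pos_eq, f.pos_eq, segment_symm]

theorem image_closedRay (u : h.U) :
    k.map '' k.closedRay (f.onU u) = h.map '' h.closedRay u := by
  ext p
  rw [mem_image_closedRay, mem_image_closedRay, f.root_eq, f.pos_eq, f.rayDir_eq]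

theorem isElevator_iff (e : h.E) : k.IsElevator (f.onE e) ↔ h.IsElevator e := by
  unfold IsElevator
  rcases f.orient e with ⟨-, -, h3⟩ | ⟨-, -, h3⟩ <;> simp [h3]

theorem isUnboundedElevator_iff (u : h.U) :
    k.IsUnboundedElevator (f.onU u) ↔ h.IsUnboundedElevator u := by
  unfold IsUnboundedElevator
  rw [f.rayDir_eq]

theorem edgeWeight_eq (e : h.E) : k.edgeWeight (f.onE e) = h.edgeWeight e := by
  unfold edgeWeight
  rcases f.orient e with ⟨-, -, h3⟩ | ⟨-, -, h3⟩ <;> simp [h3]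

theorem upper_lower_eq {e : h.E} (he : h.IsElevator e) :
    k.upper (f.onE e) = f.onV (h.upper e) ∧ k.lower (f.onE e) = f.onV (h.lower e) := by
  have hne : (h.dir e).2 ≠ 0 := fun h0 => h.dir_ne_zero e (Prod.ext he h0)
  unfold upper lower
  rcases f.orient e with ⟨h1, h2, h3⟩ | ⟨h1, h2, h3⟩
  · rw [h1, h2, h3]
    split_ifs <;> simp
  · rw [h1, h2, h3]
    simp only [Prod.snd_neg, Left.neg_neg_iff]
    split_ifs <;> first | omega | simp

theorem floorSetoid_iff (a b : h.V) :
    h.floorSetoid a b ↔ k.floorSetoid (f.onV a) (f.onV b) := by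
  constructor
  · intro hab
    induction hab with
    | rel x y hxy =>
      obtain ⟨e, he, rfl, rfl⟩ := hxy
      have he2 : ¬ k.IsElevator (f.onE e) := by rwa [f.isElevator_iff]
      rcases f.orient e with ⟨h1, h2, -⟩ | ⟨h1, h2, -⟩
      · exact .rel _ _ ⟨_, he2, h1, h2⟩
      · exact .symm _ _ (.rel _ _ ⟨_, he2, h1, h2⟩)
    | refl x => exact .refl _
    | symm x y _ ih => exact .symm _ _ ih
    | trans x y z _ _ ih1 ih2 => exact .trans _ _ _ ih1 ih2
  · have key : ∀ a b : k.V, k.floorSetoid a b → h.floorSetoid (f.onV.symm a) (f.onV.symm b) := by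
      intro a b hab
      induction hab with
      | rel x y hxy =>
        obtain ⟨e, he, rfl, rfl⟩ := hxy
        obtain ⟨e, rfl⟩ := f.onE.surjective e
        have he2 : ¬ h.IsElevator e := by rwa [f.isElevator_iff] at he
        rcases f.orient e with ⟨h1, h2, -⟩ | ⟨h1, h2, -⟩
        · rw [h1, h2]
          exact .rel _ _ ⟨_, he2, by simp, by simp⟩
        · rw [h1, h2]
          exact .symm _ _ (.rel _ _ ⟨_, he2, by simp, by simp⟩)
      | refl x => exact .refl _
      | symm x y _ ih => exact .symm _ _ ih
      | trans x y z _ _ ih1 ih2 => exact .trans _ _ _ ih1 ih2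
    intro hab
    simpa using key _ _ hab

/-- The bijection of floors induced by an isomorphism. -/
def onFloor : h.Floor ≃ k.Floor := Quotient.congr f.onV f.floorSetoid_iff

theorem onFloor_floorOf (v : h.V) : f.onFloor (h.floorOf v) = k.floorOf (f.onV v) := rfl

theorem image_floorSet (F : h.Floor) :
    k.map '' k.floorSet (f.onFloor F) = h.map '' h.floorSet F := by
  ext p
  rw [mem_image_floorSet, mem_image_floorSet]
  refine or_congr ?_ ?_
  · rw [← f.onE.exists_congr_right]
    refine exists_congr fun e => ?_
    rw [f.isElevator_iff, f.image_closedEdge]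
    refine and_congr_right fun he => and_congr_left fun _ => ?_
    rcases f.orient e with ⟨h1, -, -⟩ | ⟨h1, -, -⟩
    · rw [h1, ← onFloor_floorOf, f.onFloor.apply_eq_iff_eq]
    · rw [h1, ← onFloor_floorOf, f.onFloor.apply_eq_iff_eq, h.floorOf_fst_eq_snd he]
  · rw [← f.onU.exists_congr_right]
    refine exists_congr fun u => ?_
    rw [f.isUnboundedElevator_iff, f.image_closedRay, f.root_eq, ← onFloor_floorOf,
      f.onFloor.apply_eq_iff_eq]

/-- The isomorphism of floor diagrams induced by an isomorphism of curves. -/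
def onFloorDiagram : h.floorDiagram.Iso k.floorDiagram where
  onV := f.onFloor
  onE := f.onE.subtypeEquiv fun e => (f.isElevator_iff e).symm
  src_eq e := congrArg k.floorOf (f.upper_lower_eq e.2).1
  tgt_eq e := congrArg k.floorOf (f.upper_lower_eq e.2).2
  wt_eq e := f.edgeWeight_eq e.1

theorem inducesMarking {h k : PlaneTropicalCurve} (f : Iso h k) {N d g : ℕ} {P : Fin N → ℝ × ℝ}
    {M : FloorMarking d g} (hM : h.InducesMarking P M) : k.InducesMarking P M := by
  obtain ⟨j, l, pt, h1, h2, h3, h4, h5, h6⟩ := hM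
  let fu : {u // h.IsUnboundedElevator u} ≃ {u // k.IsUnboundedElevator u} :=
    f.onU.subtypeEquiv fun u => (f.isUnboundedElevator_iff u).symm
  let fe : {e // h.IsElevator e} ≃ {e // k.IsElevator e} :=
    f.onE.subtypeEquiv fun e => (f.isElevator_iff e).symm
  refine ⟨f.onFloorDiagram.symm.trans j, fu.symm.trans l, pt, ?_, ?_, ?_, ?_, ?_, h6⟩
  · intro u
    obtain ⟨u, rfl⟩ := fu.surjective u
    have h7 : k.floorOf (k.root (fu u).1) = f.onFloor (h.floorOf (h.root u)) :=
      congrArg k.floorOf (f.root_eq u)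
    rw [Equiv.trans_apply, Equiv.symm_apply_apply, h1, h7]
    exact (congrArg j.onV (f.onFloor.symm_apply_apply _)).symm
  · intro u
    obtain ⟨u, rfl⟩ := fu.surjective u
    have : k.rayDir (fu u).1 = h.rayDir u := f.rayDir_eq u
    unfold rayWeight
    rw [this]
    exact h2 u
  · intro F i
    obtain ⟨F, rfl⟩ := f.onFloor.surjective F
    rw [f.image_floorSet, h3]
    have h7 : (f.onFloorDiagram.symm.trans j).onV (f.onFloor F) = j.onV F :=
      congrArg j.onV (f.onFloor.symm_apply_apply F)
    exact iff_of_eq (congrArg (fun z => i = pt (.orig z)) h7.symm)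
  · intro e i
    obtain ⟨e, rfl⟩ := fe.surjective e
    have h8 : k.map '' k.closedEdge (fe e).1 = _ := f.image_closedEdge e.1
    have h7 : (f.onFloorDiagram.symm.trans j).onE (fe e) = j.onE e :=
      congrArg j.onE (fe.symm_apply_apply e)
    rw [h8]
    exact (h4 e i).trans (iff_of_eq (congrArg (fun z => i = pt (.mid z)) h7.symm))
  · intro u i
    obtain ⟨u, rfl⟩ := fu.surjective u
    have h8 : k.map '' k.closedRay (fu u).1 = _ := f.image_closedRay u.1
    have h7 : (fu.symm.trans l) (fu u) = l u := congrArg l (fu.symm_apply_apply u)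
    rw [h8]
    exact (h5 u i).trans (iff_of_eq (congrArg (fun z => i = pt (.leaf z.1 z.2)) h7.symm))

end Iso

end PlaneTropicalCurve

/-! ### Orienting the edges rightwards and downwards -/

namespace PlaneTropicalCurve

/-- An integer vector that points to the right, or straight down. -/
def PointsRightOrDown (v : ℤ × ℤ) : Prop := 0 < v.1 ∨ v.1 = 0 ∧ v.2 < 0

instance : DecidablePred PointsRightOrDown :=
  fun v => inferInstanceAs (Decidable (0 < v.1 ∨ v.1 = 0 ∧ v.2 < 0))

theorem PointsRightOrDown.neg {v : ℤ × ℤ} (h0 : v ≠ 0) (hv : ¬ PointsRightOrDown v) :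
    PointsRightOrDown (-v) := by
  unfold PointsRightOrDown at *
  simp only [Prod.fst_neg, Prod.snd_neg]
  by_contra hcon
  exact h0 (Prod.ext (by simp; omega) (by simp; omega))

/-- All bounded edges are parametrized from left to right, and the bounded elevators
downwards. Every plane tropical curve is isomorphic to a normalized one. -/
def IsNormalized (h : PlaneTropicalCurve) : Prop := ∀ e, PointsRightOrDown (h.dir e)

open Classical in
theorem natCard_fiber {α β : Type} [Fintype α] (f : α → β) (b : β) :
    Nat.card {a // f a = b} = ∑ a, if f a = b then 1 else 0 := by
  rw [Nat.card_eq_fintype_card, Fintype.card_subtype, Finset.card_filter]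

open Classical in
/-- The same curve with the parametrization of some bounded edges reversed so that it becomes
normalized. -/
noncomputable def reorient (h : PlaneTropicalCurve) : PlaneTropicalCurve where
  V := h.V
  E := h.E
  U := h.U
  fst e := if PointsRightOrDown (h.dir e) then h.fst e else h.snd e
  snd e := if PointsRightOrDown (h.dir e) then h.snd e else h.fst e
  root := h.root
  len := h.len
  fst_ne_snd e := by
    split_ifs
    exacts [h.fst_ne_snd e, (h.fst_ne_snd e).symm]
  len_pos := h.len_pos
  three_le_valency v := by
    have h3 := h.three_le_valency v
    rw [natCard_fiber, natCard_fiber, ← Finset.sum_add_distrib] at h3 ⊢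
    convert h3 using 3 with e
    split_ifs <;> simp_all
  pos := h.pos
  dir e := if PointsRightOrDown (h.dir e) then h.dir e else -h.dir e
  rayDir := h.rayDir
  dir_ne_zero e := by
    split_ifs
    exacts [h.dir_ne_zero e, neg_ne_zero.2 (h.dir_ne_zero e)]
  rayDir_ne_zero := h.rayDir_ne_zero
  pos_snd e := by
    split_ifs
    · exact h.pos_snd e
    · rw [h.pos_snd e, latticeVec_neg, smul_neg, add_neg_cancel_right]
  balanced v := by
    have h3 := h.balanced v
    rw [Finset.sum_filter, Finset.sum_filter, ← Finset.sum_add_distrib] at h3 ⊢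
    refine Eq.trans ?_ h3
    congr 1
    refine Finset.sum_congr rfl fun e _ => ?_
    by_cases h1 : PointsRightOrDown (h.dir e)
    · simp [h1]
    · simp [h1, add_comm]

theorem isNormalized_reorient (h : PlaneTropicalCurve) : h.reorient.IsNormalized := by
  intro e
  change PointsRightOrDown (if PointsRightOrDown (h.dir e) then h.dir e else -h.dir e)
  split_ifs with h1
  exacts [h1, .neg (h.dir_ne_zero e) h1]

/-- The identity, as an isomorphism from a curve to its normalization. -/
noncomputable def isoReorient (h : PlaneTropicalCurve) : Iso h h.reorient where
  onV := .refl _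
  onE := .refl _
  onU := .refl _
  ends_eq e := by
    change s(if PointsRightOrDown (h.dir e) then h.fst e else h.snd e,
      if PointsRightOrDown (h.dir e) then h.snd e else h.fst e) = s(h.fst e, h.snd e)
    split_ifs
    exacts [rfl, Sym2.eq_swap]
  root_eq _ := rfl
  len_eq _ := rfl
  pos_eq _ := rfl
  rayDir_eq _ := rfl

theorem toSimple_reorient (h : PlaneTropicalCurve) :
    h.reorient.toSimple = h.toSimple := by
  ext v w
  change (v ≠ w ∧ ((∃ e, _) ∨ ∃ e, _)) ↔ (v ≠ w ∧ ((∃ e, _) ∨ ∃ e, _))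
  refine and_congr_right fun _ => ?_
  rw [← exists_or, ← exists_or]
  refine exists_congr fun e => ?_
  have h1 : h.reorient.fst e = if PointsRightOrDown (h.dir e) then h.fst e else h.snd e := rfl
  have h2 : h.reorient.snd e = if PointsRightOrDown (h.dir e) then h.snd e else h.fst e := rfl
  rw [h1, h2]
  split_ifs
  · rfl
  · tauto

theorem IsCurveThrough.reorient {h : PlaneTropicalCurve} {d g N : ℕ} {P : Fin N → ℝ × ℝ}
    (hh : h.IsCurveThrough d g P) : h.reorient.IsCurveThrough d g P := by
  obtain ⟨h1, h2, h3, h4⟩ := hh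
  refine ⟨?_, h2, ?_, ?_⟩
  · unfold TropicalCurve.IsIrreducible
    rw [toSimple_reorient]
    exact h1
  · unfold TropicalCurve.genus
    rw [toSimple_reorient]
    exact h3
  · intro i
    have := h4 i
    rw [mem_range_map] at this ⊢
    rcases this with ⟨e, he⟩ | ⟨u, hu⟩
    · rw [← h.isoReorient.image_closedEdge e] at he
      exact Or.inl ⟨e, he⟩
    · rw [← h.isoReorient.image_closedRay u] at hu
      exact Or.inr ⟨u, hu⟩

/-! ### Balancing over sets of vertices -/

variable (h : PlaneTropicalCurve)

/-- The balancing conditions at the vertices of `S` add up to a balance of the edges that leave or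
enter `S` and of the rays that start in `S`. -/
theorem sum_dir_over_set (S : h.V → Prop) [DecidablePred S] :
    ∑ e, (((if S (h.fst e) then 1 else 0) - (if S (h.snd e) then 1 else 0) : ℤ)) • h.dir e +
      ∑ u, (if S (h.root u) then 1 else 0 : ℤ) • h.rayDir u = 0 := by
  classical
  have h1 : ∑ v with S v, ((∑ e with h.fst e = v, h.dir e) + (∑ e with h.snd e = v, -h.dir e) +
    (∑ u with h.root u = v, h.rayDir u)) = 0 :=
    Finset.sum_eq_zero fun v _ => by convert h.balanced v
  simp only [Finset.sum_add_distrib] at h1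
  have key : ∀ {α : Type} [Fintype α] (f : α → h.V) (k : α → ℤ × ℤ),
      ∑ v with S v, ∑ a with f a = v, k a = ∑ a, (if S (f a) then 1 else 0 : ℤ) • k a := by
    intro α _ f k
    simp only [Finset.sum_filter]
    have : ∀ v, (if S v then ∑ a, (if f a = v then k a else 0) else 0) =
        ∑ a, if f a = v then (if S (f a) then 1 else 0 : ℤ) • k a else 0 := by
      intro v
      split_ifs with hv
      · refine Finset.sum_congr rfl fun a _ => ?_
        split_ifs with h1 h2
        · simp
        · exact absurd (h1 ▸ hv) h2
        · rfl
      · symm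
        refine Finset.sum_eq_zero fun a _ => ?_
        split_ifs with h1 h2
        · exact absurd (h1 ▸ h2) hv
        · simp
        · rfl
    rw [Finset.sum_congr rfl fun v _ => this v, Finset.sum_comm]
    simp
  rw [key, key, key] at h1
  rw [← h1, ← Finset.sum_add_distrib]
  congr 1
  refine Finset.sum_congr rfl fun e _ => ?_
  rw [sub_smul, smul_neg, sub_eq_add_neg]

theorem sum_fst_over_set (S : h.V → Prop) [DecidablePred S] :
    ∑ e, (((if S (h.fst e) then 1 else 0) - (if S (h.snd e) then 1 else 0) : ℤ)) * (h.dir e).1 +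
      ∑ u, (if S (h.root u) then 1 else 0 : ℤ) * (h.rayDir u).1 = 0 := by
  have := congrArg Prod.fst (h.sum_dir_over_set S)
  simpa only [Prod.fst_add, Prod.fst_sum, Prod.smul_fst, smul_eq_mul, Prod.fst_zero] using this

theorem sum_snd_over_set (S : h.V → Prop) [DecidablePred S] :
    ∑ e, (((if S (h.fst e) then 1 else 0) - (if S (h.snd e) then 1 else 0) : ℤ)) * (h.dir e).2 +
      ∑ u, (if S (h.root u) then 1 else 0 : ℤ) * (h.rayDir u).2 = 0 := by
  have := congrArg Prod.snd (h.sum_dir_over_set S)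
  simpa only [Prod.snd_add, Prod.snd_sum, Prod.smul_snd, smul_eq_mul, Prod.snd_zero] using this

theorem sum_rayDir_fst : ∑ u, (h.rayDir u).1 = 0 := by
  simpa using h.sum_fst_over_set fun _ => True

theorem sum_rayDir_snd : ∑ u, (h.rayDir u).2 = 0 := by
  simpa using h.sum_snd_over_set fun _ => True

theorem fst_pos_snd (e : h.E) :
    (h.pos (h.snd e)).1 = (h.pos (h.fst e)).1 + h.len e * (h.dir e).1 := by
  rw [h.pos_snd]
  simp [latticeVec]

theorem snd_pos_snd (e : h.E) :
    (h.pos (h.snd e)).2 = (h.pos (h.fst e)).2 + h.len e * (h.dir e).2 := by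
  rw [h.pos_snd]
  simp [latticeVec]

/-! ### Slopes are bounded by the degree -/

/-- The upward momentum through a horizontal line just above the lower endpoint of `e` is at most
the momentum of the rays, which is bounded by the degree. -/
theorem abs_dir_snd_le_degree (e : h.E) : |(h.dir e).2| ≤ h.degree := by
  classical
  set c := min (h.pos (h.fst e)).2 (h.pos (h.snd e)).2 with hc
  have hcut := h.sum_snd_over_set fun v => (h.pos v).2 ≤ c
  -- Every edge that leaves the set of vertices up to height `c` goes upwards, every edge that
  -- enters it comes from above; so no term is negative, and the term of `e` is `|q|`.
  have hterm : ∀ e', 0 ≤ (((if (h.pos (h.fst e')).2 ≤ c then 1 else 0) -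
      (if (h.pos (h.snd e')).2 ≤ c then 1 else 0) : ℤ)) * (h.dir e').2 := by
    intro e'
    have h1 := h.snd_pos_snd e'
    have hl := h.len_pos e'
    split_ifs with h2 h3 h3
    · simp
    · have : 0 < h.len e' * (h.dir e').2 := by linarith
      have : (0 : ℝ) < (h.dir e').2 := pos_of_mul_pos_right this hl.le
      have : 0 < (h.dir e').2 := by exact_mod_cast this
      simpa using this.le
    · have : h.len e' * (h.dir e').2 < 0 := by linarith
      have : ((h.dir e').2 : ℝ) < 0 := by nlinarith
      have : (h.dir e').2 < 0 := by exact_mod_cast this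
      simpa using this.le
    · simp
  have hthis : |(h.dir e).2| ≤ (((if (h.pos (h.fst e)).2 ≤ c then 1 else 0) -
      (if (h.pos (h.snd e)).2 ≤ c then 1 else 0) : ℤ)) * (h.dir e).2 := by
    have h1 := h.snd_pos_snd e
    have hl := h.len_pos e
    rcases lt_trichotomy (h.dir e).2 0 with h2 | h2 | h2
    · have h3 : ((h.dir e).2 : ℝ) < 0 := by exact_mod_cast h2
      have h4 : h.len e * (h.dir e).2 < 0 := mul_neg_of_pos_of_neg hl h3
      rw [min_eq_right (by linarith)] at hc
      rw [if_neg (by rw [hc]; linarith), if_pos hc.ge, abs_of_neg h2]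
      simp
    · simp [h2]
    · have h3 : (0 : ℝ) < (h.dir e).2 := by exact_mod_cast h2
      have h4 : 0 < h.len e * (h.dir e).2 := mul_pos hl h3
      rw [min_eq_left (by linarith)] at hc
      rw [if_pos hc.ge, if_neg (by rw [hc]; linarith), abs_of_pos h2]
      simp
  have hsum := Finset.single_le_sum (fun e' _ => hterm e') (Finset.mem_univ e)
  -- Only the rays that go down contribute to the left side, and all vertical momenta of rays
  -- add up to zero.
  have hrays : -∑ u, (if (h.pos (h.root u)).2 ≤ c then 1 else 0 : ℤ) * (h.rayDir u).2 ≤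
      h.degree + -∑ u, (h.rayDir u).2 := by
    unfold degree
    rw [← Finset.sum_neg_distrib, ← Finset.sum_neg_distrib, ← Finset.sum_add_distrib]
    refine Finset.sum_le_sum fun u _ => ?_
    split_ifs <;> grind
  rw [h.sum_rayDir_snd] at hrays
  linarith

theorem abs_rayDir_snd_le_degree (u : h.U) : |(h.rayDir u).2| ≤ h.degree := by
  have h1 : max (max (h.rayDir u).1 (h.rayDir u).2) 0 ≤ h.degree :=
    Finset.single_le_sum (f := fun u => max (max (h.rayDir u).1 (h.rayDir u).2) 0)
      (fun _ _ => le_max_right _ _) (Finset.mem_univ u)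
  have h2 : max (max (h.rayDir u).1 (h.rayDir u).2) 0 - (h.rayDir u).2 ≤
      ∑ u, (max (max (h.rayDir u).1 (h.rayDir u).2) 0 - (h.rayDir u).2) :=
    Finset.single_le_sum (f := fun u => max (max (h.rayDir u).1 (h.rayDir u).2) 0 -
      (h.rayDir u).2) (fun _ _ => by simp) (Finset.mem_univ u)
  rw [Finset.sum_sub_distrib, h.sum_rayDir_snd, sub_zero] at h2
  change _ ≤ h.degree at h2
  grind

end PlaneTropicalCurve

/-! ### Strands and their crossings with vertical lines -/

namespace PlaneTropicalCurve

variable (h : PlaneTropicalCurve)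

/-- The initial vertex of a bounded edge or of a ray. -/
def strandBase : h.E ⊕ h.U → h.V := Sum.elim h.fst h.root

/-- The direction of a bounded edge or of a ray at its initial vertex. -/
def strandDir : h.E ⊕ h.U → ℤ × ℤ := Sum.elim h.dir h.rayDir

/-- The height over `c` of the line that supports a bounded edge or a ray. It is meaningful only
if the edge is not an elevator. -/
noncomputable def strandHeight (κ : h.E ⊕ h.U) (c : ℝ) : ℝ :=
  (h.pos (h.strandBase κ)).2 +
    (c - (h.pos (h.strandBase κ)).1) * ((h.strandDir κ).2 / (h.strandDir κ).1)

/-- The line over `c` meets the given edge or ray, which is not an elevator; right endpoints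
do not count, so that at a vertex over `c` only the edges going to the right cross. -/
def Crosses : h.E ⊕ h.U → ℝ → Prop
  | .inl e, c => 0 < (h.dir e).1 ∧ (h.pos (h.fst e)).1 ≤ c ∧ c < (h.pos (h.snd e)).1
  | .inr u, c => 0 < (h.rayDir u).1 ∧ (h.pos (h.root u)).1 ≤ c ∨
      (h.rayDir u).1 < 0 ∧ c < (h.pos (h.root u)).1

open Classical in
/-- The horizontal momentum of the rays of a floor that go to the left. -/
noncomputable def leftFlux (F : h.Floor) : ℤ :=
  ∑ u with h.floorOf (h.root u) = F, max (-(h.rayDir u).1) 0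

/-- All edges and rays at `v` are vertical. -/
def OnElevatorsOnly (v : h.V) : Prop :=
  (∀ e, h.fst e = v → h.IsElevator e) ∧ (∀ e, h.snd e = v → h.IsElevator e) ∧
    ∀ u, h.root u = v → h.IsUnboundedElevator u

variable {h}

theorem Crosses.fst_ne_zero {κ : h.E ⊕ h.U} {c : ℝ} (hc : h.Crosses κ c) :
    (h.strandDir κ).1 ≠ 0 := by
  rcases κ with e | u
  · exact hc.1.ne'
  · rcases hc with hc | hc
    exacts [hc.1.ne', hc.1.ne]

theorem IsNormalized.dir_fst_nonneg (hn : h.IsNormalized) (e : h.E) : 0 ≤ (h.dir e).1 := by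
  rcases hn e with h1 | h1
  exacts [h1.le, h1.1.ge]

theorem IsNormalized.dir_fst_pos (hn : h.IsNormalized) {e : h.E} (he : ¬ h.IsElevator e) :
    0 < (h.dir e).1 :=
  (hn.dir_fst_nonneg e).lt_of_ne (Ne.symm he)

theorem IsNormalized.dir_snd_neg (hn : h.IsNormalized) {e : h.E} (he : h.IsElevator e) :
    (h.dir e).2 < 0 := by
  rcases hn e with h1 | h1
  exacts [absurd he h1.ne', h1.2]

theorem fst_pos_lt_of_dir_pos {e : h.E} (he : 0 < (h.dir e).1) :
    (h.pos (h.fst e)).1 < (h.pos (h.snd e)).1 := by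
  rw [h.fst_pos_snd]
  have := h.len_pos e
  have : (0 : ℝ) < (h.dir e).1 := by exact_mod_cast he
  have := mul_pos (h.len_pos e) this
  linarith

theorem fst_pos_eq_of_isElevator {e : h.E} (he : h.IsElevator e) :
    (h.pos (h.snd e)).1 = (h.pos (h.fst e)).1 := by
  have : (h.dir e).1 = 0 := he
  rw [h.fst_pos_snd, this]
  simp

open Classical in
/-- The edges and rays of a floor that cross a vertical line, counted with their horizontal
momenta, have the same total as the rays going to the left. -/
theorem IsNormalized.sum_crosses (hn : h.IsNormalized) (F : h.Floor) (c : ℝ) :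
    ∑ κ with h.floorOf (h.strandBase κ) = F ∧ h.Crosses κ c, |(h.strandDir κ).1| =
      h.leftFlux F := by
  -- Balance the part of the floor on the left of the line, and the whole floor. Elevators carry
  -- no horizontal momentum, so only edges and rays of the floor itself matter.
  have h1 := h.sum_fst_over_set fun v => h.floorOf v = F ∧ (h.pos v).1 ≤ c
  have h2 := h.sum_fst_over_set fun v => h.floorOf v = F
  have h3 : ∑ e, (((if h.floorOf (h.fst e) = F then 1 else 0) -
      (if h.floorOf (h.snd e) = F then 1 else 0) : ℤ)) * (h.dir e).1 = 0 := by
    refine Finset.sum_eq_zero fun e _ => ?_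
    by_cases he : h.IsElevator e
    · simp [show (h.dir e).1 = 0 from he]
    · simp [h.floorOf_fst_eq_snd he]
  rw [h3, zero_add] at h2
  rw [leftFlux, Finset.sum_filter, Finset.sum_filter, Fintype.sum_sum_type]
  have h4 : ∀ e, (if h.floorOf (h.strandBase (.inl e)) = F ∧ h.Crosses (.inl e) c then
      |(h.strandDir (.inl e)).1| else 0) =
      (((if h.floorOf (h.fst e) = F ∧ (h.pos (h.fst e)).1 ≤ c then 1 else 0) -
      (if h.floorOf (h.snd e) = F ∧ (h.pos (h.snd e)).1 ≤ c then 1 else 0) : ℤ)) *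
        (h.dir e).1 := by
    intro e
    simp only [strandBase, strandDir, Crosses, Sum.elim_inl]
    by_cases he : h.IsElevator e
    · simp [show (h.dir e).1 = 0 from he]
    · have hp := hn.dir_fst_pos he
      have hx := fst_pos_lt_of_dir_pos hp
      have hfl := h.floorOf_fst_eq_snd he
      rw [abs_of_pos hp]
      by_cases hF : h.floorOf (h.snd e) = F
      · by_cases h5 : (h.pos (h.snd e)).1 ≤ c
        · have h6 : (h.pos (h.fst e)).1 ≤ c := by linarith
          simp [hfl, hF, h5, h6]
        · have h7 := not_le.1 h5
          by_cases h6 : (h.pos (h.fst e)).1 ≤ c <;>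
            simp [hfl, hF, h5, h6, h7, hp]
      · simp [hfl, hF]
  have h5 : ∀ u, (if h.floorOf (h.strandBase (.inr u)) = F ∧ h.Crosses (.inr u) c then
      |(h.strandDir (.inr u)).1| else 0) =
      (if h.floorOf (h.root u) = F ∧ (h.pos (h.root u)).1 ≤ c then 1 else 0) *
        (h.rayDir u).1 + (if h.floorOf (h.root u) = F then max (-(h.rayDir u).1) 0 else 0) := by
    intro u
    simp only [strandBase, strandDir, Crosses, Sum.elim_inr]
    by_cases hF : h.floorOf (h.root u) = F
    · rcases lt_trichotomy (h.rayDir u).1 0 with hp | hp | hp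
      · have : ¬ 0 < (h.rayDir u).1 := by omega
        rw [abs_of_neg hp, max_eq_left (by omega)]
        by_cases h6 : (h.pos (h.root u)).1 ≤ c
        · simp [hF, h6, this]
        · simp [hF, h6, hp, not_le.1 h6]
      · simp [hp]
      · have : ¬ (h.rayDir u).1 < 0 := by omega
        rw [abs_of_pos hp, max_eq_right (by omega)]
        by_cases h6 : (h.pos (h.root u)).1 ≤ c
        · simp [hF, h6, hp]
        · simp [hF, h6, this]
    · simp [hF]
  rw [Finset.sum_congr rfl fun e _ => h4 e, Finset.sum_congr rfl fun u _ => h5 u,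
    Finset.sum_add_distrib, ← add_assoc, h1, zero_add]

/-- At a vertex that is not only on elevators, some edge or ray goes to the right. -/
theorem IsNormalized.exists_right (hn : h.IsNormalized) {v : h.V} (hv : ¬ h.OnElevatorsOnly v) :
    ∃ κ, h.strandBase κ = v ∧ 0 < (h.strandDir κ).1 := by
  classical
  by_contra! hcon
  have h1 := h.sum_fst_over_set fun w => w = v
  have h2 : ∀ e ∈ Finset.univ, (((if h.fst e = v then 1 else 0) -
      (if h.snd e = v then 1 else 0) : ℤ)) * (h.dir e).1 ≤ 0 := by
    intro e _
    have h3 := hcon (.inl e)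
    have h4 := hn.dir_fst_nonneg e
    simp only [strandBase, strandDir, Sum.elim_inl] at h3
    by_cases h5 : h.fst e = v
    · simp [le_antisymm (h3 h5) h4]
    · rw [if_neg h5]
      split_ifs <;> simp [h4]
  have h3 : ∀ u ∈ Finset.univ, (if h.root u = v then 1 else 0 : ℤ) * (h.rayDir u).1 ≤ 0 := by
    intro u _
    have h3 := hcon (.inr u)
    simp only [strandBase, strandDir, Sum.elim_inr] at h3
    split_ifs with h5
    · simpa using h3 h5
    · simp
  have h4 := Finset.sum_nonpos h2
  have h5 := Finset.sum_nonpos h3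
  have h6 := (Finset.sum_eq_zero_iff_of_nonpos h2).1 (by omega)
  have h7 := (Finset.sum_eq_zero_iff_of_nonpos h3).1 (by omega)
  refine hv ⟨fun e he => ?_, fun e he => ?_, fun u hu => ?_⟩
  · exact le_antisymm (hcon (.inl e) he) (hn.dir_fst_nonneg e)
  · have := h6 e (Finset.mem_univ _)
    have h8 : h.fst e ≠ v := fun h8 => h.fst_ne_snd e (h8.trans he.symm)
    rw [if_pos he, if_neg h8] at this
    simpa [IsElevator] using this
  · have := h7 u (Finset.mem_univ _)
    rw [if_pos hu] at this
    simpa [IsUnboundedElevator] using this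

/-- At a vertex that is not only on elevators, some edge or ray goes to the left. -/
theorem IsNormalized.exists_left (hn : h.IsNormalized) {v : h.V} (hv : ¬ h.OnElevatorsOnly v) :
    (∃ e, h.snd e = v ∧ ¬ h.IsElevator e) ∨ ∃ u, h.root u = v ∧ (h.rayDir u).1 < 0 := by
  classical
  by_contra! hcon
  obtain ⟨hc1, hc2⟩ := hcon
  have h1 := h.sum_fst_over_set fun w => w = v
  have h2 : ∀ e ∈ Finset.univ, 0 ≤ (((if h.fst e = v then 1 else 0) -
      (if h.snd e = v then 1 else 0) : ℤ)) * (h.dir e).1 := by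
    intro e _
    have h3 := hc1 e
    have h4 := hn.dir_fst_nonneg e
    by_cases h5 : h.snd e = v
    · simp [show (h.dir e).1 = 0 from h3 h5]
    · rw [if_neg h5]
      split_ifs <;> simp [h4]
  have h3 : ∀ u ∈ Finset.univ, 0 ≤ (if h.root u = v then 1 else 0 : ℤ) * (h.rayDir u).1 := by
    intro u _
    have h3 := hc2 u
    split_ifs with h5
    · simpa using h3 h5
    · simp
  have h4 := Finset.sum_nonneg h2
  have h5 := Finset.sum_nonneg h3
  have h6 := (Finset.sum_eq_zero_iff_of_nonneg h2).1 (by omega)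
  have h7 := (Finset.sum_eq_zero_iff_of_nonneg h3).1 (by omega)
  refine hv ⟨fun e he => ?_, hc1, fun u hu => ?_⟩
  · have := h6 e (Finset.mem_univ _)
    have h8 : h.snd e ≠ v := fun h8 => h.fst_ne_snd e (he.trans h8.symm)
    rw [if_pos he, if_neg h8] at this
    simpa [IsElevator] using this
  · have := h7 u (Finset.mem_univ _)
    rw [if_pos hu] at this
    simpa [IsUnboundedElevator] using this

/-! ### Walking along floors -/

theorem abs_slope_le_degree (κ : h.E ⊕ h.U) :
    |((h.strandDir κ).2 / (h.strandDir κ).1 : ℝ)| ≤ h.degree := by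
  have h1 : |(h.strandDir κ).2| ≤ h.degree := by
    rcases κ with e | u
    exacts [h.abs_dir_snd_le_degree e, h.abs_rayDir_snd_le_degree u]
  have h2 : |((h.strandDir κ).2 : ℝ)| ≤ h.degree := by exact_mod_cast h1
  rw [abs_div]
  refine le_trans ?_ h2
  rcases eq_or_ne (h.strandDir κ).1 0 with h3 | h3
  · simp [h3]
  · refine div_le_self (abs_nonneg _) ?_
    have : 1 ≤ |(h.strandDir κ).1| := Int.one_le_abs h3
    exact_mod_cast this

theorem abs_strandHeight_sub_le (κ : h.E ⊕ h.U) (a b : ℝ) :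
    |h.strandHeight κ a - h.strandHeight κ b| ≤ h.degree * |a - b| := by
  have : h.strandHeight κ a - h.strandHeight κ b =
      ((h.strandDir κ).2 / (h.strandDir κ).1 : ℝ) * (a - b) := by
    unfold strandHeight
    ring
  rw [this, abs_mul]
  exact mul_le_mul_of_nonneg_right (abs_slope_le_degree κ) (abs_nonneg _)

theorem strandHeight_base (κ : h.E ⊕ h.U) :
    h.strandHeight κ (h.pos (h.strandBase κ)).1 = (h.pos (h.strandBase κ)).2 := by
  simp [strandHeight]

theorem strandHeight_edge {e : h.E} (he : (h.dir e).1 ≠ 0) {t : ℝ} :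
    h.strandHeight (.inl e) ((h.pos (h.fst e)).1 + t * (h.dir e).1) =
      (h.pos (h.fst e)).2 + t * (h.dir e).2 := by
  have : ((h.dir e).1 : ℝ) ≠ 0 := by exact_mod_cast he
  simp only [strandHeight, strandBase, strandDir, Sum.elim_inl]
  field_simp
  ring

theorem strandHeight_ray {u : h.U} (hu : (h.rayDir u).1 ≠ 0) {t : ℝ} :
    h.strandHeight (.inr u) ((h.pos (h.root u)).1 + t * (h.rayDir u).1) =
      (h.pos (h.root u)).2 + t * (h.rayDir u).2 := by
  have : ((h.rayDir u).1 : ℝ) ≠ 0 := by exact_mod_cast hu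
  simp only [strandHeight, strandBase, strandDir, Sum.elim_inr]
  field_simp
  ring

theorem strandHeight_snd {e : h.E} (he : (h.dir e).1 ≠ 0) :
    h.strandHeight (.inl e) (h.pos (h.snd e)).1 = (h.pos (h.snd e)).2 := by
  rw [h.fst_pos_snd, h.snd_pos_snd, strandHeight_edge he]

/-- The points of an edge that is not an elevator lie on its supporting line, between the
endpoints. -/
theorem IsNormalized.point_on_edge (hn : h.IsNormalized) {e : h.E} (he : ¬ h.IsElevator e)
    {p : ℝ × ℝ} (hp : p ∈ h.map '' h.closedEdge e) :
    (h.pos (h.fst e)).1 ≤ p.1 ∧ p.1 ≤ (h.pos (h.snd e)).1 ∧ h.strandHeight (.inl e) p.1 = p.2 := by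
  obtain ⟨t, h0, h1, rfl⟩ := h.mem_image_closedEdge.1 hp
  have hpos : (0 : ℝ) < (h.dir e).1 := by exact_mod_cast hn.dir_fst_pos he
  simp only [Prod.fst_add, Prod.snd_add, Prod.smul_fst, Prod.smul_snd, latticeVec, smul_eq_mul]
  refine ⟨by nlinarith, ?_, strandHeight_edge he⟩
  rw [h.fst_pos_snd]
  nlinarith

theorem point_on_ray {u : h.U} (hu : ¬ h.IsUnboundedElevator u)
    {p : ℝ × ℝ} (hp : p ∈ h.map '' h.closedRay u) :
    (0 < (h.rayDir u).1 ∧ (h.pos (h.root u)).1 ≤ p.1 ∨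
      (h.rayDir u).1 < 0 ∧ p.1 ≤ (h.pos (h.root u)).1) ∧
      h.strandHeight (.inr u) p.1 = p.2 := by
  obtain ⟨t, h0, rfl⟩ := h.mem_image_closedRay.1 hp
  simp only [Prod.fst_add, Prod.snd_add, Prod.smul_fst, Prod.smul_snd, latticeVec, smul_eq_mul]
  refine ⟨?_, strandHeight_ray hu⟩
  rcases lt_or_gt_of_ne (show (h.rayDir u).1 ≠ 0 from hu) with h1 | h1
  · have : ((h.rayDir u).1 : ℝ) < 0 := by exact_mod_cast h1
    exact Or.inr ⟨h1, by nlinarith⟩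
  · have : (0 : ℝ) < (h.rayDir u).1 := by exact_mod_cast h1
    exact Or.inl ⟨h1, by nlinarith⟩

/-- Walking to the right from `v` inside its floor one reaches the vertical line over `c`, and
the height changes at most by the degree times the horizontal distance. -/
theorem IsNormalized.walk_right (hn : h.IsNormalized) {v : h.V} (hv : ¬ h.OnElevatorsOnly v)
    {c : ℝ} (hc : (h.pos v).1 ≤ c) :
    ∃ κ, h.floorOf (h.strandBase κ) = h.floorOf v ∧ h.Crosses κ c ∧
      |h.strandHeight κ c - (h.pos v).2| ≤ h.degree * (c - (h.pos v).1) := by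
  classical
  let A : Finset h.V := Finset.univ.filter fun w => ¬ h.OnElevatorsOnly w ∧
    h.floorOf w = h.floorOf v ∧ (h.pos v).1 ≤ (h.pos w).1 ∧ (h.pos w).1 ≤ c ∧
    |(h.pos w).2 - (h.pos v).2| ≤ h.degree * ((h.pos w).1 - (h.pos v).1)
  -- Start from the last vertex before the line that satisfies the estimate.
  obtain ⟨w, hw, hmax⟩ := A.exists_max_image (fun w => (h.pos w).1)
    ⟨v, by simp [A, hv, hc]⟩
  simp only [A, Finset.mem_filter, Finset.mem_univ, true_and] at hw hmax
  obtain ⟨hw0, hw1, hw2, hw3, hw4⟩ := hw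
  obtain ⟨κ, rfl, hκ⟩ := hn.exists_right hw0
  have hlip : ∀ b, (h.pos (h.strandBase κ)).1 ≤ b →
      |h.strandHeight κ b - (h.pos v).2| ≤ h.degree * (b - (h.pos v).1) := by
    intro b hb
    have h1 := abs_strandHeight_sub_le κ b (h.pos (h.strandBase κ)).1
    rw [strandHeight_base, abs_of_nonneg (sub_nonneg.2 hb)] at h1
    have h2 := abs_sub_le (h.strandHeight κ b) (h.pos (h.strandBase κ)).2 (h.pos v).2
    linarith
  rcases κ with e | u
  · have hne : ¬ h.IsElevator e := hκ.ne'
    have hx := fst_pos_lt_of_dir_pos (h := h) hκ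
    by_cases hs : (h.pos (h.snd e)).1 ≤ c
    · have h1 := hlip _ hx.le
      rw [strandHeight_snd hκ.ne'] at h1
      exact absurd (hmax (h.snd e) ⟨fun h2 => hne (h2.2.1 e rfl),
        (h.floorOf_fst_eq_snd hne).symm.trans hw1, hw2.trans hx.le, hs, h1⟩) (not_le.2 hx)
    · exact ⟨_, hw1, ⟨hκ, hw3, not_le.1 hs⟩, hlip _ hw3⟩
  · exact ⟨_, hw1, Or.inl ⟨hκ, hw3⟩, hlip _ hw3⟩

/-- The version of `walk_right` that starts from any point of a floor: follow its edge or ray up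
to the line, or up to the next vertex on the right if this comes first. -/
theorem IsNormalized.walk_right_of_mem_floor (hn : h.IsNormalized) {F : h.Floor} {p : ℝ × ℝ}
    (hp : p ∈ h.map '' h.floorSet F) {c : ℝ} (hc : p.1 ≤ c) :
    ∃ κ, h.floorOf (h.strandBase κ) = F ∧ h.Crosses κ c ∧
      |h.strandHeight κ c - p.2| ≤ h.degree * (c - p.1) := by
  have hvia : ∀ (κ : h.E ⊕ h.U) (v : h.V), ¬ h.OnElevatorsOnly v → h.floorOf v = F →
      h.strandHeight κ p.1 = p.2 → h.strandHeight κ (h.pos v).1 = (h.pos v).2 →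
      p.1 ≤ (h.pos v).1 → (h.pos v).1 ≤ c →
      ∃ κ, h.floorOf (h.strandBase κ) = F ∧ h.Crosses κ c ∧
        |h.strandHeight κ c - p.2| ≤ h.degree * (c - p.1) := by
    rintro κ v hv rfl h1 h2 h3 h4
    obtain ⟨κ', hF, hcr, hle⟩ := hn.walk_right hv h4
    refine ⟨κ', hF, hcr, ?_⟩
    have h5 := abs_strandHeight_sub_le κ (h.pos v).1 p.1
    rw [h1, h2, abs_of_nonneg (sub_nonneg.2 h3)] at h5
    have h6 := abs_sub_le (h.strandHeight κ' c) (h.pos v).2 p.2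
    linarith
  have hdirect : ∀ κ : h.E ⊕ h.U, h.floorOf (h.strandBase κ) = F → h.Crosses κ c →
      h.strandHeight κ p.1 = p.2 →
      ∃ κ, h.floorOf (h.strandBase κ) = F ∧ h.Crosses κ c ∧
        |h.strandHeight κ c - p.2| ≤ h.degree * (c - p.1) := by
    intro κ h1 h2 h3
    refine ⟨κ, h1, h2, ?_⟩
    have h5 := abs_strandHeight_sub_le κ c p.1
    rwa [h3, abs_of_nonneg (sub_nonneg.2 hc)] at h5
  rcases h.mem_image_floorSet.1 hp with ⟨e, he, hF, hpe⟩ | ⟨u, hu, hF, hpu⟩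
  · obtain ⟨h1, h2, h3⟩ := hn.point_on_edge he hpe
    by_cases h4 : (h.pos (h.snd e)).1 ≤ c
    · exact hvia (.inl e) (h.snd e) (fun h5 => he (h5.2.1 e rfl))
        ((h.floorOf_fst_eq_snd he).symm.trans hF) h3 (strandHeight_snd he) h2 h4
    · exact hdirect (.inl e) hF ⟨hn.dir_fst_pos he, h1.trans hc, not_le.1 h4⟩ h3
  · obtain ⟨h1 | h1, h3⟩ := point_on_ray hu hpu
    · exact hdirect (.inr u) hF (Or.inl ⟨h1.1, h1.2.trans hc⟩) h3
    · by_cases h4 : (h.pos (h.root u)).1 ≤ c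
      · exact hvia (.inr u) (h.root u) (fun h5 => hu (h5.2.2 u rfl)) hF h3
          (strandHeight_base (.inr u)) h1.2 h4
      · exact hdirect (.inr u) hF (Or.inr ⟨h1.1, not_le.1 h4⟩) h3

end PlaneTropicalCurve

/-! ### Counting floors, elevators and points -/

/-- A strip `[c - W, c]` that contains all points, such that the differences of their heights
exceed `2dW`. The constant comes from `2d ≤ d ^ 3 + d` for `1 ≤ d`. -/
theorem IsVerticallyStretched.exists_width {d g : ℕ} (hd : 0 < d)
    {P : Fin (3 * d - 1 + g) → ℝ × ℝ} (hP : IsVerticallyStretched d g P) :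
    ∃ c W : ℝ, (∀ i, (P i).1 ≤ c ∧ c - (P i).1 ≤ W) ∧ (∀ i j, |(P i).1 - (P j).1| ≤ W) ∧
      ∀ i j, i ≠ j → 2 * d * W < |(P i).2 - (P j).2| := by
  obtain ⟨hx, -, hs⟩ := hP
  let i0 : Fin (3 * d - 1 + g) := ⟨0, by omega⟩
  let i1 : Fin (3 * d - 1 + g) := ⟨3 * d - 1 + g - 1, by omega⟩
  have hle : ∀ i, (P i0).1 ≤ (P i).1 ∧ (P i).1 ≤ (P i1).1 := fun i =>
    ⟨hx.monotone (Fin.le_def.2 (Nat.zero_le _)),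
      hx.monotone (Fin.le_def.2 (Nat.le_sub_one_of_lt i.2))⟩
  have hne : i1 ≠ i0 := by
    intro h1
    have := congrArg Fin.val h1
    simp only [i0, i1] at this
    omega
  refine ⟨(P i1).1, (P i1).1 - (P i0).1, fun i => ⟨(hle i).2, by linarith [hle i]⟩,
    fun i j => abs_le.2 ⟨by linarith [hle i, hle j], by linarith [hle i, hle j]⟩, ?_⟩
  intro i j hij
  refine lt_of_le_of_lt ?_ (hs i j i1 i0 hij hne)
  rw [abs_of_nonneg (by linarith [hle i0])]
  refine mul_le_mul_of_nonneg_right ?_ (by linarith [hle i0])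
  have h1 : (1 : ℝ) ≤ d := by exact_mod_cast hd
  nlinarith [sq_nonneg ((d : ℝ) - 1), mul_nonneg (sub_nonneg.2 h1) (sub_nonneg.2 h1)]

namespace PlaneTropicalCurve

variable {h : PlaneTropicalCurve}

open Classical in
noncomputable instance : Fintype h.Floor := Fintype.ofSurjective h.floorOf Quotient.mk_surjective

theorem floorOf_surjective : Function.Surjective h.floorOf := Quotient.mk_surjective

theorem eq_of_floorOf_eq {α : Type} {f : h.V → α}
    (hf : ∀ e, ¬ h.IsElevator e → f (h.fst e) = f (h.snd e)) {v w : h.V}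
    (hvw : h.floorOf v = h.floorOf w) : f v = f w := by
  have h1 : h.floorSetoid v w := Quotient.exact hvw
  induction h1 with
  | rel x y hxy =>
    obtain ⟨e, he, rfl, rfl⟩ := hxy
    exact hf e he
  | refl x => rfl
  | symm x y hxy ih => exact (ih (Quotient.sound hxy)).symm
  | trans x y z h1 h2 ih1 ih2 =>
    exact (ih1 (Quotient.sound h1)).trans (ih2 (Quotient.sound h2))

variable (h)

open Classical in
/-- A graph has at least as many components as vertices minus edges: functions on the vertices
without variation along the edges descend to the set of components. -/
theorem card_vertex_le :
    Fintype.card h.V ≤ Fintype.card {e // ¬ h.IsElevator e} + Fintype.card h.Floor := by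
  -- The coboundary map, whose kernel is the space of functions that are constant on floors.
  let δ : (h.V → ℚ) →ₗ[ℚ] ({e // ¬ h.IsElevator e} → ℚ) :=
    LinearMap.funLeft ℚ ℚ (fun e => h.fst e.1) - LinearMap.funLeft ℚ ℚ (fun e => h.snd e.1)
  have h1 := δ.finrank_range_add_finrank_ker
  have h2 : Module.finrank ℚ (LinearMap.range δ) ≤ Fintype.card {e // ¬ h.IsElevator e} := by
    simpa using Submodule.finrank_le (LinearMap.range δ)
  have h3 : LinearMap.ker δ ≤ LinearMap.range (LinearMap.funLeft ℚ ℚ h.floorOf) := by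
    intro f hf
    have h4 : ∀ e, ¬ h.IsElevator e → f (h.fst e) = f (h.snd e) := fun e he =>
      sub_eq_zero.1 (congrFun (LinearMap.mem_ker.1 hf) ⟨e, he⟩)
    exact ⟨fun F => f F.out, funext fun v => eq_of_floorOf_eq h4 (Quotient.out_eq _)⟩
  have h4 : Module.finrank ℚ (LinearMap.ker δ) ≤ Fintype.card h.Floor := by
    refine (Submodule.finrank_mono h3).trans ?_
    simpa using LinearMap.finrank_range_le (LinearMap.funLeft ℚ ℚ h.floorOf)
  simp only [Module.finrank_fintype_fun_eq_card] at h1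
  omega

open Classical in
/-- The Euler characteristic of the graph obtained by collapsing the floors. -/
theorem card_elevator_add_one_le (hirr : h.IsIrreducible) {g : ℕ} (hg : h.genus = g) :
    Fintype.card {e // h.IsElevator e} + 1 ≤ g + Fintype.card h.Floor := by
  have h1 := h.card_vertex_le
  have h2 : Fintype.card {e // h.IsElevator e} + Fintype.card {e // ¬ h.IsElevator e} =
      Fintype.card h.E := by
    rw [← Fintype.card_sum]
    exact Fintype.card_congr (Equiv.sumCompl _)
  have h3 : Nat.card h.toSimple.ConnectedComponent = 1 := by
    have := hirr.preconnected.subsingleton_connectedComponent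
    have : Nonempty h.toSimple.ConnectedComponent :=
      hirr.nonempty.map h.toSimple.connectedComponentMk
    exact Nat.card_unique
  unfold TropicalCurve.genus at hg
  rw [h3] at hg
  omega

/-- The positive part of the horizontal momentum of the rays going to the left. -/
noncomputable def totalFlux : ℤ := ∑ u, max (-(h.rayDir u).1) 0

theorem sum_leftFlux : ∑ F, h.leftFlux F = h.totalFlux := by
  classical
  unfold leftFlux totalFlux
  convert Finset.sum_fiberwise (Finset.univ : Finset h.U) (fun u => h.floorOf (h.root u))
    fun u => max (-(h.rayDir u).1) 0

theorem sum_right_eq_totalFlux : ∑ u, max (h.rayDir u).1 0 = h.totalFlux := by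
  have h1 := h.sum_rayDir_fst
  have h2 : ∑ u, max (h.rayDir u).1 0 - h.totalFlux = 0 := by
    rw [← h1, totalFlux, ← Finset.sum_sub_distrib]
    exact Finset.sum_congr rfl fun u _ => by grind
  omega

theorem leftFlux_nonneg (F : h.Floor) : 0 ≤ h.leftFlux F :=
  Finset.sum_nonneg fun _ _ => le_max_right _ _

variable {h}

theorem IsNormalized.leftFlux_pos (hn : h.IsNormalized) {v : h.V} (hv : ¬ h.OnElevatorsOnly v) :
    0 < h.leftFlux (h.floorOf v) := by
  classical
  obtain ⟨κ, h1, h2, -⟩ := hn.walk_right hv le_rfl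
  rw [← hn.sum_crosses _ (h.pos v).1]
  refine lt_of_lt_of_le (abs_pos.2 h2.fst_ne_zero)
    (Finset.single_le_sum (f := fun κ => |(h.strandDir κ).1|) (fun _ _ => abs_nonneg _) ?_)
  simp [h1, h2]

open Classical in
/-- Each floor has a ray going to the left, unless it is degenerate and consists of vertices on
elevators only. -/
theorem IsNormalized.card_floor_le (hn : h.IsNormalized) :
    (Fintype.card h.Floor : ℤ) ≤ h.totalFlux + Fintype.card {v // h.OnElevatorsOnly v} := by
  have h1 : ∀ F : h.Floor, (1 : ℤ) ≤ h.leftFlux F +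
      (Finset.card {v | h.OnElevatorsOnly v ∧ h.floorOf v = F} : ℕ) := by
    intro F
    obtain ⟨v, rfl⟩ := floorOf_surjective F
    by_cases hv : h.OnElevatorsOnly v
    · have h2 := h.leftFlux_nonneg (h.floorOf v)
      have h3 : 0 < Finset.card {w | h.OnElevatorsOnly w ∧ h.floorOf w = h.floorOf v} :=
        Finset.card_pos.2 ⟨v, by simp [hv]⟩
      omega
    · have := hn.leftFlux_pos hv
      omega
  have h2 := Finset.sum_le_sum fun F (_ : F ∈ Finset.univ) => h1 F
  rw [Finset.sum_add_distrib, sum_leftFlux] at h2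
  have h3 : Fintype.card {v // h.OnElevatorsOnly v} =
      ∑ F, Finset.card {v | h.OnElevatorsOnly v ∧ h.floorOf v = F} := by
    rw [Fintype.card_subtype, Finset.card_eq_sum_card_fiberwise (f := h.floorOf)
      (t := Finset.univ) (by simp)]
    simp only [Finset.filter_filter]
  rw [h3]
  push_cast
  simpa using h2

/-! ### The budget of the rays -/

variable (h)

/-- The contribution of a ray to the degree. -/
def rayMax (u : h.U) : ℤ := max (max (h.rayDir u).1 (h.rayDir u).2) 0

theorem sum_rayMax_sub_fst : ∑ u, (h.rayMax u - max (h.rayDir u).1 0) = h.degree - h.totalFlux := by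
  rw [Finset.sum_sub_distrib, sum_right_eq_totalFlux]
  rfl

theorem sum_rayMax_sub_snd : ∑ u, (h.rayMax u - (h.rayDir u).2) = h.degree := by
  rw [Finset.sum_sub_distrib, sum_rayDir_snd, sub_zero]
  rfl

theorem rayMax_sub_fst_nonneg (u : h.U) : 0 ≤ h.rayMax u - max (h.rayDir u).1 0 := by
  unfold rayMax
  grind

theorem rayMax_sub_snd_nonneg (u : h.U) : 0 ≤ h.rayMax u - (h.rayDir u).2 := by
  unfold rayMax
  grind

theorem totalFlux_le_degree : h.totalFlux ≤ h.degree := by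
  have h1 := h.sum_rayMax_sub_fst
  have h2 := Finset.sum_nonneg fun u (_ : u ∈ Finset.univ) => h.rayMax_sub_fst_nonneg u
  omega

open Classical in
/-- A vertical ray contributes to `∑ (rayMax - p⁺) = d - φ` if it goes up and to
`∑ (rayMax - q) = d` if it goes down. -/
theorem card_unboundedElevator_le :
    (Fintype.card {u // h.IsUnboundedElevator u} : ℤ) ≤ 2 * h.degree - h.totalFlux := by
  have h1 : ∀ u, (if h.IsUnboundedElevator u then 1 else 0 : ℤ) ≤
      (h.rayMax u - max (h.rayDir u).1 0) + (h.rayMax u - (h.rayDir u).2) := by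
    intro u
    have h2 := h.rayMax_sub_fst_nonneg u
    have h3 := h.rayMax_sub_snd_nonneg u
    split_ifs with hu
    · have h4 : (h.rayDir u).1 = 0 := hu
      have h5 : (h.rayDir u).2 ≠ 0 := fun h5 => h.rayDir_ne_zero u (Prod.ext h4 h5)
      unfold rayMax
      grind
    · omega
  have h2 := Finset.sum_le_sum fun u (_ : u ∈ Finset.univ) => h1 u
  rw [Finset.sum_add_distrib, sum_rayMax_sub_fst, sum_rayMax_sub_snd] at h2
  rw [Fintype.card_subtype, Finset.card_filter]
  push_cast
  omega

/-! ### Points on elevators -/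

/-- Bounded and unbounded elevators. -/
abbrev Elevator : Type := {e // h.IsElevator e} ⊕ {u // h.IsUnboundedElevator u}

/-- The abscissa of an elevator. -/
def elevatorX : h.Elevator → ℝ := Sum.elim (fun e => (h.pos (h.fst e.1)).1)
  (fun u => (h.pos (h.root u.1)).1)

/-- The elevator as a subset of the plane. -/
def elevatorImage : h.Elevator → Set (ℝ × ℝ) := Sum.elim (fun e => h.map '' h.closedEdge e.1)
  (fun u => h.map '' h.closedRay u.1)

/-- The lower end of the elevator is a vertex that lies on elevators only. -/
def LowerEndOnElevators : h.Elevator → Prop := Sum.elim (fun e => h.OnElevatorsOnly (h.snd e.1))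
  (fun u => 0 < (h.rayDir u.1).2 ∧ h.OnElevatorsOnly (h.root u.1))

/-- The upper end of the elevator is a vertex that lies on elevators only. -/
def UpperEndOnElevators : h.Elevator → Prop := Sum.elim (fun e => h.OnElevatorsOnly (h.fst e.1))
  (fun u => (h.rayDir u.1).2 < 0 ∧ h.OnElevatorsOnly (h.root u.1))

variable {h}

theorem fst_eq_elevatorX {κ : h.Elevator} {p : ℝ × ℝ} (hp : p ∈ h.elevatorImage κ) :
    p.1 = h.elevatorX κ := by
  rcases κ with e | u
  · obtain ⟨t, -, -, rfl⟩ := h.mem_image_closedEdge.1 hp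
    have : (h.dir e.1).1 = 0 := e.2
    simp [elevatorX, latticeVec, this]
  · obtain ⟨t, -, rfl⟩ := h.mem_image_closedRay.1 hp
    have : (h.rayDir u.1).1 = 0 := u.2
    simp [elevatorX, latticeVec, this]

theorem rayDir_snd_ne_zero {u : h.U} (hu : h.IsUnboundedElevator u) : (h.rayDir u).2 ≠ 0 :=
  fun h5 => h.rayDir_ne_zero u (Prod.ext hu h5)

/-- Elevators at a vertex without other edges cannot all go up, by balancing. -/
theorem IsNormalized.exists_down (hn : h.IsNormalized) {v : h.V} (hv : h.OnElevatorsOnly v) :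
    (∃ e, h.fst e = v) ∨ ∃ u, h.root u = v ∧ (h.rayDir u).2 < 0 := by
  classical
  by_contra! hcon
  obtain ⟨hc1, hc2⟩ := hcon
  have h1 := h.sum_snd_over_set fun w => w = v
  have h2 : ∀ e ∈ Finset.univ, 0 ≤ (((if h.fst e = v then 1 else 0) -
      (if h.snd e = v then 1 else 0) : ℤ)) * (h.dir e).2 := by
    intro e _
    rw [if_neg (hc1 e)]
    split_ifs with h5
    · have := hn.dir_snd_neg (hv.2.1 e h5)
      simp [this.le]
    · simp
  have h3 : ∀ u ∈ Finset.univ, 0 ≤ (if h.root u = v then 1 else 0 : ℤ) * (h.rayDir u).2 := by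
    intro u _
    split_ifs with h5
    · simpa using hc2 u h5
    · simp
  have h4 := Finset.sum_nonneg h2
  have h5 := Finset.sum_nonneg h3
  have h6 := (Finset.sum_eq_zero_iff_of_nonneg h2).1 (by omega)
  have h7 := (Finset.sum_eq_zero_iff_of_nonneg h3).1 (by omega)
  rcases h.exists_edge_or_ray_at v with ⟨e, he⟩ | ⟨e, he⟩ | ⟨u, hu⟩
  · exact hc1 e he
  · have := h6 e (Finset.mem_univ _)
    rw [if_pos he, if_neg (hc1 e)] at this
    exact (hn.dir_snd_neg (hv.2.1 e he)).ne (by simpa using this)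
  · have := h7 u (Finset.mem_univ _)
    rw [if_pos hu] at this
    exact rayDir_snd_ne_zero (hv.2.2 u hu) (by simpa using this)

/-- Elevators at a vertex without other edges cannot all go down, by balancing. -/
theorem IsNormalized.exists_up (hn : h.IsNormalized) {v : h.V} (hv : h.OnElevatorsOnly v) :
    (∃ e, h.snd e = v) ∨ ∃ u, h.root u = v ∧ 0 < (h.rayDir u).2 := by
  classical
  by_contra! hcon
  obtain ⟨hc1, hc2⟩ := hcon
  have h1 := h.sum_snd_over_set fun w => w = v
  have h2 : ∀ e ∈ Finset.univ, (((if h.fst e = v then 1 else 0) -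
      (if h.snd e = v then 1 else 0) : ℤ)) * (h.dir e).2 ≤ 0 := by
    intro e _
    rw [if_neg (hc1 e)]
    split_ifs with h5
    · have := hn.dir_snd_neg (hv.1 e h5)
      simp [this.le]
    · simp
  have h3 : ∀ u ∈ Finset.univ, (if h.root u = v then 1 else 0 : ℤ) * (h.rayDir u).2 ≤ 0 := by
    intro u _
    split_ifs with h5
    · simpa using hc2 u h5
    · simp
  have h4 := Finset.sum_nonpos h2
  have h5 := Finset.sum_nonpos h3
  have h6 := (Finset.sum_eq_zero_iff_of_nonpos h2).1 (by omega)
  have h7 := (Finset.sum_eq_zero_iff_of_nonpos h3).1 (by omega)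
  rcases h.exists_edge_or_ray_at v with ⟨e, he⟩ | ⟨e, he⟩ | ⟨u, hu⟩
  · have := h6 e (Finset.mem_univ _)
    rw [if_pos he, if_neg (hc1 e)] at this
    exact (hn.dir_snd_neg (hv.1 e he)).ne (by simpa using this)
  · exact hc1 e he
  · have := h7 u (Finset.mem_univ _)
    rw [if_pos hu] at this
    exact rayDir_snd_ne_zero (hv.2.2 u hu) (by simpa using this)

theorem IsNormalized.snd_pos_lt (hn : h.IsNormalized) {e : h.E} (he : h.IsElevator e) :
    (h.pos (h.snd e)).2 < (h.pos (h.fst e)).2 := by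
  rw [h.snd_pos_snd]
  have : ((h.dir e).2 : ℝ) < 0 := by exact_mod_cast hn.dir_snd_neg he
  nlinarith [h.len_pos e]

/-- Descending along elevators one arrives at an elevator that ends on a floor or is unbounded
below. -/
theorem IsNormalized.exists_lowest (hn : h.IsNormalized) (κ : h.Elevator) :
    ∃ κ', ¬ h.LowerEndOnElevators κ' ∧ h.elevatorX κ' = h.elevatorX κ := by
  classical
  by_contra! hcon
  have hall : ∀ κ', h.elevatorX κ' = h.elevatorX κ → h.LowerEndOnElevators κ' :=
    fun κ' h1 => by_contra fun h2 => hcon κ' h2 h1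
  let A : Finset h.Elevator := Finset.univ.filter fun κ' => h.elevatorX κ' = h.elevatorX κ
  let low : h.Elevator → h.V := Sum.elim (fun e => h.snd e.1) (fun u => h.root u.1)
  obtain ⟨κ', hκ', hmin⟩ := A.exists_min_image (fun κ' => (h.pos (low κ')).2) ⟨κ, by simp [A]⟩
  simp only [A, Finset.mem_filter, Finset.mem_univ, true_and] at hκ' hmin
  have h1 : h.OnElevatorsOnly (low κ') ∧ (h.pos (low κ')).1 = h.elevatorX κ := by
    rw [← hκ']
    rcases κ' with e | u
    · exact ⟨hall _ hκ', fst_pos_eq_of_isElevator e.2⟩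
    · exact ⟨(hall _ hκ').2, rfl⟩
  rcases hn.exists_down h1.1 with ⟨e, he⟩ | ⟨u, hu, hneg⟩
  · have h2 := h1.1.1 e he
    have h3 := hmin (.inl ⟨e, h2⟩) (by rw [← h1.2, ← he]; rfl)
    have h4 := hn.snd_pos_lt h2
    rw [he] at h4
    exact absurd h3 (not_le.2 h4)
  · have h2 := h1.1.2.2 u hu
    have h3 := hall (.inr ⟨u, h2⟩) (by rw [← h1.2, ← hu]; rfl)
    exact absurd h3.1 (not_lt.2 hneg.le)

/-- Ascending along elevators one arrives at an elevator that ends on a floor or is unbounded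
above. -/
theorem IsNormalized.exists_highest (hn : h.IsNormalized) (κ : h.Elevator) :
    ∃ κ', ¬ h.UpperEndOnElevators κ' ∧ h.elevatorX κ' = h.elevatorX κ := by
  classical
  by_contra! hcon
  have hall : ∀ κ', h.elevatorX κ' = h.elevatorX κ → h.UpperEndOnElevators κ' :=
    fun κ' h1 => by_contra fun h2 => hcon κ' h2 h1
  let A : Finset h.Elevator := Finset.univ.filter fun κ' => h.elevatorX κ' = h.elevatorX κ
  let up : h.Elevator → h.V := Sum.elim (fun e => h.fst e.1) (fun u => h.root u.1)
  obtain ⟨κ', hκ', hmax⟩ := A.exists_max_image (fun κ' => (h.pos (up κ')).2) ⟨κ, by simp [A]⟩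
  simp only [A, Finset.mem_filter, Finset.mem_univ, true_and] at hκ' hmax
  have h1 : h.OnElevatorsOnly (up κ') ∧ (h.pos (up κ')).1 = h.elevatorX κ := by
    rw [← hκ']
    rcases κ' with e | u
    · exact ⟨hall _ hκ', rfl⟩
    · exact ⟨(hall _ hκ').2, rfl⟩
  rcases hn.exists_up h1.1 with ⟨e, he⟩ | ⟨u, hu, hpos⟩
  · have h2 := h1.1.2.1 e he
    have h3 := hmax (.inl ⟨e, h2⟩)
      (by rw [← h1.2, ← he]; exact (fst_pos_eq_of_isElevator h2).symm)
    have h4 := hn.snd_pos_lt h2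
    rw [he] at h4
    exact absurd h3 (not_le.2 h4)
  · have h2 := h1.1.2.2 u hu
    have h3 := hall (.inr ⟨u, h2⟩) (by rw [← h1.2, ← hu]; rfl)
    exact absurd h3.1 (not_lt.2 hpos.le)

open Classical in
/-- A vertex that lies on elevators only is the end of at least three elevators. -/
theorem three_mul_card_onElevatorsOnly_le :
    3 * Fintype.card {v // h.OnElevatorsOnly v} ≤
      Fintype.card {κ // h.LowerEndOnElevators κ} +
        Fintype.card {κ // h.UpperEndOnElevators κ} := by
  have key : ∀ {α : Type} [Fintype α] (f : α → h.V),
      ∑ v with h.OnElevatorsOnly v, ∑ a, (if f a = v then 1 else 0) =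
        ∑ a, (if h.OnElevatorsOnly (f a) then 1 else 0) := by
    intro α _ f
    rw [Finset.sum_comm]
    refine Finset.sum_congr rfl fun a _ => ?_
    rw [Finset.sum_ite_eq]
    simp
  have h1 : ∑ v with h.OnElevatorsOnly v, 3 ≤ ∑ v with h.OnElevatorsOnly v,
      ((∑ e, if h.fst e = v then 1 else 0) + (∑ e, if h.snd e = v then 1 else 0) +
        ∑ u, if h.root u = v then 1 else 0) := by
    refine Finset.sum_le_sum fun v _ => ?_
    have := h.three_le_valency v
    rwa [natCard_fiber, natCard_fiber, natCard_fiber] at this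
  rw [Finset.sum_const, ← Fintype.card_subtype, Finset.sum_add_distrib, Finset.sum_add_distrib,
    key, key, key] at h1
  have hsub : ∀ {α : Type} [Fintype α] {R : α → Prop} (Q : {a // R a} → Prop),
      (∑ a, if Q a then 1 else 0) = ∑ a, if ∃ ha, Q ⟨a, ha⟩ then 1 else 0 := by
    intro α _ R Q
    rw [← Finset.card_filter, ← Finset.card_filter, ← Fintype.card_subtype,
      ← Fintype.card_subtype]
    exact Fintype.card_congr (Equiv.subtypeSubtypeEquivSubtypeExists R Q)
  have hcount : ∀ (Q : h.Elevator → Prop), Fintype.card {κ // Q κ} =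
      (∑ e, if ∃ he, Q (.inl ⟨e, he⟩) then 1 else 0) +
        ∑ u, if ∃ hu, Q (.inr ⟨u, hu⟩) then 1 else 0 := by
    intro Q
    rw [Fintype.card_subtype, Finset.card_filter, Fintype.sum_sum_type,
      hsub fun e => Q (.inl e), hsub fun u => Q (.inr u)]
  rw [hcount, hcount]
  have e1 : ∑ e, (if h.OnElevatorsOnly (h.fst e) then 1 else 0) =
      ∑ e, (if ∃ he, h.UpperEndOnElevators (.inl ⟨e, he⟩) then 1 else 0) :=
    Finset.sum_congr rfl fun e _ => if_congr
      ⟨fun hv => ⟨hv.1 e rfl, hv⟩, fun hv => hv.2⟩ rfl rfl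
  have e2 : ∑ e, (if h.OnElevatorsOnly (h.snd e) then 1 else 0) =
      ∑ e, (if ∃ he, h.LowerEndOnElevators (.inl ⟨e, he⟩) then 1 else 0) :=
    Finset.sum_congr rfl fun e _ => if_congr
      ⟨fun hv => ⟨hv.2.1 e rfl, hv⟩, fun hv => hv.2⟩ rfl rfl
  have e3 : ∑ u, (if h.OnElevatorsOnly (h.root u) then 1 else 0) ≤
      (∑ u, if ∃ hu, h.LowerEndOnElevators (.inr ⟨u, hu⟩) then 1 else 0) +
        ∑ u, if ∃ hu, h.UpperEndOnElevators (.inr ⟨u, hu⟩) then 1 else 0 := by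
    rw [← Finset.sum_add_distrib]
    refine Finset.sum_le_sum fun u _ => ?_
    by_cases hv : h.OnElevatorsOnly (h.root u)
    · have hu := hv.2.2 u rfl
      rcases lt_or_gt_of_ne (rayDir_snd_ne_zero hu) with h2 | h2
      · rw [if_pos hv, if_pos (c := ∃ hu, h.UpperEndOnElevators (.inr ⟨u, hu⟩)) ⟨hu, h2, hv⟩]
        omega
      · rw [if_pos hv, if_pos (c := ∃ hu, h.LowerEndOnElevators (.inr ⟨u, hu⟩)) ⟨hu, h2, hv⟩]
        omega
    · simp [hv]
  rw [e1, e2, smul_eq_mul] at h1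
  omega

open Classical in
/-- Points with different abscissas lie on different vertical lines, and every vertical line that
contains an elevator contains one whose lower (upper) end is not on elevators only. -/
theorem IsNormalized.card_points_on_elevators_le (hn : h.IsNormalized) {N : ℕ}
    {P : Fin N → ℝ × ℝ} (hx : Function.Injective fun i => (P i).1) :
    2 * Fintype.card {i // ∃ κ, P i ∈ h.elevatorImage κ} +
      3 * Fintype.card {v // h.OnElevatorsOnly v} ≤
      2 * (Fintype.card {e // h.IsElevator e} +
        Fintype.card {u // h.IsUnboundedElevator u}) := by
  have key : ∀ Q : h.Elevator → Prop,
      (∀ κ, ∃ κ', ¬ Q κ' ∧ h.elevatorX κ' = h.elevatorX κ) →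
      Fintype.card {i // ∃ κ, P i ∈ h.elevatorImage κ} + Fintype.card {κ // Q κ} ≤
        Fintype.card {e // h.IsElevator e} + Fintype.card {u // h.IsUnboundedElevator u} := by
    intro Q hQ
    have h1 : ∀ i : {i // ∃ κ, P i ∈ h.elevatorImage κ},
        ∃ κ : {κ // ¬ Q κ}, h.elevatorX κ.1 = (P i.1).1 := by
      rintro ⟨i, κ, hκ⟩
      obtain ⟨κ', h2, h3⟩ := hQ κ
      exact ⟨⟨κ', h2⟩, h3.trans (fst_eq_elevatorX hκ).symm⟩
    choose f hf using h1
    have h2 : Function.Injective f := fun i j hij =>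
      Subtype.ext (hx (by simp only [← hf, hij]))
    have h3 := Fintype.card_le_of_injective f h2
    have h4 : Fintype.card {κ // Q κ} + Fintype.card {κ // ¬ Q κ} =
        Fintype.card h.Elevator := by
      rw [← Fintype.card_sum]
      exact Fintype.card_congr (Equiv.sumCompl _)
    rw [Fintype.card_sum] at h4
    omega
  -- The bounds by elevators that end well below and above are added, since a vertex on elevators
  -- only spoils at least three ends, but perhaps just one on each side.
  have h1 := key _ hn.exists_lowest
  have h2 := key _ hn.exists_highest
  have h3 := h.three_mul_card_onElevatorsOnly_le
  omega

/-! ### Points on floors -/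

open Classical in
/-- Walking to the right from points of different heights one reaches a vertical line at
different crossings. -/
theorem IsNormalized.card_points_on_floors_le (hn : h.IsNormalized) {N : ℕ}
    {P : Fin N → ℝ × ℝ} {c W : ℝ} (hc : ∀ i, (P i).1 ≤ c ∧ c - (P i).1 ≤ W)
    (hy : ∀ i j, i ≠ j → 2 * h.degree * W < |(P i).2 - (P j).2|) :
    (Fintype.card {i // ∃ F, P i ∈ h.map '' h.floorSet F} : ℤ) ≤ h.totalFlux := by
  have hdeg : (0 : ℝ) ≤ h.degree := by
    have : 0 ≤ h.degree := Finset.sum_nonneg fun _ _ => le_max_right _ _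
    exact_mod_cast this
  have h1 : ∀ i : {i // ∃ F, P i ∈ h.map '' h.floorSet F},
      ∃ κ : {κ // h.Crosses κ c}, |h.strandHeight κ.1 c - (P i.1).2| ≤ h.degree * W := by
    rintro ⟨i, F, hF⟩
    obtain ⟨κ, -, h2, h3⟩ := hn.walk_right_of_mem_floor hF (hc i).1
    exact ⟨⟨κ, h2⟩, h3.trans (mul_le_mul_of_nonneg_left (hc i).2 hdeg)⟩
  choose f hf using h1
  have h2 : Function.Injective f := by
    intro i j hij
    by_contra hne
    have h3 := hy i.1 j.1 fun h4 => hne (Subtype.ext h4)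
    have h4 := hf i
    have h5 := hf j
    rw [← hij] at h5
    have h6 := abs_sub_le (P i.1).2 (h.strandHeight (f i).1 c) (P j.1).2
    rw [abs_sub_comm (P i.1).2 (h.strandHeight _ _)] at h6
    linarith
  have h3 := Fintype.card_le_of_injective f h2
  -- Every crossing carries a horizontal momentum of at least one.
  have h4 : (Fintype.card {κ // h.Crosses κ c} : ℤ) ≤ h.totalFlux := by
    rw [← sum_leftFlux, ← Finset.sum_congr rfl fun F _ => hn.sum_crosses F c,
      Fintype.card_subtype, Finset.card_eq_sum_ones]
    push_cast
    rw [← Finset.sum_fiberwise (Finset.univ.filter fun κ => h.Crosses κ c)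
      (fun κ => h.floorOf (h.strandBase κ))]
    refine Finset.sum_le_sum fun F _ => ?_
    rw [Finset.filter_filter]
    simp only [and_comm]
    refine Finset.sum_le_sum fun κ hκ => ?_
    simp only [Finset.mem_filter, Finset.mem_univ, true_and] at hκ
    exact Int.one_le_abs hκ.1.fst_ne_zero
  omega

end PlaneTropicalCurve

/-! ### Curves through vertically stretched points are floor decomposed -/

namespace PlaneTropicalCurve

open Classical in
/-- A normalized curve of degree `d` and genus `g` that has `d` floors, each of which is the graph
of a function, and whose rays have the standard directions, `d` of them being elevators. -/
structure IsFloorDecomposed (h : PlaneTropicalCurve) (d g : ℕ) : Prop where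
  normalized : h.IsNormalized
  degree_eq : h.degree = d
  not_onElevatorsOnly : ∀ v, ¬ h.OnElevatorsOnly v
  card_floor : Fintype.card h.Floor = d
  card_elevator : Fintype.card {e // h.IsElevator e} + 1 = d + g
  card_unboundedElevator : Fintype.card {u // h.IsUnboundedElevator u} = d
  leftFlux_eq_one : ∀ F, h.leftFlux F = 1
  rayDir_cases : ∀ u, h.rayDir u = (0, -1) ∨ h.rayDir u = (-1, 0) ∨ h.rayDir u = (1, 1)

variable {h : PlaneTropicalCurve}

theorem IsNormalized.abs_eq_one_of_crosses (hn : h.IsNormalized) {κ : h.E ⊕ h.U} {c : ℝ}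
    (hF : h.leftFlux (h.floorOf (h.strandBase κ)) = 1) (hc : h.Crosses κ c) :
    |(h.strandDir κ).1| = 1 := by
  classical
  refine le_antisymm ?_ (Int.one_le_abs hc.fst_ne_zero)
  rw [← hF, ← hn.sum_crosses _ c]
  exact Finset.single_le_sum (f := fun κ => |(h.strandDir κ).1|) (fun _ _ => abs_nonneg _)
    (by simp [hc])

theorem IsNormalized.eq_of_crosses (hn : h.IsNormalized) {κ κ' : h.E ⊕ h.U} {c : ℝ}
    (hF : h.leftFlux (h.floorOf (h.strandBase κ)) = 1) (hc : h.Crosses κ c)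
    (hF' : h.floorOf (h.strandBase κ') = h.floorOf (h.strandBase κ)) (hc' : h.Crosses κ' c) :
    κ = κ' := by
  classical
  by_contra hne
  have h1 := Finset.sum_le_sum_of_subset_of_nonneg (s := {κ, κ'})
    (t := Finset.univ.filter fun κ₂ => h.floorOf (h.strandBase κ₂) = h.floorOf (h.strandBase κ) ∧
      h.Crosses κ₂ c) (f := fun κ => |(h.strandDir κ).1|)
    (by
      intro κ₂ h2
      simp only [Finset.mem_insert, Finset.mem_singleton] at h2
      rcases h2 with rfl | rfl <;> simp [hc, hc', hF'])
    (fun _ _ _ => abs_nonneg _)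
  rw [hn.sum_crosses, hF, Finset.sum_pair hne] at h1
  have h2 := Int.one_le_abs hc.fst_ne_zero
  have h3 := Int.one_le_abs hc'.fst_ne_zero
  omega

theorem crosses_of_ray {u : h.U} (hu : ¬ h.IsUnboundedElevator u) : ∃ c, h.Crosses (.inr u) c := by
  rcases lt_or_gt_of_ne (show (h.rayDir u).1 ≠ 0 from hu) with h1 | h1
  · exact ⟨(h.pos (h.root u)).1 - 1, Or.inr ⟨h1, by linarith⟩⟩
  · exact ⟨(h.pos (h.root u)).1, Or.inl ⟨h1, le_rfl⟩⟩

theorem mem_elevator_or_floor {p : ℝ × ℝ} (hp : p ∈ Set.range h.map) :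
    (∃ κ, p ∈ h.elevatorImage κ) ∨ ∃ F, p ∈ h.map '' h.floorSet F := by
  rcases h.mem_range_map.1 hp with ⟨e, he⟩ | ⟨u, hu⟩
  · by_cases h1 : h.IsElevator e
    · exact Or.inl ⟨.inl ⟨e, h1⟩, he⟩
    · exact Or.inr ⟨_, h.mem_image_floorSet.2 (Or.inl ⟨e, h1, rfl, he⟩)⟩
  · by_cases h1 : h.IsUnboundedElevator u
    · exact Or.inl ⟨.inr ⟨u, h1⟩, hu⟩
    · exact Or.inr ⟨_, h.mem_image_floorSet.2 (Or.inr ⟨u, h1, rfl, hu⟩)⟩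

/-- The number of points is so large that all the inequalities between the numbers of floors,
elevators, rays and points have to be equalities. -/
theorem IsNormalized.isFloorDecomposed (hn : h.IsNormalized) {d g : ℕ} (hd : 0 < d)
    {P : Fin (3 * d - 1 + g) → ℝ × ℝ} (hP : IsVerticallyStretched d g P)
    (hh : h.IsCurveThrough d g P) : h.IsFloorDecomposed d g := by
  classical
  obtain ⟨hirr, hdeg, hgen, hpts⟩ := hh
  obtain ⟨c, W, hc, -, hy⟩ := hP.exists_width hd
  have h1 := h.card_elevator_add_one_le hirr hgen
  have h2 := hn.card_floor_le
  have h3 := h.card_unboundedElevator_le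
  have h4 := hn.card_points_on_elevators_le hP.1.injective
  have h5 := hn.card_points_on_floors_le hc (fun i j hij => by
    have := hy i j hij
    rwa [hdeg, Int.cast_natCast])
  have h6 := h.totalFlux_le_degree
  have h7 : 3 * d - 1 + g ≤ Fintype.card {i // ∃ κ, P i ∈ h.elevatorImage κ} +
      Fintype.card {i // ∃ F, P i ∈ h.map '' h.floorSet F} := by
    rw [Fintype.card_subtype, Fintype.card_subtype]
    refine le_trans ?_ (Finset.card_union_le _ _)
    rw [← Finset.filter_or, Finset.filter_true_of_mem fun i _ => mem_elevator_or_floor (hpts i)]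
    simp
  rw [hdeg] at h3 h6
  -- The number of points leaves no slack in the inequalities above.
  have hflux : h.totalFlux = d := by omega
  have hn0 : Fintype.card {v // h.OnElevatorsOnly v} = 0 := by omega
  have hfl : Fintype.card h.Floor = d := by omega
  have hEl : Fintype.card {e // h.IsElevator e} + 1 = d + g := by omega
  have hUn : Fintype.card {u // h.IsUnboundedElevator u} = d := by omega
  have hno : ∀ v, ¬ h.OnElevatorsOnly v := fun v hv =>
    (Fintype.card_eq_zero_iff.1 hn0).false ⟨v, hv⟩
  have hF1 : ∀ F ∈ Finset.univ, (1 : ℤ) ≤ h.leftFlux F := by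
    intro F _
    obtain ⟨v, rfl⟩ := floorOf_surjective F
    exact hn.leftFlux_pos (hno v)
  have hF : ∀ F, h.leftFlux F = 1 := by
    have h8 : ∑ F : h.Floor, (1 : ℤ) = ∑ F, h.leftFlux F := by
      rw [sum_leftFlux, hflux]
      simp [hfl]
    intro F
    exact ((Finset.sum_eq_sum_iff_of_le hF1).1 h8 F (Finset.mem_univ F)).symm
  refine ⟨hn, hdeg, hno, hfl, hEl, hUn, hF, fun u => ?_⟩
  -- Now the bounds on the contributions of the single rays are equalities too.
  have h8 := h.sum_rayMax_sub_fst
  rw [hdeg, hflux, sub_self] at h8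
  have h9 : ∀ u, h.rayMax u - max (h.rayDir u).1 0 = 0 := fun u =>
    (Finset.sum_eq_zero_iff_of_nonneg fun u _ => h.rayMax_sub_fst_nonneg u).1 h8 u
      (Finset.mem_univ u)
  have h10 : ∀ u ∈ Finset.univ, (if h.IsUnboundedElevator u then 1 else 0 : ℤ) ≤
      h.rayMax u - (h.rayDir u).2 := by
    intro u _
    have h11 := h9 u
    have h12 := h.rayMax_sub_snd_nonneg u
    split_ifs with hu
    · have h13 : (h.rayDir u).1 = 0 := hu
      have h14 := rayDir_snd_ne_zero hu
      rw [h13] at h11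
      simp only [max_self, sub_zero] at h11
      omega
    · exact h12
  have h11 : ∑ u, (if h.IsUnboundedElevator u then 1 else 0 : ℤ) =
      ∑ u, (h.rayMax u - (h.rayDir u).2) := by
    rw [sum_rayMax_sub_snd, hdeg, ← hUn, Fintype.card_subtype, Finset.card_filter]
    push_cast
    rfl
  have h12 := (Finset.sum_eq_sum_iff_of_le h10).1 h11 u (Finset.mem_univ u)
  have h13 := h9 u
  by_cases hu : h.IsUnboundedElevator u
  · have h14 : (h.rayDir u).1 = 0 := hu
    rw [h14, max_self] at h13
    rw [if_pos hu] at h12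
    exact Or.inl (Prod.ext h14 (by simp only; omega))
  · rw [if_neg hu] at h12
    obtain ⟨c, hcr⟩ := crosses_of_ray hu
    have h14 := hn.abs_eq_one_of_crosses (hF _) hcr
    simp only [strandDir, Sum.elim_inr] at h14
    rcases (abs_eq zero_le_one).1 h14 with h15 | h15
    · refine Or.inr (Or.inr (Prod.ext h15 ?_))
      rw [h15] at h13
      simp at h13
      simp only
      omega
    · refine Or.inr (Or.inl (Prod.ext h15 ?_))
      rw [h15] at h13
      simp at h13
      simp only
      omega

/-! ### Geometry of a floor decomposed curve -/

namespace IsFloorDecomposed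

variable {d g : ℕ} (hfd : h.IsFloorDecomposed d g)
include hfd

theorem rayDir_of_isUnboundedElevator {u : h.U} (hu : h.IsUnboundedElevator u) :
    h.rayDir u = (0, -1) := by
  rcases hfd.rayDir_cases u with h1 | h1 | h1
  · exact h1
  all_goals simp [IsUnboundedElevator, h1] at hu

theorem eq_of_crosses {κ κ' : h.E ⊕ h.U} {c : ℝ} (hc : h.Crosses κ c)
    (hF : h.floorOf (h.strandBase κ) = h.floorOf (h.strandBase κ')) (hc' : h.Crosses κ' c) :
    κ = κ' :=
  hfd.normalized.eq_of_crosses (hfd.leftFlux_eq_one _) hc hF.symm hc'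

theorem dir_fst_eq_one {e : h.E} (he : ¬ h.IsElevator e) : (h.dir e).1 = 1 := by
  have hp := hfd.normalized.dir_fst_pos he
  have hc : h.Crosses (.inl e) (h.pos (h.fst e)).1 := ⟨hp, le_rfl, fst_pos_lt_of_dir_pos hp⟩
  have := hfd.normalized.abs_eq_one_of_crosses (hfd.leftFlux_eq_one _) hc
  rwa [strandDir, Sum.elim_inl, abs_of_pos hp] at this

/-- Two points on the same floor differ in height by at most `2dW` if they lie over the interval
`[c - W, c]`. -/
theorem abs_sub_le_of_mem_floor {F : h.Floor} {p q : ℝ × ℝ} {c W : ℝ}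
    (hp : p ∈ h.map '' h.floorSet F) (hq : q ∈ h.map '' h.floorSet F)
    (hpc : p.1 ≤ c ∧ c - p.1 ≤ W) (hqc : q.1 ≤ c ∧ c - q.1 ≤ W) :
    |p.2 - q.2| ≤ 2 * d * W := by
  obtain ⟨κ, h1, h2, h3⟩ := hfd.normalized.walk_right_of_mem_floor hp hpc.1
  obtain ⟨κ', h4, h5, h6⟩ := hfd.normalized.walk_right_of_mem_floor hq hqc.1
  obtain rfl := hfd.eq_of_crosses h2 (h1.trans h4.symm) h5
  rw [hfd.degree_eq, Int.cast_natCast] at h3 h6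
  have h7 := abs_sub_le p.2 (h.strandHeight κ c) q.2
  rw [abs_sub_comm p.2 (h.strandHeight κ c)] at h7
  have h8 := mul_le_mul_of_nonneg_left hpc.2 d.cast_nonneg
  have h9 := mul_le_mul_of_nonneg_left hqc.2 d.cast_nonneg
  linarith

theorem vertex_mem_floor (v : h.V) : h.pos v ∈ h.map '' h.floorSet (h.floorOf v) := by
  obtain ⟨κ, rfl, h2⟩ := hfd.normalized.exists_right (hfd.not_onElevatorsOnly v)
  rw [mem_image_floorSet]
  rcases κ with e | u
  · exact Or.inl ⟨e, h2.ne', rfl, _, Or.inl rfl, rfl⟩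
  · exact Or.inr ⟨u, h2.ne', rfl, _, Or.inl rfl, rfl⟩

end IsFloorDecomposed

/-! ### Points and the objects that contain them -/

/-- The floors, bounded elevators and unbounded elevators of a curve. -/
abbrev FloorOrElevator (h : PlaneTropicalCurve) : Type := h.Floor ⊕ h.Elevator

/-- A floor or an elevator as a subset of the plane. -/
def image (h : PlaneTropicalCurve) : h.FloorOrElevator → Set (ℝ × ℝ) :=
  Sum.elim (fun F => h.map '' h.floorSet F) h.elevatorImage

/-- Each floor and each elevator contains a unique point of the configuration. -/
theorem IsFloorDecomposed.exists_equiv {d g : ℕ} (hfd : h.IsFloorDecomposed d g) (hd : 0 < d)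
    {P : Fin (3 * d - 1 + g) → ℝ × ℝ} (hP : IsVerticallyStretched d g P)
    (hh : h.IsCurveThrough d g P) :
    ∃ σ : h.FloorOrElevator ≃ Fin (3 * d - 1 + g), ∀ o i, P i ∈ h.image o ↔ i = σ o := by
  classical
  obtain ⟨c, W, hc, -, hy⟩ := hP.exists_width hd
  have huniq : ∀ o i j, P i ∈ h.image o → P j ∈ h.image o → i = j := by
    rintro (F | κ) i j hi hj
    · by_contra hij
      exact absurd (hfd.abs_sub_le_of_mem_floor hi hj (hc i) (hc j)) (not_le.2 (hy i j hij))
    · exact hP.1.injective ((fst_eq_elevatorX hi).trans (fst_eq_elevatorX hj).symm)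
  have hex : ∀ i, ∃ o, P i ∈ h.image o := by
    intro i
    rcases mem_elevator_or_floor (hh.2.2.2 i) with ⟨κ, hκ⟩ | ⟨F, hF⟩
    exacts [⟨.inr κ, hκ⟩, ⟨.inl F, hF⟩]
  choose f hf using hex
  have hinj : Function.Injective f := fun i j hij => huniq (f i) i j (hf i) (hij ▸ hf j)
  have hcard : Fintype.card (Fin (3 * d - 1 + g)) = Fintype.card h.FloorOrElevator := by
    rw [Fintype.card_fin, Fintype.card_sum, Fintype.card_sum, hfd.card_floor,
      hfd.card_unboundedElevator]
    have := hfd.card_elevator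
    omega
  let σ := Equiv.ofBijective f ((Fintype.bijective_iff_injective_and_card f).2 ⟨hinj, hcard⟩)
  refine ⟨σ.symm, fun o i => ⟨fun hi => ?_, fun hi => ?_⟩⟩
  · obtain ⟨j, rfl⟩ := σ.surjective o
    rw [Equiv.symm_apply_apply]
    exact huniq _ _ _ hi (hf j)
  · subst hi
    have := hf (σ.symm o)
    rwa [show f (σ.symm o) = o from σ.apply_symm_apply o] at this

end PlaneTropicalCurve

/-! ### The marking induced by a configuration -/

theorem sum_subtype_eq_sum_ite {α M : Type*} [Fintype α] [AddCommMonoid M] (p : α → Prop)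
    [DecidablePred p] [Fintype {a // p a}] (f : α → M) :
    ∑ a : {a // p a}, f a = ∑ a, if p a then f a else 0 := by
  rw [← Finset.sum_filter]
  exact (Finset.sum_subtype _ (by simp) _).symm

namespace PlaneTropicalCurve

variable {h : PlaneTropicalCurve}

open Classical in
noncomputable instance : Fintype h.floorDiagram.E :=
  inferInstanceAs (Fintype {e // h.IsElevator e})

theorem IsNormalized.edgeWeight_eq (hn : h.IsNormalized) {e : h.E} (he : h.IsElevator e) :
    (h.edgeWeight e : ℤ) = -(h.dir e).2 := by
  have h1 : (h.dir e).1 = 0 := he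
  have h2 := hn.dir_snd_neg he
  rw [edgeWeight, h1, Int.gcd_zero_left]
  omega

theorem IsNormalized.upper_eq (hn : h.IsNormalized) {e : h.E} (he : h.IsElevator e) :
    h.upper e = h.fst e :=
  if_pos (hn.dir_snd_neg he)

theorem IsNormalized.lower_eq (hn : h.IsNormalized) {e : h.E} (he : h.IsElevator e) :
    h.lower e = h.snd e :=
  if_pos (hn.dir_snd_neg he)

namespace IsFloorDecomposed

variable {d g : ℕ}

open Classical in
/-- The slope of a floor over `c` is the total momentum of the elevators attached to it on the
left of `c`, since the ray going to the left is horizontal. -/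
theorem strandDir_snd_of_crosses (hfd : h.IsFloorDecomposed d g) {κ : h.E ⊕ h.U} {c : ℝ}
    (hκ : h.Crosses κ c) {S : h.V → Prop} [DecidablePred S]
    (hS : ∀ v, S v ↔ h.floorOf v = h.floorOf (h.strandBase κ) ∧ (h.pos v).1 ≤ c) :
    (h.strandDir κ).2 =
      ∑ e : {e // h.IsElevator e}, (h.edgeWeight e.1 : ℤ) *
        ((if S (h.fst e.1) then 1 else 0) - (if S (h.snd e.1) then 1 else 0)) +
      ∑ u : {u // h.IsUnboundedElevator u}, if S (h.root u.1) then 1 else 0 := by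
  -- Balance the vertical momenta over the part `S` of the floor: of the edges and rays that are
  -- not elevators only `κ` leaves this part, and rays to the left are horizontal.
  have hcut := h.sum_snd_over_set S
  have hE : ∀ e, (((if S (h.fst e) then 1 else 0) - (if S (h.snd e) then 1 else 0) : ℤ)) *
      (h.dir e).2 = (if .inl e = κ then (h.strandDir κ).2 else 0) -
      if h.IsElevator e then (h.edgeWeight e : ℤ) *
        ((if S (h.fst e) then 1 else 0) - (if S (h.snd e) then 1 else 0)) else 0 := by
    intro e
    by_cases he : h.IsElevator e
    · have hne : .inl e ≠ κ := by
        rintro rfl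
        exact hκ.1.ne' he
      rw [if_neg hne, if_pos he, hfd.normalized.edgeWeight_eq he]
      ring
    · rw [if_neg he, sub_zero]
      have hfl := h.floorOf_fst_eq_snd he
      have hp := hfd.normalized.dir_fst_pos he
      have hx := fst_pos_lt_of_dir_pos hp
      by_cases hF : h.floorOf (h.fst e) = h.floorOf (h.strandBase κ)
      · by_cases hcr : h.Crosses (.inl e) c
        · obtain rfl := hfd.eq_of_crosses hcr hF hκ
          have h1 : S (h.fst e) := (hS _).2 ⟨rfl, hcr.2.1⟩
          have h2 : ¬ S (h.snd e) := fun h2 => not_le.2 hcr.2.2 ((hS _).1 h2).2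
          simp [h1, h2, strandDir]
        · have hne : .inl e ≠ κ := by
            rintro rfl
            exact hcr hκ
          have h3 : S (h.fst e) ↔ S (h.snd e) := by
            rw [hS, hS, hfl]
            refine and_congr_right fun _ => ⟨fun h4 => ?_, fun h4 => hx.le.trans h4⟩
            exact not_lt.1 fun h5 => hcr ⟨hp, h4, h5⟩
          simp [h3, hne]
      · have hne : .inl e ≠ κ := by
          rintro rfl
          exact hF rfl
        have h1 : ¬ S (h.fst e) := fun h2 => hF ((hS _).1 h2).1
        have h2 : ¬ S (h.snd e) := fun h2 => hF (hfl.trans ((hS _).1 h2).1)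
        simp [h1, h2, hne]
  have hU : ∀ u, (if S (h.root u) then 1 else 0 : ℤ) * (h.rayDir u).2 =
      (if .inr u = κ then (h.strandDir κ).2 else 0) -
      if h.IsUnboundedElevator u then (if S (h.root u) then 1 else 0) else 0 := by
    intro u
    rcases hfd.rayDir_cases u with hu | hu | hu
    · have hne : .inr u ≠ κ := by
        rintro rfl
        simp [Crosses, hu] at hκ
      simp [hne, IsUnboundedElevator, hu]
    · have h1 : ¬ h.IsUnboundedElevator u := by simp [IsUnboundedElevator, hu]
      have h2 : (if .inr u = κ then (h.strandDir κ).2 else 0) = 0 := by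
        split_ifs with h3
        · rw [← h3]
          simp [strandDir, hu]
        · rfl
      simp [h1, h2, hu]
    · have h1 : ¬ h.IsUnboundedElevator u := by simp [IsUnboundedElevator, hu]
      rw [if_neg h1, sub_zero, hu]
      by_cases h3 : S (h.root u)
      · have h4 := (hS _).1 h3
        obtain rfl := hfd.eq_of_crosses (κ := .inr u) (c := c)
          (Or.inl ⟨by simp [hu], h4.2⟩) h4.1 hκ
        simp [h3, strandDir, hu]
      · have hne : .inr u ≠ κ := by
          rintro rfl
          refine h3 ((hS _).2 ⟨rfl, ?_⟩)
          rcases hκ with h4 | h4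
          · exact h4.2
          · simp [hu] at h4
        simp [h3, hne]
  rw [Finset.sum_congr rfl fun e _ => hE e, Finset.sum_congr rfl fun u _ => hU u,
    Finset.sum_sub_distrib, Finset.sum_sub_distrib, ← sum_subtype_eq_sum_ite h.IsElevator
      fun e => (h.edgeWeight e : ℤ) *
        ((if S (h.fst e) then 1 else 0) - (if S (h.snd e) then 1 else 0)),
    ← sum_subtype_eq_sum_ite h.IsUnboundedElevator fun u => if S (h.root u) then (1 : ℤ) else 0]
    at hcut
  have hone := Fintype.sum_sum_type fun κ' => if κ' = κ then (h.strandDir κ).2 else 0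
  rw [Finset.sum_ite_eq' Finset.univ κ] at hone
  simp only [Finset.mem_univ, if_true] at hone
  omega

theorem exists_crosses (hfd : h.IsFloorDecomposed d g) (F : h.Floor) (c : ℝ) :
    ∃ κ, h.floorOf (h.strandBase κ) = F ∧ h.Crosses κ c := by
  classical
  have h1 := hfd.normalized.sum_crosses F c
  rw [hfd.leftFlux_eq_one] at h1
  obtain ⟨κ, hκ, -⟩ := Finset.exists_ne_zero_of_sum_ne_zero (h1.trans_ne one_ne_zero)
  exact ⟨κ, by simpa using hκ⟩

theorem exists_right_ray (hfd : h.IsFloorDecomposed d g) (F : h.Floor) :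
    ∃ u, h.floorOf (h.root u) = F ∧ h.rayDir u = (1, 1) := by
  obtain ⟨v, -, hv⟩ := Finset.exists_max_image Finset.univ (fun v => (h.pos v).1)
    ⟨(floorOf_surjective F).choose, Finset.mem_univ _⟩
  obtain ⟨κ, h1, h2⟩ := hfd.exists_crosses F (h.pos v).1
  rcases κ with e | u
  · exact absurd (hv _ (Finset.mem_univ _)) (not_le.2 h2.2.2)
  · refine ⟨u, h1, ?_⟩
    rcases hfd.rayDir_cases u with hu | hu | hu
    · simp [Crosses, hu] at h2
    · simp only [Crosses, hu] at h2
      rcases h2 with h2 | h2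
      · norm_num at h2
      · exact absurd (hv _ (Finset.mem_univ _)) (not_le.2 h2.2)
    · exact hu

open Classical in
/-- Far on the right a floor has slope one, which is the total momentum of its elevators. -/
theorem div_floorDiagram (hfd : h.IsFloorDecomposed d g)
    (F : h.Floor) :
    h.floorDiagram.div F = 1 - Fintype.card {u : {u // h.IsUnboundedElevator u} //
      h.floorOf (h.root u.1) = F} := by
  obtain ⟨v, -, hv⟩ := Finset.exists_max_image Finset.univ (fun v => (h.pos v).1)
    ⟨(floorOf_surjective F).choose, Finset.mem_univ _⟩
  obtain ⟨u, hF, hu⟩ := hfd.exists_right_ray F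
  have hcr : h.Crosses (.inr u) (h.pos v).1 := Or.inl ⟨by simp [hu], hv _ (Finset.mem_univ _)⟩
  have h1 := hfd.strandDir_snd_of_crosses hcr (S := fun v => h.floorOf v = F) fun w =>
    ⟨fun hw => ⟨hw.trans hF.symm, hv _ (Finset.mem_univ _)⟩, fun hw => hw.1.trans hF⟩
  have h2 : h.floorDiagram.div F = ∑ e : {e // h.IsElevator e}, (h.edgeWeight e.1 : ℤ) *
      ((if h.floorOf (h.fst e.1) = F then 1 else 0) -
        (if h.floorOf (h.snd e.1) = F then 1 else 0)) := by
    have h3 : ∀ e : h.floorDiagram.E, h.floorDiagram.src e = h.floorOf (h.fst e.1) := fun e =>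
      congrArg h.floorOf (hfd.normalized.upper_eq e.2)
    have h4 : ∀ e : h.floorDiagram.E, h.floorDiagram.tgt e = h.floorOf (h.snd e.1) := fun e =>
      congrArg h.floorOf (hfd.normalized.lower_eq e.2)
    unfold WeightedDigraph.div
    rw [Finset.sum_filter, Finset.sum_filter, ← Finset.sum_sub_distrib]
    simp only [h3, h4]
    simp only [mul_sub, mul_ite, mul_one, mul_zero]
    exact Finset.sum_congr rfl fun e _ =>
      congrArg₂ _ (if_congr Iff.rfl rfl rfl) (if_congr Iff.rfl rfl rfl)
  have h5 : (Fintype.card {u : {u // h.IsUnboundedElevator u} // h.floorOf (h.root u.1) = F} : ℤ) =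
      ∑ u : {u // h.IsUnboundedElevator u}, if h.floorOf (h.root u.1) = F then 1 else 0 := by
    rw [Fintype.card_subtype, Finset.card_filter]
    push_cast
    rfl
  rw [h2, h5]
  simp only [strandDir, Sum.elim_inr, hu] at h1
  linarith

theorem elevator_point_le (hfd : h.IsFloorDecomposed d g) {e : h.E} (he : h.IsElevator e)
    {p : ℝ × ℝ} (hp : p ∈ h.map '' h.closedEdge e) :
    (h.pos (h.snd e)).2 ≤ p.2 ∧ p.2 ≤ (h.pos (h.fst e)).2 := by
  obtain ⟨t, h0, h1, rfl⟩ := h.mem_image_closedEdge.1 hp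
  have h2 : ((h.dir e).2 : ℝ) < 0 := by exact_mod_cast hfd.normalized.dir_snd_neg he
  rw [h.snd_pos_snd]
  simp only [Prod.snd_add, Prod.smul_snd, latticeVec, smul_eq_mul]
  constructor <;> nlinarith

theorem ray_point_le (hfd : h.IsFloorDecomposed d g) {u : h.U} (hu : h.IsUnboundedElevator u)
    {p : ℝ × ℝ} (hp : p ∈ h.map '' h.closedRay u) : p.2 ≤ (h.pos (h.root u)).2 := by
  obtain ⟨t, h0, rfl⟩ := h.mem_image_closedRay.1 hp
  rw [hfd.rayDir_of_isUnboundedElevator hu]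
  simp [latticeVec, h0]

theorem connected_floorDiagram (hirr : h.IsIrreducible) :
    h.floorDiagram.toSimple.Connected := by
  have hr : ∀ v w : h.V, h.toSimple.Reachable v w →
      h.floorDiagram.toSimple.Reachable (h.floorOf v) (h.floorOf w) := by
    rintro v w ⟨p⟩
    induction p with
    | nil => rfl
    | @cons a b c hab p ih =>
      refine SimpleGraph.Reachable.trans ?_ ih
      have hedge : ∀ e, h.floorDiagram.toSimple.Reachable (h.floorOf (h.fst e))
          (h.floorOf (h.snd e)) := by
        intro e
        by_cases heq : h.floorOf (h.fst e) = h.floorOf (h.snd e)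
        · rw [heq]
          exact SimpleGraph.Reachable.refl _
        · have he : h.IsElevator e := by
            by_contra he
            exact heq (h.floorOf_fst_eq_snd he)
          refine SimpleGraph.Adj.reachable ⟨heq, ?_⟩
          by_cases hneg : (h.dir e).2 < 0
          · exact Or.inl ⟨⟨e, he⟩, congrArg h.floorOf (if_pos hneg),
              congrArg h.floorOf (if_pos hneg)⟩
          · exact Or.inr ⟨⟨e, he⟩, congrArg h.floorOf (if_neg hneg),
              congrArg h.floorOf (if_neg hneg)⟩
      rcases hab.2 with ⟨e, rfl, rfl⟩ | ⟨e, rfl, rfl⟩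
      · exact hedge e
      · exact (hedge e).symm
  have : Nonempty h.floorDiagram.V := hirr.nonempty.map h.floorOf
  refine SimpleGraph.Connected.mk fun F F' => ?_
  obtain ⟨v, rfl⟩ := floorOf_surjective F
  obtain ⟨w, rfl⟩ := floorOf_surjective F'
  exact hr v w (hirr.preconnected v w)

/-- The point of a floor lies above the point of any elevator that starts on this floor, and
below the point of any elevator that ends there. -/
theorem elevator_order (hfd : h.IsFloorDecomposed d g) (hd : 0 < d)
    {P : Fin (3 * d - 1 + g) → ℝ × ℝ} (hP : IsVerticallyStretched d g P)
    {σ : h.FloorOrElevator ≃ Fin (3 * d - 1 + g)} (hσ : ∀ o i, P i ∈ h.image o ↔ i = σ o) :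
    (∀ e : {e // h.IsElevator e},
      σ (.inr (.inl e)) < σ (.inl (h.floorOf (h.fst e.1))) ∧
      σ (.inl (h.floorOf (h.snd e.1))) < σ (.inr (.inl e))) ∧
    ∀ u : {u // h.IsUnboundedElevator u},
      σ (.inr (.inr u)) < σ (.inl (h.floorOf (h.root u.1))) := by
  obtain ⟨c, W, hc, -, hy⟩ := hP.exists_width hd
  have hmem : ∀ o, P (σ o) ∈ h.image o := fun o => (hσ o _).2 rfl
  -- The end of an elevator on a floor lies over the strip, hence its height is closer to the
  -- height of the point of the floor than the height of the point of the elevator is.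
  have key : ∀ (κ : h.Elevator) (v : h.V), (h.pos v).1 = h.elevatorX κ →
      |(h.pos v).2 - (P (σ (.inl (h.floorOf v)))).2| <
        |(P (σ (.inr κ))).2 - (P (σ (.inl (h.floorOf v)))).2| := by
    intro κ v hv
    have h1 := hy (σ (.inr κ)) (σ (.inl (h.floorOf v))) (σ.injective.ne (by simp))
    refine lt_of_le_of_lt ?_ h1
    refine hfd.abs_sub_le_of_mem_floor (c := c) (hfd.vertex_mem_floor v)
      (hmem (.inl (h.floorOf v))) ?_ (hc _)
    rw [hv, ← fst_eq_elevatorX (hmem (.inr κ))]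
    exact hc _
  have hup : ∀ (κ : h.Elevator) (v : h.V), (h.pos v).1 = h.elevatorX κ →
      (P (σ (.inr κ))).2 ≤ (h.pos v).2 → σ (.inr κ) < σ (.inl (h.floorOf v)) := by
    intro κ v hv hle
    rw [← hP.2.1.lt_iff_lt]
    by_contra hcon
    have h1 := key κ v hv
    rw [not_lt] at hcon
    rw [abs_of_nonneg (sub_nonneg.2 hcon), abs_of_nonneg (sub_nonneg.2 (hcon.trans hle))] at h1
    linarith
  have hdown : ∀ (κ : h.Elevator) (v : h.V), (h.pos v).1 = h.elevatorX κ →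
      (h.pos v).2 ≤ (P (σ (.inr κ))).2 → σ (.inl (h.floorOf v)) < σ (.inr κ) := by
    intro κ v hv hle
    rw [← hP.2.1.lt_iff_lt]
    by_contra hcon
    have h1 := key κ v hv
    rw [not_lt] at hcon
    rw [abs_of_nonpos (sub_nonpos.2 hcon), abs_of_nonpos (sub_nonpos.2 (hle.trans hcon))] at h1
    linarith
  refine ⟨fun e => ⟨?_, ?_⟩, fun u => ?_⟩
  · exact hup (.inl e) _ rfl (hfd.elevator_point_le e.2 (hmem (.inr (.inl e)))).2
  · exact hdown (.inl e) _ (fst_pos_eq_of_isElevator e.2)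
      (hfd.elevator_point_le e.2 (hmem (.inr (.inl e)))).1
  · exact hup (.inr u) _ rfl (hfd.ray_point_le u.2 (hmem (.inr (.inr u))))

open Classical in
/-- The floor diagram, with the floors ordered downwards by their points. As the points are listed
from bottom to top, this is the dual of the order of their indices. -/
noncomputable def labeledFloorDiagram (hfd : h.IsFloorDecomposed d g) (hd : 0 < d)
    {P : Fin (3 * d - 1 + g) → ℝ × ℝ} (hP : IsVerticallyStretched d g P)
    (hirr : h.IsIrreducible) (σ : h.FloorOrElevator ≃ Fin (3 * d - 1 + g))
    (hσ : ∀ o i, P i ∈ h.image o ↔ i = σ o) : LabeledFloorDiagram d g where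
  V := h.floorDiagram.V
  E := h.floorDiagram.E
  src := h.floorDiagram.src
  tgt := h.floorDiagram.tgt
  wt := h.floorDiagram.wt
  fintypeV := inferInstanceAs (Fintype h.Floor)
  fintypeE := inferInstance
  orderV := LinearOrder.lift' (fun F : h.Floor => OrderDual.toDual (σ (.inl F)))
    fun _ _ h1 => Sum.inl_injective (σ.injective h1)
  card_V := hfd.card_floor
  card_E := hfd.card_elevator
  connected := connected_floorDiagram hirr
  wt_pos e := by
    have h1 := hfd.normalized.edgeWeight_eq e.2
    have h2 := hfd.normalized.dir_snd_neg e.2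
    change 0 < h.edgeWeight e.1
    omega
  src_lt_tgt e := by
    have h1 := (hfd.elevator_order hd hP hσ).1 e
    have h2 := h1.2.trans h1.1
    rw [← hfd.normalized.upper_eq e.2, ← hfd.normalized.lower_eq e.2] at h2
    exact h2
  div_le_one F := by
    have h1 := hfd.div_floorDiagram F
    exact h1.trans_le (by omega)

/-- Every curve of degree `d` and genus `g` through a vertically stretched configuration induces
a marking of its floor diagram. -/
theorem exists_inducesMarking (hfd : h.IsFloorDecomposed d g) (hd : 0 < d)
    {P : Fin (3 * d - 1 + g) → ℝ × ℝ} (hP : IsVerticallyStretched d g P)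
    (hh : h.IsCurveThrough d g P) : ∃ M : FloorMarking d g, h.InducesMarking P M := by
  classical
  obtain ⟨σ, hσ⟩ := hfd.exists_equiv hd hP hh
  let D := hfd.labeledFloorDiagram hd hP hh.1 σ hσ
  have hleaf : ∀ F : h.Floor, Fintype.card {u : {u // h.IsUnboundedElevator u} //
      h.floorOf (h.root u.1) = F} = D.leafCount F := by
    intro F
    have h1 : D.toWeightedDigraph.div F = _ :=
      hfd.div_floorDiagram F
    unfold LabeledFloorDiagram.leafCount
    omega
  let l : {u // h.IsUnboundedElevator u} ≃ Σ F : D.V, Fin (D.leafCount F) :=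
    (Equiv.sigmaFiberEquiv fun u : {u // h.IsUnboundedElevator u} =>
      h.floorOf (h.root u.1)).symm.trans
      (Equiv.sigmaCongrRight fun F => Fintype.equivFinOfCardEq (hleaf F))
  let pt : D.ExtVertex → Fin (3 * d - 1 + g)
    | .orig F => σ (.inl F)
    | .mid e => σ (.inr (.inl e))
    | .leaf F k => σ (.inr (.inr (l.symm ⟨F, k⟩)))
  have hl : ∀ u, (l u).1 = h.floorOf (h.root u.1) := fun _ => rfl
  have hpt : Function.Injective pt := by
    rintro (F | e | ⟨F, k⟩) (F' | e' | ⟨F', k'⟩) heq <;> have h1 := σ.injective heq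
    · exact congrArg _ (Sum.inl_injective h1)
    · cases h1
    · cases h1
    · cases h1
    · exact congrArg _ (Sum.inl_injective (Sum.inr_injective h1))
    · cases h1
    · cases h1
    · cases h1
    · have h2 := l.symm.injective (Sum.inr_injective (Sum.inr_injective h1))
      cases h2
      rfl
  have hlt : ∀ (F : h.Floor) (k : Fin (D.leafCount F)),
      pt (.leaf F k) < pt (.orig F) := by
    intro F k
    have h1 := (hfd.elevator_order hd hP hσ).2 (l.symm ⟨F, k⟩)
    rw [← hl, Equiv.apply_symm_apply] at h1
    exact h1
  refine ⟨{ diagram := D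
            order := LinearOrder.lift' (fun a => OrderDual.toDual (pt a)) hpt
            extends_order := fun u v huv => huv
            src_lt_tgt := ?_ }, ⟨.refl _, .refl _, fun _ => rfl, fun _ => rfl, fun _ => rfl⟩, l, pt,
      fun _ => rfl, ?_, fun F i => hσ (.inl F) i, fun e i => hσ (.inr (.inl e)) i, ?_,
      fun a b => ?_⟩
  · rintro (e | e | ⟨F, k⟩)
    · have h1 := ((hfd.elevator_order hd hP hσ).1 e).1
      rw [← hfd.normalized.upper_eq e.2] at h1
      exact h1
    · have h1 := ((hfd.elevator_order hd hP hσ).1 e).2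
      rw [← hfd.normalized.lower_eq e.2] at h1
      exact h1
    · exact hlt F k
  · intro u
    have h1 := hfd.rayDir_of_isUnboundedElevator u.2
    simp [rayWeight, h1]
  · intro u i
    have h1 : pt (.leaf (l u).1 (l u).2) = σ (.inr (.inr u)) := by
      simp only [pt, Sigma.eta, Equiv.symm_apply_apply]
    rw [h1]
    exact hσ (.inr (.inr u)) i
  · exact hP.2.1.lt_iff_lt.symm

end IsFloorDecomposed

end PlaneTropicalCurve

/-! ### Markings up to isomorphism -/

namespace LabeledFloorDiagram

variable {d g : ℕ}

/-- The three kinds of vertices of the extended graph. -/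
def extVertexEquiv (D : LabeledFloorDiagram d g) :
    D.ExtVertex ≃ D.V ⊕ D.E ⊕ Σ v, Fin (D.leafCount v) where
  toFun
    | .orig v => .inl v
    | .mid e => .inr (.inl e)
    | .leaf v k => .inr (.inr ⟨v, k⟩)
  invFun
    | .inl v => .orig v
    | .inr (.inl e) => .mid e
    | .inr (.inr s) => .leaf s.1 s.2
  left_inv := by rintro (v | e | ⟨v, k⟩) <;> rfl
  right_inv := by rintro (v | e | ⟨v, k⟩) <;> rfl

/-- The three kinds of edges of the extended graph. -/
def extEdgeEquiv (D : LabeledFloorDiagram d g) :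
    D.ExtEdge ≃ D.E ⊕ D.E ⊕ Σ v, Fin (D.leafCount v) where
  toFun
    | .firstHalf e => .inl e
    | .secondHalf e => .inr (.inl e)
    | .toLeaf v k => .inr (.inr ⟨v, k⟩)
  invFun
    | .inl e => .firstHalf e
    | .inr (.inl e) => .secondHalf e
    | .inr (.inr s) => .toLeaf s.1 s.2
  left_inv := by rintro (e | e | ⟨v, k⟩) <;> rfl
  right_inv := by rintro (e | e | ⟨v, k⟩) <;> rfl

/-- An isomorphism of floor diagrams and a compatible bijection of the new vertices extend to the
extended graphs. -/
def extIso {D D' : LabeledFloorDiagram d g} (φ : D.toWeightedDigraph.Iso D'.toWeightedDigraph)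
    (φL : (Σ v, Fin (D.leafCount v)) ≃ Σ v, Fin (D'.leafCount v))
    (hφ : ∀ s, (φL s).1 = φ.onV s.1) : D.extGraph.Iso D'.extGraph where
  onV := D.extVertexEquiv.trans ((φ.onV.sumCongr (φ.onE.sumCongr φL)).trans D'.extVertexEquiv.symm)
  onE := D.extEdgeEquiv.trans ((φ.onE.sumCongr (φ.onE.sumCongr φL)).trans D'.extEdgeEquiv.symm)
  src_eq := by
    rintro (e | e | ⟨v, k⟩)
    · exact congrArg ExtVertex.orig (φ.src_eq e)
    · rfl
    · exact congrArg ExtVertex.orig (hφ ⟨v, k⟩)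
  tgt_eq := by
    rintro (e | e | ⟨v, k⟩)
    · rfl
    · exact congrArg ExtVertex.orig (φ.tgt_eq e)
    · rfl
  wt_eq := by
    rintro (e | e | ⟨v, k⟩)
    · exact φ.wt_eq e
    · exact φ.wt_eq e
    · rfl

section

variable {D D' : LabeledFloorDiagram d g} (k : D.extGraph.Iso D'.extGraph)
  (hk : ∀ a, a ∈ D.origSet ↔ k.onV a ∈ D'.origSet)
include hk

theorem exists_onV_orig (v : D.V) : ∃ v', k.onV (.orig v) = .orig v' := by
  obtain ⟨v', hv'⟩ := (hk (.orig v)).1 ⟨v, rfl⟩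
  exact ⟨v', hv'.symm⟩

/-- Midpoints are mapped to midpoints: they are the new vertices from which an edge starts. -/
theorem exists_onV_mid (e : D.E) :
    ∃ e', k.onV (.mid e) = .mid e' ∧ k.onE (.secondHalf e) = .secondHalf e' := by
  have h1 : k.onV (.mid e) ∉ D'.origSet := by
    intro hmem
    obtain ⟨v, hv⟩ := (hk (.mid e)).2 hmem
    cases hv
  have h2 := k.src_eq (.secondHalf e)
  change _ = k.onV (.mid e) at h2
  rw [← h2] at h1 ⊢
  cases hε : k.onE (.secondHalf e) with
  | firstHalf e' => exact absurd ⟨_, rfl⟩ (hε ▸ h1)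
  | secondHalf e' => exact ⟨e', rfl, rfl⟩
  | toLeaf v j => exact absurd ⟨_, rfl⟩ (hε ▸ h1)

theorem origSet_symm (a : D'.extGraph.V) :
    a ∈ D'.origSet ↔ k.symm.onV a ∈ D.origSet := by
  rw [hk]
  simp [WeightedDigraph.Iso.symm]

theorem exists_onV_leaf (s : Σ v, Fin (D.leafCount v)) :
    ∃ s' : Σ v, Fin (D'.leafCount v), k.onV (.leaf s.1 s.2) = .leaf s'.1 s'.2 := by
  cases hε : k.onV (.leaf s.1 s.2) with
  | orig v =>
    obtain ⟨w, hw⟩ := (hk (.leaf s.1 s.2)).2 (by rw [hε]; exact ⟨v, rfl⟩)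
    cases hw
  | mid e =>
    obtain ⟨e', he', -⟩ := exists_onV_mid k.symm (origSet_symm k hk) e
    rw [← hε] at he'
    have h1 : k.symm.onV (k.onV (.leaf s.1 s.2)) = .leaf s.1 s.2 := k.onV.symm_apply_apply _
    rw [h1] at he'
    cases he'
  | leaf v j => exact ⟨⟨v, j⟩, rfl⟩

/-- An isomorphism of extended graphs that respects the original vertices comes from an
isomorphism of the floor diagrams. -/
theorem exists_restriction :
    ∃ (φ : D.toWeightedDigraph.Iso D'.toWeightedDigraph)
      (φL : (Σ v, Fin (D.leafCount v)) ≃ Σ v, Fin (D'.leafCount v)),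
      (∀ s, (φL s).1 = φ.onV s.1) ∧ (∀ v, k.onV (.orig v) = .orig (φ.onV v)) ∧
      (∀ e, k.onV (.mid e) = .mid (φ.onE e)) ∧
      ∀ s : Σ v, Fin (D.leafCount v), k.onV (.leaf s.1 s.2) = .leaf (φL s).1 (φL s).2 := by
  have hk' := origSet_symm k hk
  choose fV hfV using exists_onV_orig k hk
  choose fE hfE hfE₂ using exists_onV_mid k hk
  choose fL hfL using exists_onV_leaf k hk
  choose gV hgV using exists_onV_orig k.symm hk'
  choose gE hgE hgE₂ using exists_onV_mid k.symm hk'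
  choose gL hgL using exists_onV_leaf k.symm hk'
  have hinv : ∀ a, k.symm.onV (k.onV a) = a := k.onV.symm_apply_apply
  have hinv' : ∀ a, k.onV (k.symm.onV a) = a := k.onV.apply_symm_apply
  have leaf_inj : ∀ {C : LabeledFloorDiagram d g} {s t : Σ v, Fin (C.leafCount v)},
      ExtVertex.leaf (D := C) s.1 s.2 = .leaf t.1 t.2 → s = t := by
    rintro C ⟨s1, s2⟩ ⟨t1, t2⟩ hst
    cases hst
    rfl
  let φV : D.V ≃ D'.V := ⟨fV, gV,
    fun v => ExtVertex.orig.inj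
      ((hgV _).symm.trans ((congrArg k.symm.onV (hfV v)).symm.trans (hinv _))),
    fun v => ExtVertex.orig.inj
      ((hfV _).symm.trans ((congrArg k.onV (hgV v)).symm.trans (hinv' _)))⟩
  let φE : D.E ≃ D'.E := ⟨fE, gE,
    fun v => ExtVertex.mid.inj
      ((hgE _).symm.trans ((congrArg k.symm.onV (hfE v)).symm.trans (hinv _))),
    fun v => ExtVertex.mid.inj
      ((hfE _).symm.trans ((congrArg k.onV (hgE v)).symm.trans (hinv' _)))⟩
  let φL : (Σ v, Fin (D.leafCount v)) ≃ Σ v, Fin (D'.leafCount v) := ⟨fL, gL,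
    fun s => leaf_inj
      ((hgL _).symm.trans ((congrArg k.symm.onV (hfL s)).symm.trans (hinv _))),
    fun s => leaf_inj
      ((hfL _).symm.trans ((congrArg k.onV (hgL s)).symm.trans (hinv' _)))⟩
  have hfirst : ∀ e, k.onE (.firstHalf e) = .firstHalf (fE e) := by
    intro e
    have h1 := k.tgt_eq (.firstHalf e)
    change _ = k.onV (.mid e) at h1
    rw [hfE] at h1
    cases hε : k.onE (.firstHalf e) with
    | firstHalf e' => rw [hε] at h1; cases h1; rfl
    | secondHalf e' => rw [hε] at h1; cases h1
    | toLeaf v j => rw [hε] at h1; cases h1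
  refine ⟨⟨φV, φE, fun e => ?_, fun e => ?_, fun e => ?_⟩, φL, fun s => ?_, hfV, hfE, hfL⟩
  · have h1 := k.src_eq (.firstHalf e)
    rw [hfirst] at h1
    exact ExtVertex.orig.inj (h1.trans (hfV _))
  · have h1 := k.tgt_eq (.secondHalf e)
    rw [hfE₂] at h1
    exact ExtVertex.orig.inj (h1.trans (hfV _))
  · have h1 := k.wt_eq (.secondHalf e)
    rw [hfE₂] at h1
    exact h1
  · have h1 := k.tgt_eq (.toLeaf s.1 s.2)
    have h2 := k.src_eq (.toLeaf s.1 s.2)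
    change _ = k.onV (.leaf s.1 s.2) at h1
    rw [hfL] at h1
    cases hε : k.onE (.toLeaf s.1 s.2) with
    | firstHalf e' => rw [hε] at h1; cases h1
    | secondHalf e' => rw [hε] at h1; cases h1
    | toLeaf v j =>
      rw [hε] at h1 h2
      have h3 : (⟨v, j⟩ : Σ v, Fin (D'.leafCount v)) = fL s := leaf_inj h1
      have h4 := ExtVertex.orig.inj (h2.trans (hfV _))
      exact (congrArg Sigma.fst h3).symm.trans h4

end

end LabeledFloorDiagram

namespace PlaneTropicalCurve

variable {h : PlaneTropicalCurve} {N d g : ℕ} {P : Fin N → ℝ × ℝ} {M M' : FloorMarking d g}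

/-- The identification of the two extended graphs through `h` matches the points, hence the
orders. -/
theorem InducesMarking.equivalent (hM : h.InducesMarking P M) (hM' : h.InducesMarking P M') :
    M.Equivalent M' := by
  obtain ⟨f, l, pt, h1, -, h3, h4, h5, h6⟩ := hM
  obtain ⟨f', l', pt', h1', -, h3', h4', h5', h6'⟩ := hM'
  have hφ : ∀ s, (l.symm.trans l' s).1 = (f.symm.trans f').onV s.1 := by
    intro s
    obtain ⟨u, rfl⟩ := l.surjective s
    rw [Equiv.trans_apply, Equiv.symm_apply_apply, h1, h1']
    exact congrArg f'.onV (f.onV.symm_apply_apply _).symm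
  let k := LabeledFloorDiagram.extIso (f.symm.trans f') (l.symm.trans l') hφ
  have hpt : ∀ a, pt' (k.onV a) = pt a := by
    rintro (v | e | ⟨v, j⟩)
    · obtain ⟨F, rfl⟩ := f.onV.surjective v
      refine ((h3' F _).1 ((h3 F _).2 rfl)).trans ?_ |>.symm
      exact congrArg (fun F => pt' (.orig (f'.onV F))) (f.onV.symm_apply_apply F).symm
    · obtain ⟨e, rfl⟩ := f.onE.surjective e
      refine ((h4' e _).1 ((h4 e _).2 rfl)).trans ?_ |>.symm
      exact congrArg (fun e => pt' (.mid (f'.onE e))) (f.onE.symm_apply_apply e).symm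
    · obtain ⟨u, hu⟩ := l.surjective ⟨v, j⟩
      have h7 : pt (.leaf v j) = pt (.leaf (l u).1 (l u).2) := by rw [hu]
      rw [h7]
      refine ((h5' u _).1 ((h5 u _).2 rfl)).trans ?_ |>.symm
      have h8 : l' u = (l.symm.trans l') ⟨v, j⟩ := by
        rw [← hu, Equiv.trans_apply, Equiv.symm_apply_apply]
      exact congrArg (fun s : Σ v, Fin (M'.diagram.leafCount v) => pt' (.leaf s.1 s.2)) h8
  refine ⟨k, fun a b => ?_, ?_⟩
  · rw [h6, h6', hpt, hpt]
  · rintro (v | e | ⟨v, j⟩)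
    · exact iff_of_true ⟨v, rfl⟩ ⟨_, rfl⟩
    · refine iff_of_false ?_ ?_ <;> rintro ⟨w, hw⟩ <;> cases hw
    · refine iff_of_false ?_ ?_ <;> rintro ⟨w, hw⟩ <;> cases hw

theorem InducesMarking.of_equivalent (hM : h.InducesMarking P M) (hMM : M.Equivalent M') :
    h.InducesMarking P M' := by
  obtain ⟨f, l, pt, h1, h2, h3, h4, h5, h6⟩ := hM
  obtain ⟨k, hk1, hk2⟩ := hMM
  obtain ⟨φ, φL, hφ, hV, hE, hL⟩ := LabeledFloorDiagram.exists_restriction k hk2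
  have hinv : ∀ a, k.onV.symm (k.onV a) = a := k.onV.symm_apply_apply
  refine ⟨f.trans φ, l.trans φL, fun a => pt (k.onV.symm a), fun u => ?_, h2, fun F i => ?_,
    fun e i => ?_, fun u i => ?_, fun a b => ?_⟩
  · rw [Equiv.trans_apply, hφ, h1]
    rfl
  · have h7 : k.onV.symm (.orig ((f.trans φ).onV F)) = .orig (f.onV F) := by
      rw [← hinv (.orig (f.onV F)), hV]
      rfl
    exact (h3 F i).trans (iff_of_eq (congrArg (fun a => i = pt a) h7.symm))
  · have h7 : k.onV.symm (.mid ((f.trans φ).onE e)) = .mid (f.onE e) := by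
      rw [← hinv (.mid (f.onE e)), hE]
      rfl
    exact (h4 e i).trans (iff_of_eq (congrArg (fun a => i = pt a) h7.symm))
  · have h7 : k.onV.symm (.leaf ((l.trans φL) u).1 ((l.trans φL) u).2) =
        .leaf (l u).1 (l u).2 := by
      rw [← hinv (.leaf (l u).1 (l u).2), hL]
      rfl
    exact (h5 u i).trans (iff_of_eq (congrArg (fun a => i = pt a) h7.symm))
  · rw [← h6, hk1]
    simp

end PlaneTropicalCurve

/-! ### Floors with prescribed elevators -/

namespace LabeledFloorDiagram

variable {d g : ℕ} (D : LabeledFloorDiagram d g)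

noncomputable instance : Fintype D.ExtEdge := Fintype.ofEquiv _ D.extEdgeEquiv.symm

noncomputable instance : Fintype D.ExtVertex := Fintype.ofEquiv _ D.extVertexEquiv.symm

variable {D}

/-- The edges of the extended graph stand for the ends of elevators. This is the floor to which
the end is attached. -/
def endFloor : D.ExtEdge → D.V
  | .firstHalf e => D.src e
  | .secondHalf e => D.tgt e
  | .toLeaf v _ => v

/-- The elevator to which an end belongs, as a vertex of the extended graph. -/
def endElevator : D.ExtEdge → D.ExtVertex
  | .firstHalf e => .mid e
  | .secondHalf e => .mid e
  | .toLeaf v k => .leaf v k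

/-- The downward momentum of the elevator, seen from the given end: it is the change of the slope
of the floor at this end. -/
def endMomentum : D.ExtEdge → ℤ
  | .firstHalf e => D.wt e
  | .secondHalf e => -D.wt e
  | .toLeaf _ _ => 1

theorem sum_extEdge {M : Type*} [AddCommMonoid M] (f : D.ExtEdge → M) :
    ∑ w, f w = ∑ e, f (.firstHalf e) + (∑ e, f (.secondHalf e) +
      ∑ s : Σ v, Fin (D.leafCount v), f (.toLeaf s.1 s.2)) := by
  rw [← D.extEdgeEquiv.symm.sum_comp, Fintype.sum_sum_type, Fintype.sum_sum_type]
  rfl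

theorem cast_leafCount (v : D.V) : (D.leafCount v : ℤ) = 1 - D.toWeightedDigraph.div v :=
  Int.toNat_of_nonneg (sub_nonneg.2 (D.div_le_one v))

theorem sum_leaf_ite (v : D.V) :
    ∑ s : Σ v, Fin (D.leafCount v), (if s.1 = v then 1 else 0 : ℤ) = D.leafCount v := by
  rw [Fintype.sum_sigma, Finset.sum_eq_single v]
  · simp
  · intro b _ hb
    simp [hb]
  · simp

theorem sum_ends {M : Type*} [AddCommMonoid M] (v : D.V) (f : D.ExtEdge → M) :
    ∑ w with endFloor w = v, f w = (∑ e, if D.src e = v then f (.firstHalf e) else 0) +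
      ((∑ e, if D.tgt e = v then f (.secondHalf e) else 0) +
      ∑ s : Σ v, Fin (D.leafCount v), if s.1 = v then f (.toLeaf s.1 s.2) else 0) := by
  rw [Finset.sum_filter]
  exact sum_extEdge _

theorem div_eq_sum (v : D.V) : D.toWeightedDigraph.div v =
    (∑ e, if D.src e = v then (D.wt e : ℤ) else 0) -
      ∑ e, if D.tgt e = v then (D.wt e : ℤ) else 0 := by
  unfold WeightedDigraph.div
  rw [Finset.sum_filter, Finset.sum_filter]
  congr!

/-- Far on the right, every floor has slope one. -/
theorem sum_endMomentum (v : D.V) : ∑ w with endFloor w = v, endMomentum w = 1 := by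
  refine (sum_ends v _).trans ?_
  simp only [endMomentum]
  rw [sum_leaf_ite, cast_leafCount, div_eq_sum]
  have h1 : ∑ e, (if D.tgt e = v then -(D.wt e : ℤ) else 0) =
      -∑ e, (if D.tgt e = v then (D.wt e : ℤ) else 0) := by
    rw [← Finset.sum_neg_distrib]
    exact Finset.sum_congr rfl fun e _ => by split_ifs <;> simp
  rw [h1]
  ring

theorem exists_end (v : D.V) : ∃ w : D.ExtEdge, endFloor w = v := by
  classical
  obtain ⟨w, hw, -⟩ := Finset.exists_ne_zero_of_sum_ne_zero
    ((sum_endMomentum v).trans_ne one_ne_zero)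
  exact ⟨w, by simpa using hw⟩

/-- The total weight of the edges that end in `v` is bounded by the total divergence of the
vertices before `v`. -/
theorem sum_incoming_lt (v : D.V) : ∑ e, (if D.tgt e = v then (D.wt e : ℤ) else 0) < d := by
  have h1 : ∑ e, (if D.tgt e = v then (D.wt e : ℤ) else 0) ≤
      ∑ u with u < v, D.toWeightedDigraph.div u := by
    have h2 : ∑ u with u < v, D.toWeightedDigraph.div u = ∑ e, ((if D.src e < v then (D.wt e : ℤ)
        else 0) - if D.tgt e < v then (D.wt e : ℤ) else 0) := by
      have key : ∀ f : D.E → D.V, ∑ u with u < v, ∑ e, (if f e = u then (D.wt e : ℤ) else 0) =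
          ∑ e, if f e < v then (D.wt e : ℤ) else 0 := by
        intro f
        rw [Finset.sum_comm]
        refine Finset.sum_congr rfl fun e _ => ?_
        rw [Finset.sum_ite_eq]
        simp
      simp only [div_eq_sum]
      rw [Finset.sum_sub_distrib, key, key, Finset.sum_sub_distrib]
    rw [h2]
    refine Finset.sum_le_sum fun e _ => ?_
    have h3 := D.src_lt_tgt e
    by_cases h4 : D.tgt e = v
    · simp [h4, h4 ▸ h3]
    · by_cases h5 : D.tgt e < v
      · simp [h4, h5, h3.trans h5]
      · simp only [h4, h5, if_false, sub_zero]
        positivity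
  refine h1.trans_lt ?_
  have h2 : ∑ u with u < v, D.toWeightedDigraph.div u ≤ ∑ u with u < v, (1 : ℤ) :=
    Finset.sum_le_sum fun u _ => D.div_le_one u
  refine h2.trans_lt ?_
  have h3 := Finset.card_lt_card (Finset.filter_ssubset (p := (· < v)) |>.2
    ⟨v, Finset.mem_univ _, lt_irrefl v⟩)
  rw [Finset.card_univ, D.card_V] at h3
  rw [Finset.sum_const, nsmul_eq_mul, mul_one]
  exact_mod_cast h3

theorem sum_abs_endMomentum_le (v : D.V) : ∑ w with endFloor w = v, |endMomentum w| ≤ 2 * d := by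
  have h1 := (sum_ends v _).symm.trans (sum_endMomentum v)
  have h2 := sum_incoming_lt v
  refine (sum_ends v _).trans_le ?_
  simp only [endMomentum, abs_neg, abs_one, Nat.abs_cast] at h1 ⊢
  have h3 : ∑ e, (if D.tgt e = v then -(D.wt e : ℤ) else 0) =
      -∑ e, (if D.tgt e = v then (D.wt e : ℤ) else 0) := by
    rw [← Finset.sum_neg_distrib]
    exact Finset.sum_congr rfl fun e _ => by split_ifs <;> simp
  rw [h3] at h1
  linarith

variable (D)

/-- Points in the plane for the floors and the elevators of a floor diagram, stretched
vertically and ordered downwards in accordance with the edges of the extended graph. -/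
structure Placement where
  point : D.ExtVertex → ℝ × ℝ
  width : ℝ
  x_injective : Function.Injective fun a => (point a).1
  abs_x_sub_le : ∀ a b, |(point a).1 - (point b).1| ≤ width
  lt_abs_y_sub : ∀ a b, a ≠ b → 2 * d * width < |(point a).2 - (point b).2|
  mid_lt_src : ∀ e, (point (.mid e)).2 < (point (.orig (D.src e))).2
  tgt_lt_mid : ∀ e, (point (.orig (D.tgt e))).2 < (point (.mid e)).2
  leaf_lt : ∀ v k, (point (.leaf v k)).2 < (point (.orig v)).2

namespace Placement

variable {D} (p : D.Placement)

/-- The abscissa of an end of an elevator. -/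
def endX (w : D.ExtEdge) : ℝ := (p.point (endElevator w)).1

/-- The slope of the floor `v` on the right of the abscissa `t`. -/
noncomputable def slope (v : D.V) (t : ℝ) : ℤ :=
  ∑ w with endFloor w = v ∧ p.endX w ≤ t, endMomentum w

/-- The piecewise linear function whose graph is the floor `v`: it is constant far on the left,
bends at the ends of the elevators, and passes through the given point of the floor. -/
noncomputable def floorY (v : D.V) (t : ℝ) : ℝ :=
  (p.point (.orig v)).2 + ∑ w with endFloor w = v, (endMomentum w : ℝ) *
    (max (t - p.endX w) 0 - max ((p.point (.orig v)).1 - p.endX w) 0)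

theorem floorY_orig (v : D.V) : p.floorY v (p.point (.orig v)).1 = (p.point (.orig v)).2 := by
  simp [floorY]

theorem floorY_sub (v : D.V) {t t' : ℝ} (h : t ≤ t')
    (hw : ∀ w, endFloor w = v → ¬ (t < p.endX w ∧ p.endX w < t')) :
    p.floorY v t' - p.floorY v t = p.slope v t * (t' - t) := by
  classical
  have h1 : p.floorY v t' - p.floorY v t = ∑ w with endFloor w = v, (endMomentum w : ℝ) *
      (max (t' - p.endX w) 0 - max (t - p.endX w) 0) := by
    unfold floorY
    rw [add_sub_add_left_eq_sub, ← Finset.sum_sub_distrib]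
    exact Finset.sum_congr rfl fun w _ => by ring
  rw [h1, slope, ← Finset.filter_filter, Finset.sum_filter (fun w => p.endX w ≤ t)]
  push_cast
  rw [Finset.sum_mul]
  refine Finset.sum_congr rfl fun w hwm => ?_
  have h2 := hw w (by simpa using hwm)
  split_ifs with h3
  · rw [max_eq_left (by linarith), max_eq_left (by linarith)]
    ring
  · have h4 : t' ≤ p.endX w := not_lt.1 fun h4 => h2 ⟨not_le.1 h3, h4⟩
    rw [max_eq_right (by linarith), max_eq_right (by linarith)]
    simp

theorem abs_floorY_sub_le (a : D.ExtVertex) (v : D.V) :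
    |p.floorY v (p.point a).1 - (p.point (.orig v)).2| ≤ 2 * d * p.width := by
  classical
  unfold floorY
  rw [add_sub_cancel_left]
  have hW : 0 ≤ p.width := (abs_nonneg _).trans (p.abs_x_sub_le a a)
  have h1 : ∀ w, |(endMomentum w : ℝ) * (max ((p.point a).1 - p.endX w) 0 -
      max ((p.point (.orig v)).1 - p.endX w) 0)| ≤ (|endMomentum w| : ℤ) * p.width := by
    intro w
    rw [abs_mul, Int.cast_abs]
    refine mul_le_mul_of_nonneg_left ?_ (abs_nonneg _)
    refine (abs_max_sub_max_le_abs _ _ _).trans ?_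
    rw [sub_sub_sub_cancel_right]
    exact p.abs_x_sub_le _ _
  refine (Finset.abs_sum_le_sum_abs _ _).trans ((Finset.sum_le_sum fun w _ => h1 w).trans ?_)
  rw [← Finset.sum_mul, ← Int.cast_sum]
  refine mul_le_mul_of_nonneg_right ?_ hW
  exact_mod_cast sum_abs_endMomentum_le v

theorem lt_floorY {a : D.ExtVertex} {v : D.V} (ha : a ≠ .orig v)
    (h : (p.point a).2 < (p.point (.orig v)).2) : (p.point a).2 < p.floorY v (p.point a).1 := by
  have h1 := p.lt_abs_y_sub a _ ha
  have h2 := p.abs_floorY_sub_le a v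
  rw [abs_of_neg (sub_neg.2 h)] at h1
  rw [abs_le] at h2
  linarith

theorem floorY_lt {a : D.ExtVertex} {v : D.V} (ha : a ≠ .orig v)
    (h : (p.point (.orig v)).2 < (p.point a).2) : p.floorY v (p.point a).1 < (p.point a).2 := by
  have h1 := p.lt_abs_y_sub a _ ha
  have h2 := p.abs_floorY_sub_le a v
  rw [abs_of_pos (sub_pos.2 h)] at h1
  rw [abs_le] at h2
  linarith

theorem eq_of_endX_eq {w w' : D.ExtEdge} (hF : endFloor w = endFloor w')
    (hx : p.endX w = p.endX w') : w = w' := by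
  have h1 := p.x_injective hx
  rcases w with e | e | ⟨v, k⟩ <;> rcases w' with e' | e' | ⟨v', k'⟩ <;>
    simp only [endElevator, ExtVertex.mid.injEq, reduceCtorEq] at h1
  · rw [h1]
  · subst h1
    exact absurd hF (D.src_lt_tgt e).ne
  · subst h1
    exact absurd hF (D.src_lt_tgt e).ne'
  · rw [h1]
  · cases h1
    rfl

/-- Two consecutive ends of elevators on a floor. -/
def Consec (w w' : D.ExtEdge) : Prop :=
  endFloor w = endFloor w' ∧ p.endX w < p.endX w' ∧
    ∀ w₂, endFloor w₂ = endFloor w → ¬ (p.endX w < p.endX w₂ ∧ p.endX w₂ < p.endX w')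

/-- The first end of an elevator on its floor, from the left. -/
def IsFirst (w : D.ExtEdge) : Prop := ∀ w', endFloor w' = endFloor w → p.endX w ≤ p.endX w'

/-- The last end of an elevator on its floor, from the left. -/
def IsLast (w : D.ExtEdge) : Prop := ∀ w', endFloor w' = endFloor w → p.endX w' ≤ p.endX w

variable {p}

theorem Consec.not_isLast {w w' : D.ExtEdge} (h : p.Consec w w') : ¬ p.IsLast w :=
  fun h1 => not_le.2 h.2.1 (h1 w' h.1.symm)

theorem Consec.not_isFirst {w w' : D.ExtEdge} (h : p.Consec w w') : ¬ p.IsFirst w' :=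
  fun h1 => not_le.2 h.2.1 (h1 w h.1)

theorem exists_consec_right {w : D.ExtEdge} (h : ¬ p.IsLast w) : ∃ w', p.Consec w w' := by
  classical
  unfold IsLast at h
  push Not at h
  obtain ⟨w₀, h0, h1⟩ := h
  obtain ⟨w', hw', hmin⟩ := Finset.exists_min_image
    (Finset.univ.filter fun w' => endFloor w' = endFloor w ∧ p.endX w < p.endX w') p.endX
    ⟨w₀, by simp [h0, h1]⟩
  simp only [Finset.mem_filter, Finset.mem_univ, true_and] at hw' hmin
  exact ⟨w', hw'.1.symm, hw'.2, fun w₂ h2 h3 => not_le.2 h3.2 (hmin w₂ ⟨h2, h3.1⟩)⟩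

theorem exists_consec_left {w : D.ExtEdge} (h : ¬ p.IsFirst w) : ∃ w', p.Consec w' w := by
  classical
  unfold IsFirst at h
  push Not at h
  obtain ⟨w₀, h0, h1⟩ := h
  obtain ⟨w', hw', hmax⟩ := Finset.exists_max_image
    (Finset.univ.filter fun w' => endFloor w' = endFloor w ∧ p.endX w' < p.endX w) p.endX
    ⟨w₀, by simp [h0, h1]⟩
  simp only [Finset.mem_filter, Finset.mem_univ, true_and] at hw' hmax
  exact ⟨w', hw'.1, hw'.2, fun w₂ h2 h3 => not_le.2 h3.1 (hmax w₂ ⟨h2.trans hw'.1, h3.2⟩)⟩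

theorem Consec.right_unique {w w₁ w₂ : D.ExtEdge} (h1 : p.Consec w w₁) (h2 : p.Consec w w₂) :
    w₁ = w₂ :=
  p.eq_of_endX_eq (h1.1.symm.trans h2.1) (le_antisymm
    (not_lt.1 fun h3 => h1.2.2 w₂ h2.1.symm ⟨h2.2.1, h3⟩)
    (not_lt.1 fun h3 => h2.2.2 w₁ h1.1.symm ⟨h1.2.1, h3⟩))

theorem Consec.left_unique {w w₁ w₂ : D.ExtEdge} (h1 : p.Consec w₁ w) (h2 : p.Consec w₂ w) :
    w₁ = w₂ :=
  p.eq_of_endX_eq (h1.1.trans h2.1.symm) (le_antisymm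
    (not_lt.1 fun h3 => h2.2.2 w₁ (h1.1.trans h2.1.symm) ⟨h3, h1.2.1⟩)
    (not_lt.1 fun h3 => h1.2.2 w₂ (h2.1.trans h1.1.symm) ⟨h3, h2.2.1⟩))

variable (p)

theorem exists_isLast (v : D.V) : ∃ w, endFloor w = v ∧ p.IsLast w := by
  classical
  obtain ⟨w₀, h0⟩ := exists_end v
  obtain ⟨w, hw, hmax⟩ := Finset.exists_max_image
    (Finset.univ.filter fun w => endFloor w = v) p.endX ⟨w₀, by simp [h0]⟩
  simp only [Finset.mem_filter, Finset.mem_univ, true_and] at hw hmax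
  exact ⟨w, hw, fun w' h1 => hmax w' (h1.trans hw)⟩

theorem exists_isFirst (v : D.V) : ∃ w, endFloor w = v ∧ p.IsFirst w := by
  classical
  obtain ⟨w₀, h0⟩ := exists_end v
  obtain ⟨w, hw, hmin⟩ := Finset.exists_min_image
    (Finset.univ.filter fun w => endFloor w = v) p.endX ⟨w₀, by simp [h0]⟩
  simp only [Finset.mem_filter, Finset.mem_univ, true_and] at hw hmin
  exact ⟨w, hw, fun w' h1 => hmin w' (h1.trans hw)⟩

variable {p}

theorem IsLast.unique {w w' : D.ExtEdge} (h : p.IsLast w) (h' : p.IsLast w')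
    (hF : endFloor w = endFloor w') : w = w' :=
  p.eq_of_endX_eq hF (le_antisymm (h' w hF) (h w' hF.symm))

theorem slope_of_isLast {w : D.ExtEdge} (h : p.IsLast w) :
    p.slope (endFloor w) (p.endX w) = 1 := by
  classical
  rw [← sum_endMomentum (endFloor w), slope]
  congr 1
  exact Finset.filter_congr fun w' _ => ⟨fun h1 => h1.1, fun h1 => ⟨h1, h w' h1⟩⟩

/-- The slope of the floor on the left of an end of an elevator. -/
theorem slope_sub_endMomentum (w : D.ExtEdge) {t : ℝ} (ht : t < p.endX w)
    (hw : ∀ w₂, endFloor w₂ = endFloor w → ¬ (t < p.endX w₂ ∧ p.endX w₂ < p.endX w)) :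
    p.slope (endFloor w) t = p.slope (endFloor w) (p.endX w) - endMomentum w := by
  classical
  have h1 : Finset.univ.filter (fun w' => endFloor w' = endFloor w ∧ p.endX w' ≤ p.endX w) =
      insert w (Finset.univ.filter fun w' => endFloor w' = endFloor w ∧ p.endX w' ≤ t) := by
    ext w'
    simp only [Finset.mem_filter, Finset.mem_univ, true_and, Finset.mem_insert]
    constructor
    · rintro ⟨h2, h3⟩
      rcases h3.eq_or_lt with h4 | h4
      · exact Or.inl (p.eq_of_endX_eq h2 h4)
      · exact Or.inr ⟨h2, not_lt.1 fun h5 => hw w' h2 ⟨h5, h4⟩⟩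
    · rintro (rfl | ⟨h2, h3⟩)
      · exact ⟨rfl, le_rfl⟩
      · exact ⟨h2, h3.trans ht.le⟩
  rw [slope, slope, h1, Finset.sum_insert (by simp [ht])]
  ring

theorem slope_of_forall_lt {v : D.V} {t : ℝ} (h : ∀ w, endFloor w = v → t < p.endX w) :
    p.slope v t = 0 := by
  classical
  rw [slope, Finset.filter_false_of_mem, Finset.sum_empty]
  rintro w - ⟨h1, h2⟩
  exact not_lt.2 h2 (h w h1)

theorem slope_of_isFirst {w : D.ExtEdge} (h : p.IsFirst w) :
    p.slope (endFloor w) (p.endX w) - endMomentum w = 0 := by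
  rw [← slope_sub_endMomentum w (t := p.endX w - 1) (by linarith)
    fun w₂ h2 h3 => not_le.2 h3.2 (h w₂ h2)]
  exact slope_of_forall_lt fun w₂ h2 => by linarith [h w₂ h2]

end Placement

end LabeledFloorDiagram

/-! ### The curve with prescribed floors and elevators -/

theorem add_interchange {M : Type*} [AddCommMonoid M] (a b c x y z t : M) :
    a + x + (c + z) + (b + (t + y)) = a + (c + b) + (x + y + (z + t)) := by
  abel

namespace LabeledFloorDiagram

variable {d g : ℕ} {D : LabeledFloorDiagram d g}

namespace Placement

variable (p : D.Placement)

/-- The pairs of consecutive ends on the same floor. -/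
abbrev Gap : Type := {q : D.ExtEdge × D.ExtEdge // p.Consec q.1 q.2}

open Classical in
/-- At each end exactly one edge of the floor goes to the right: a gap, or the ray at the last
end. -/
theorem sum_gap_right {M : Type*} [AddCommMonoid M] (f : D.ExtEdge → M) (w : D.ExtEdge) :
    ∑ q : p.Gap, (if q.1.1 = w then f q.1.1 else 0) +
      ∑ w' : {w // p.IsLast w}, (if w'.1 = w then f w'.1 else 0) = f w := by
  rw [sum_subtype_eq_sum_ite p.IsLast fun w' => if w' = w then f w' else 0]
  have h1 : ∑ w', (if p.IsLast w' then (if w' = w then f w' else 0) else 0) =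
      if p.IsLast w then f w else 0 := by
    rw [Finset.sum_eq_single w]
    · simp
    · intro b _ hb
      simp [hb]
    · simp
  rw [h1]
  split_ifs with hl
  · rw [Finset.sum_eq_zero, zero_add]
    intro q _
    rw [if_neg]
    intro hq
    exact q.2.not_isLast (hq ▸ hl)
  · obtain ⟨w', hw'⟩ := exists_consec_right hl
    rw [add_zero, Finset.sum_eq_single (⟨(w, w'), hw'⟩ : p.Gap)]
    · simp
    · rintro ⟨⟨q1, q2⟩, hq⟩ - hne
      rw [if_neg]
      intro (h2 : q1 = w)
      subst h2
      exact hne (Subtype.ext (Prod.ext rfl (hq.right_unique hw')))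
    · simp

open Classical in
/-- At each end exactly one edge of the floor goes to the left: a gap, or the ray at the first
end. -/
theorem sum_gap_left {M : Type*} [AddCommMonoid M] (f : D.ExtEdge → M) (w : D.ExtEdge) :
    ∑ q : p.Gap, (if q.1.2 = w then f q.1.2 else 0) +
      ∑ w' : {w // p.IsFirst w}, (if w'.1 = w then f w'.1 else 0) = f w := by
  rw [sum_subtype_eq_sum_ite p.IsFirst fun w' => if w' = w then f w' else 0]
  have h1 : ∑ w', (if p.IsFirst w' then (if w' = w then f w' else 0) else 0) =
      if p.IsFirst w then f w else 0 := by
    rw [Finset.sum_eq_single w]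
    · simp
    · intro b _ hb
      simp [hb]
    · simp
  rw [h1]
  split_ifs with hl
  · rw [Finset.sum_eq_zero, zero_add]
    intro q _
    rw [if_neg]
    intro hq
    exact q.2.not_isFirst (hq ▸ hl)
  · obtain ⟨w', hw'⟩ := exists_consec_left hl
    rw [add_zero, Finset.sum_eq_single (⟨(w', w), hw'⟩ : p.Gap)]
    · simp
    · rintro ⟨⟨q1, q2⟩, hq⟩ - hne
      rw [if_neg]
      intro (h2 : q2 = w)
      subst h2
      exact hne (Subtype.ext (Prod.ext (hq.left_unique hw') rfl))
    · simp

open Classical in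
/-- Each end belongs to exactly one elevator. -/
theorem sum_elevator_ends {M : Type*} [AddCommMonoid M] (f : D.ExtEdge → M) (w : D.ExtEdge) :
    ∑ e, (if ExtEdge.firstHalf e = w then f (.firstHalf e) else 0) +
      (∑ e, (if ExtEdge.secondHalf e = w then f (.secondHalf e) else 0) +
      ∑ s : Σ v, Fin (D.leafCount v),
        (if ExtEdge.toLeaf s.1 s.2 = w then f (.toLeaf s.1 s.2) else 0)) = f w := by
  rw [← sum_extEdge fun w' => if w' = w then f w' else 0, Finset.sum_ite_eq']
  simp

/-- The position of the end of an elevator in the plane. -/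
noncomputable def endPos (w : D.ExtEdge) : ℝ × ℝ := (p.endX w, p.floorY (endFloor w) (p.endX w))

/-- The upper end of a bounded elevator is above its lower end, because its point is below the
former and above the latter. -/
theorem floorY_tgt_lt (e : D.E) :
    (p.endPos (.secondHalf e)).2 < (p.endPos (.firstHalf e)).2 :=
  (p.floorY_lt (a := .mid e) (v := D.tgt e) (by simp) (p.tgt_lt_mid e)).trans
    (p.lt_floorY (a := .mid e) (v := D.src e) (by simp) (p.mid_lt_src e))

theorem endPos_gap {w w' : D.ExtEdge} (h : p.Consec w w') :
    p.endPos w' = p.endPos w + (p.endX w' - p.endX w) •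
      latticeVec (1, p.slope (endFloor w) (p.endX w)) := by
  have h1 := p.floorY_sub (endFloor w) h.2.1.le h.2.2
  refine Prod.ext ?_ ?_
  · simp [endPos, latticeVec]
  · simp only [endPos, latticeVec, Prod.snd_add, Prod.smul_snd, smul_eq_mul, ← h.1]
    linarith

/-- The two ends of every edge. -/
def curveEnds : D.E ⊕ p.Gap → D.ExtEdge × D.ExtEdge :=
  Sum.elim (fun e => (.firstHalf e, .secondHalf e)) (fun q => q.1)

/-- The ends from which the rays start. -/
def curveRoot : (Σ v, Fin (D.leafCount v)) ⊕ ({w // p.IsFirst w} ⊕ {w // p.IsLast w}) →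
    D.ExtEdge :=
  Sum.elim (fun s => .toLeaf s.1 s.2) (Sum.elim Subtype.val Subtype.val)

/-- The length of an edge. The direction of an elevator has length equal to its weight. -/
noncomputable def curveLen : D.E ⊕ p.Gap → ℝ :=
  Sum.elim (fun e => ((p.endPos (.firstHalf e)).2 - (p.endPos (.secondHalf e)).2) / D.wt e)
    (fun q => p.endX q.1.2 - p.endX q.1.1)

/-- The direction of an edge. -/
noncomputable def curveDir : D.E ⊕ p.Gap → ℤ × ℤ :=
  Sum.elim (fun e => (0, -(D.wt e : ℤ)))
    (fun q => (1, p.slope (endFloor q.1.1) (p.endX q.1.1)))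

/-- The direction of a ray. -/
def curveRayDir : (Σ v, Fin (D.leafCount v)) ⊕ ({w // p.IsFirst w} ⊕ {w // p.IsLast w}) →
    ℤ × ℤ :=
  Sum.elim (fun _ => (0, -1)) (Sum.elim (fun _ => (-1, 0)) (fun _ => (1, 1)))

open Classical in
/-- The floor decomposed curve with the given elevators, whose floors are the graphs of the
functions `floorY`. Its vertices are the ends of the elevators. -/
noncomputable def curve : PlaneTropicalCurve where
  V := D.ExtEdge
  E := D.E ⊕ p.Gap
  U := (Σ v, Fin (D.leafCount v)) ⊕ ({w // p.IsFirst w} ⊕ {w // p.IsLast w})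
  fst e := (p.curveEnds e).1
  snd e := (p.curveEnds e).2
  root := p.curveRoot
  len := p.curveLen
  fst_ne_snd := by
    rintro (e | q)
    · simp [curveEnds]
    · intro h1
      have h2 := q.2.2.1
      rw [show q.1.1 = q.1.2 from h1] at h2
      exact lt_irrefl _ h2
  len_pos := by
    rintro (e | q)
    · have h1 : (0 : ℝ) < D.wt e := by exact_mod_cast D.wt_pos e
      exact div_pos (sub_pos.2 (p.floorY_tgt_lt e)) h1
    · exact sub_pos.2 q.2.2.1
  three_le_valency w := by
    rw [PlaneTropicalCurve.natCard_fiber, PlaneTropicalCurve.natCard_fiber,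
      PlaneTropicalCurve.natCard_fiber, Fintype.sum_sum_type, Fintype.sum_sum_type,
      Fintype.sum_sum_type, Fintype.sum_sum_type]
    have h1 := sum_elevator_ends (fun _ => 1) w
    have h2 := p.sum_gap_right (fun _ => 1) w
    have h3 := p.sum_gap_left (fun _ => 1) w
    have h4 : 3 ≤ ((∑ e, if ExtEdge.firstHalf e = w then 1 else 0) +
          ∑ q : p.Gap, if q.1.1 = w then 1 else 0) +
        ((∑ e, if ExtEdge.secondHalf e = w then 1 else 0) +
          ∑ q : p.Gap, if q.1.2 = w then 1 else 0) +
        ((∑ s : Σ v, Fin (D.leafCount v), if ExtEdge.toLeaf s.1 s.2 = w then 1 else 0) +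
          ((∑ w' : {w // p.IsFirst w}, if w'.1 = w then 1 else 0) +
          ∑ w' : {w // p.IsLast w}, if w'.1 = w then 1 else 0)) := by
      omega
    exact h4
  pos := p.endPos
  dir := p.curveDir
  rayDir := p.curveRayDir
  dir_ne_zero := by
    rintro (e | q)
    · have := D.wt_pos e
      simp [curveDir, this.ne']
    · simp [curveDir]
  rayDir_ne_zero := by
    rintro (s | w | w) <;> simp [curveRayDir]
  pos_snd := by
    rintro (e | q)
    · have h1 : (D.wt e : ℝ) ≠ 0 := by exact_mod_cast (D.wt_pos e).ne'
      refine Prod.ext ?_ ?_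
      · simp [curveEnds, curveDir, latticeVec, endPos, endX, endElevator]
      · simp only [curveEnds, curveDir, curveLen, latticeVec, Sum.elim_inl, Prod.snd_add,
          Prod.smul_snd, smul_eq_mul]
        push_cast
        field_simp
        ring
    · exact p.endPos_gap q.2
  balanced w := by
    rw [Finset.sum_filter, Finset.sum_filter, Finset.sum_filter, Fintype.sum_sum_type,
      Fintype.sum_sum_type, Fintype.sum_sum_type, Fintype.sum_sum_type]
    have h1 := sum_elevator_ends (fun w => ((0, -endMomentum w) : ℤ × ℤ)) w
    have h2 := p.sum_gap_right (fun w => ((1, p.slope (endFloor w) (p.endX w)) : ℤ × ℤ)) w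
    have h3 := p.sum_gap_left
      (fun w => ((-1, endMomentum w - p.slope (endFloor w) (p.endX w)) : ℤ × ℤ)) w
    have h4 : ∀ q : p.Gap, -p.curveDir (.inr q) =
        (-1, endMomentum q.1.2 - p.slope (endFloor q.1.2) (p.endX q.1.2)) := by
      intro q
      have h5 := slope_sub_endMomentum q.1.2 q.2.2.1 (p := p)
        fun w₂ h6 h7 => q.2.2.2 w₂ (h6.trans q.2.1.symm) h7
      refine Prod.ext rfl ?_
      simp only [curveDir, Sum.elim_inr, Prod.snd_neg, q.2.1, h5]
      ring
    have h5 : ∀ w' : {w // p.IsFirst w}, p.curveRayDir (.inr (.inl w')) =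
        (-1, endMomentum w'.1 - p.slope (endFloor w'.1) (p.endX w'.1)) := by
      intro w'
      have := slope_of_isFirst w'.2
      exact Prod.ext rfl (by simp only [curveRayDir, Sum.elim_inr, Sum.elim_inl]; omega)
    have h6 : ∀ w' : {w // p.IsLast w}, p.curveRayDir (.inr (.inr w')) =
        (1, p.slope (endFloor w'.1) (p.endX w'.1)) := by
      intro w'
      exact Prod.ext rfl (slope_of_isLast w'.2).symm
    have h7 : ∀ e, -p.curveDir (.inl e) = (0, -endMomentum (.secondHalf e)) := by
      intro e
      simp [curveDir, endMomentum]
    -- The elevator, the right edge and the left edge have the directions `(0, -m)`, `(1, s)` and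
    -- `(-1, m - s)`.
    have key := (congrArg₂ (· + ·) h1 (congrArg₂ (· + ·) h2 h3)).trans
      (show _ = (0 : ℤ × ℤ) from Prod.ext (by simp) (by simp))
    refine Eq.trans ?_ ((add_interchange _ _ _ _ _ _ _).trans key)
    refine congrArg₂ (· + ·) (congrArg₂ (· + ·) (congrArg₂ (· + ·) rfl rfl)
      (congrArg₂ (· + ·) ?_ ?_)) (congrArg₂ (· + ·) rfl (congrArg₂ (· + ·) ?_ ?_))
    · exact Finset.sum_congr rfl fun e _ => if_congr Iff.rfl (h7 e) rfl
    · exact Finset.sum_congr rfl fun q _ => if_congr Iff.rfl (h4 q) rfl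
    · exact Finset.sum_congr rfl fun w' _ => if_congr Iff.rfl (h5 w') rfl
    · exact Finset.sum_congr rfl fun w' _ => if_congr Iff.rfl (h6 w') rfl

end Placement

end LabeledFloorDiagram

/-! ### Properties of the constructed curve -/

namespace LabeledFloorDiagram

variable {d g : ℕ} {D : LabeledFloorDiagram d g}

namespace Placement

variable (p : D.Placement)

theorem isNormalized_curve : p.curve.IsNormalized := by
  rintro (e | q)
  · refine Or.inr ⟨rfl, ?_⟩
    have h1 := D.wt_pos e
    have h2 : (p.curve.dir (.inl e)).2 = -(D.wt e : ℤ) := rfl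
    omega
  · exact Or.inl Int.one_pos

theorem isElevator_inl (e : D.E) : p.curve.IsElevator (.inl e) := rfl

theorem not_isElevator_inr (q : p.Gap) : ¬ p.curve.IsElevator (.inr q) := one_ne_zero

theorem endFloor_eq_of_floorOf_eq {w w' : D.ExtEdge}
    (h : p.curve.floorOf w = p.curve.floorOf w') : endFloor w = endFloor w' := by
  refine PlaneTropicalCurve.eq_of_floorOf_eq (h := p.curve) (f := endFloor) ?_ h
  rintro (e | q) he
  · exact absurd (p.isElevator_inl e) he
  · exact q.2.1

theorem floorOf_eq_of_consec {w w' : D.ExtEdge} (h : p.Consec w w') :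
    p.curve.floorOf w = p.curve.floorOf w' :=
  p.curve.floorOf_fst_eq_snd (p.not_isElevator_inr ⟨(w, w'), h⟩)

/-- Moving to the right through the gaps one stays on the same floor. -/
theorem exists_isLast_floorOf_eq (w : D.ExtEdge) :
    ∃ w', p.IsLast w' ∧ p.curve.floorOf w' = p.curve.floorOf w := by
  classical
  obtain ⟨w', h1, hmax⟩ := Finset.exists_max_image
    (Finset.univ.filter fun w' : D.ExtEdge => p.curve.floorOf w' = p.curve.floorOf w) p.endX
    ⟨w, by simp⟩
  simp only [Finset.mem_filter, Finset.mem_univ, true_and] at h1 hmax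
  refine ⟨w', ?_, h1⟩
  by_contra h2
  obtain ⟨w'', h3⟩ := exists_consec_right h2
  exact not_lt.2 (hmax w'' ((p.floorOf_eq_of_consec h3).symm.trans h1)) h3.2.1

theorem floorOf_eq_iff {w w' : D.ExtEdge} :
    p.curve.floorOf w = p.curve.floorOf w' ↔ endFloor w = endFloor w' := by
  refine ⟨p.endFloor_eq_of_floorOf_eq, fun h => ?_⟩
  obtain ⟨w₁, h1, h2⟩ := p.exists_isLast_floorOf_eq w
  obtain ⟨w₂, h3, h4⟩ := p.exists_isLast_floorOf_eq w'
  have h5 : endFloor w₁ = endFloor w₂ := (p.endFloor_eq_of_floorOf_eq h2).trans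
    (h.trans (p.endFloor_eq_of_floorOf_eq h4).symm)
  rw [← h2, ← h4, h1.unique h3 h5]

/-- The floors of the constructed curve are the vertices of the floor diagram. -/
noncomputable def floorEquiv : p.curve.Floor ≃ D.V :=
  Equiv.ofBijective
    (Quotient.lift endFloor fun _ _ h => p.endFloor_eq_of_floorOf_eq (Quotient.sound h)) (by
      constructor
      · intro F F'
        induction F using Quotient.inductionOn with | h w =>
        induction F' using Quotient.inductionOn with | h w' =>
        exact p.floorOf_eq_iff.2
      · intro v
        obtain ⟨w, hw⟩ := exists_end v
        exact ⟨p.curve.floorOf w, hw⟩)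

/-- The bounded elevators of the constructed curve are the edges of the floor diagram. -/
noncomputable def elevatorEquiv : D.E ≃ {e // p.curve.IsElevator e} :=
  Equiv.ofBijective (fun e => ⟨.inl e, p.isElevator_inl e⟩) (by
    constructor
    · intro e e' h
      exact Sum.inl_injective (congrArg Subtype.val h)
    · rintro ⟨e | q, he⟩
      · exact ⟨e, rfl⟩
      · exact absurd he (p.not_isElevator_inr q))

/-- The unbounded elevators of the constructed curve are the leaves of the extended graph. -/
noncomputable def leafEquiv : (Σ v, Fin (D.leafCount v)) ≃ {u // p.curve.IsUnboundedElevator u} :=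
  Equiv.ofBijective (fun s => ⟨.inl s, rfl⟩) (by
    constructor
    · intro e e' h
      exact Sum.inl_injective (congrArg Subtype.val h)
    · rintro ⟨s | w | w, hu⟩
      · exact ⟨s, rfl⟩
      · exact absurd hu (show ((-1 : ℤ)) ≠ 0 by simp)
      · exact absurd hu (show ((1 : ℤ)) ≠ 0 by simp))

/-- The floor diagram of the constructed curve. -/
noncomputable def floorDiagramIso : p.curve.floorDiagram.Iso D.toWeightedDigraph where
  onV := p.floorEquiv
  onE := p.elevatorEquiv.symm
  src_eq e := by
    obtain ⟨e, rfl⟩ := p.elevatorEquiv.surjective e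
    exact (congrArg D.src (p.elevatorEquiv.symm_apply_apply e)).trans
      (congrArg (p.floorEquiv ∘ p.curve.floorOf)
        (p.isNormalized_curve.upper_eq (p.isElevator_inl e))).symm
  tgt_eq e := by
    obtain ⟨e, rfl⟩ := p.elevatorEquiv.surjective e
    exact (congrArg D.tgt (p.elevatorEquiv.symm_apply_apply e)).trans
      (congrArg (p.floorEquiv ∘ p.curve.floorOf)
        (p.isNormalized_curve.lower_eq (p.isElevator_inl e))).symm
  wt_eq e := by
    obtain ⟨e, rfl⟩ := p.elevatorEquiv.surjective e
    have h1 := p.isNormalized_curve.edgeWeight_eq (p.isElevator_inl e)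
    have h2 : (p.curve.dir (.inl e)).2 = -(D.wt e : ℤ) := rfl
    rw [h2, neg_neg] at h1
    exact (congrArg D.wt (p.elevatorEquiv.symm_apply_apply e)).trans (Int.natCast_inj.1 h1).symm

theorem isIrreducible_curve : p.curve.IsIrreducible := by
  let comp : D.ExtEdge → p.curve.toSimple.ConnectedComponent :=
    p.curve.toSimple.connectedComponentMk
  have hedge : ∀ e : p.curve.E, comp (p.curve.fst e) = comp (p.curve.snd e) := fun e =>
    SimpleGraph.ConnectedComponent.sound (SimpleGraph.Adj.reachable
      ((SimpleGraph.fromRel_adj _ _ _).2 ⟨p.curve.fst_ne_snd e, Or.inl ⟨e, rfl, rfl⟩⟩))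
  have hfloor : ∀ w w' : D.ExtEdge, endFloor w = endFloor w' → comp w = comp w' :=
    fun w w' h => PlaneTropicalCurve.eq_of_floorOf_eq (f := comp) (fun e _ => hedge e)
      (p.floorOf_eq_iff.2 h)
  have hdiag : ∀ e : D.E, ∀ w w' : D.ExtEdge, endFloor w = D.src e → endFloor w' = D.tgt e →
      comp w = comp w' := fun e w w' h h' =>
    (hfloor w (.firstHalf e) h).trans ((hedge (.inl e)).trans (hfloor (.secondHalf e) w' h'.symm))
  have hwalk : ∀ u v : D.V, D.toWeightedDigraph.toSimple.Walk u v → ∀ w w' : D.ExtEdge,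
      endFloor w = u → endFloor w' = v → comp w = comp w' := by
    intro u v W
    induction W with
    | nil => exact fun w w' h h' => hfloor w w' (h.trans h'.symm)
    | @cons a b c hab W ih =>
      intro w w' h h'
      obtain ⟨w₂, h2⟩ := exists_end b
      refine Eq.trans ?_ (ih w₂ w' h2 h')
      rcases ((SimpleGraph.fromRel_adj _ _ _).1 hab).2 with ⟨e, he, he'⟩ | ⟨e, he, he'⟩
      · exact hdiag e w w₂ (h.trans he.symm) (h2.trans he'.symm)
      · exact (hdiag e w₂ w (h2.trans he.symm) (h.trans he'.symm)).symm
  obtain ⟨v⟩ := D.connected.nonempty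
  have : Nonempty p.curve.V := ⟨(exists_end v).choose⟩
  refine SimpleGraph.Connected.mk fun w w' => ?_
  obtain ⟨W⟩ := D.connected.preconnected (endFloor w) (endFloor w')
  exact SimpleGraph.ConnectedComponent.exact (hwalk _ _ W w w' rfl rfl)

/-- Every floor has a unique last end. -/
noncomputable def lastEquiv : {w // p.IsLast w} ≃ D.V :=
  Equiv.ofBijective (fun w => endFloor w.1)
    ⟨fun w w' h => Subtype.ext (w.2.unique w'.2 h), fun v =>
      let ⟨w, h1, h2⟩ := p.exists_isLast v
      ⟨⟨w, h2⟩, h1⟩⟩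

/-- All ends of elevators but the last ones on the floors are left ends of gaps. -/
noncomputable def gapEquiv : p.Gap ≃ {w // ¬ p.IsLast w} :=
  Equiv.ofBijective (fun q => ⟨q.1.1, q.2.not_isLast⟩) (by
    constructor
    · rintro ⟨⟨w₁, w₂⟩, hq⟩ ⟨⟨w₁', w₂'⟩, hq'⟩ h
      obtain rfl : w₁ = w₁' := congrArg Subtype.val h
      obtain rfl : w₂ = w₂' := hq.right_unique hq'
      rfl
    · rintro ⟨w, hw⟩
      obtain ⟨w', hw'⟩ := exists_consec_right hw
      exact ⟨⟨(w, w'), hw'⟩, rfl⟩)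

theorem degree_curve : p.curve.degree = d := by
  classical
  have h1 : p.curve.degree =
      (∑ _s : Σ v, Fin (D.leafCount v), max (max (0 : ℤ) (-1)) 0) +
      ((∑ _w : {w // p.IsFirst w}, max (max (-1 : ℤ) 0) 0) +
        ∑ _w : {w // p.IsLast w}, max (max (1 : ℤ) 1) 0) := by
    refine (Fintype.sum_equiv (Equiv.refl _) _ _ fun _ => rfl).trans
      ((Fintype.sum_sum_type _).trans (congrArg₂ (· + ·) rfl (Fintype.sum_sum_type _)))
  have h2 := (Fintype.card_congr p.lastEquiv).trans D.card_V
  rw [h1]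
  simp [← h2]

theorem genus_curve : p.curve.genus = g := by
  classical
  have h1 : Nat.card p.curve.toSimple.ConnectedComponent = 1 := by
    have := p.isIrreducible_curve.preconnected.subsingleton_connectedComponent
    have : Nonempty p.curve.toSimple.ConnectedComponent :=
      p.isIrreducible_curve.nonempty.map p.curve.toSimple.connectedComponentMk
    exact Nat.card_unique
  have h2 : Fintype.card p.curve.E = Fintype.card D.E + Fintype.card p.Gap :=
    (Fintype.card_congr (Equiv.refl _)).trans Fintype.card_sum
  have h3 : Fintype.card p.curve.V = Fintype.card D.ExtEdge := Fintype.card_congr (Equiv.refl _)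
  have h4 : Fintype.card p.Gap = Fintype.card D.ExtEdge - Fintype.card {w // p.IsLast w} :=
    (Fintype.card_congr p.gapEquiv).trans (Fintype.card_subtype_compl _)
  have h5 := Fintype.card_subtype_le p.IsLast
  rw [Fintype.card_congr p.lastEquiv, D.card_V] at h4 h5
  have h6 := D.card_E
  unfold TropicalCurve.genus
  rw [h1, h2, h3]
  omega

/-- The graph of `floorY v` is contained in the floor `v` of the constructed curve. -/
theorem mem_image_floorSet (v : D.V) (t : ℝ) :
    (t, p.floorY v t) ∈ p.curve.map '' p.curve.floorSet (p.floorEquiv.symm v) := by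
  classical
  have hfl : ∀ w : D.ExtEdge, endFloor w = v → p.curve.floorOf w = p.floorEquiv.symm v :=
    fun w hw => (Equiv.eq_symm_apply _).2 hw
  rw [PlaneTropicalCurve.mem_image_floorSet]
  by_cases hleft : ∃ w, endFloor w = v ∧ p.endX w ≤ t
  -- The last end before `t` starts a gap or a ray over `t`.
  · obtain ⟨w₀, h0⟩ := hleft
    obtain ⟨w, hw, hmax⟩ := Finset.exists_max_image
      (Finset.univ.filter fun w => endFloor w = v ∧ p.endX w ≤ t) p.endX ⟨w₀, by simp [h0]⟩
    simp only [Finset.mem_filter, Finset.mem_univ, true_and] at hw hmax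
    obtain ⟨rfl, hwt⟩ := hw
    have hY := p.floorY_sub (endFloor w) hwt fun w' h1 h2 => not_lt.2 (hmax w' ⟨h1, h2.2.le⟩) h2.1
    by_cases hl : p.IsLast w
    · refine Or.inr ⟨.inr (.inr ⟨w, hl⟩), one_ne_zero, hfl w rfl, ?_⟩
      refine p.curve.mem_image_closedRay.2 ?_
      refine ⟨t - p.endX w, sub_nonneg.2 hwt, ?_⟩
      change _ = p.endPos w + (t - p.endX w) • latticeVec (1, 1)
      rw [slope_of_isLast hl] at hY
      refine Prod.ext ?_ ?_
      · simp [endPos, latticeVec]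
      · simp only [endPos, latticeVec, Prod.snd_add, Prod.smul_snd, smul_eq_mul]
        linarith
    · obtain ⟨w', hw'⟩ := exists_consec_right hl
      refine Or.inl ⟨.inr ⟨(w, w'), hw'⟩, p.not_isElevator_inr _, hfl w rfl, ?_⟩
      refine p.curve.mem_image_closedEdge.2 ?_
      refine ⟨t - p.endX w, sub_nonneg.2 hwt, ?_, ?_⟩
      · refine sub_le_sub_right (not_lt.1 fun h1 => ?_) _
        exact not_lt.2 (hmax w' ⟨hw'.1.symm, h1.le⟩) hw'.2.1
      · change _ = p.endPos w + (t - p.endX w) • latticeVec (1, p.slope (endFloor w) (p.endX w))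
        refine Prod.ext ?_ ?_
        · simp [endPos, latticeVec]
        · simp only [endPos, latticeVec, Prod.snd_add, Prod.smul_snd, smul_eq_mul]
          linarith
  -- Before the first end the floor is the ray going to the left.
  · push Not at hleft
    obtain ⟨w, rfl, hf⟩ := p.exists_isFirst v
    refine Or.inr ⟨.inr (.inl ⟨w, hf⟩), show (-1 : ℤ) ≠ 0 by simp, hfl w rfl, ?_⟩
    have htw := hleft w rfl
    have hY := p.floorY_sub (endFloor w) htw.le fun w' h1 h2 => not_lt.2 (hf w' h1) h2.2
    rw [slope_of_forall_lt hleft] at hY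
    refine p.curve.mem_image_closedRay.2 ?_
    refine ⟨p.endX w - t, sub_nonneg.2 htw.le, ?_⟩
    change _ = p.endPos w + (p.endX w - t) • latticeVec (-1, 0)
    refine Prod.ext ?_ ?_
    · simp [endPos, latticeVec]
    · simp only [endPos, latticeVec, Prod.snd_add, Prod.smul_snd, smul_eq_mul]
      push_cast at hY ⊢
      linarith

theorem point_mid_mem (e : D.E) :
    p.point (.mid e) ∈ p.curve.map '' p.curve.closedEdge (.inl e) := by
  refine p.curve.mem_image_closedEdge.2 ?_
  have h0 : (0 : ℝ) < D.wt e := by exact_mod_cast D.wt_pos e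
  have h1 := p.floorY_lt (a := .mid e) (v := D.tgt e) (by simp) (p.tgt_lt_mid e)
  have h2 := p.lt_floorY (a := .mid e) (v := D.src e) (by simp) (p.mid_lt_src e)
  change ((p.endPos (.secondHalf e)).2 < _) at h1
  change (_ < (p.endPos (.firstHalf e)).2) at h2
  refine ⟨((p.endPos (.firstHalf e)).2 - (p.point (.mid e)).2) / D.wt e,
    div_nonneg (by linarith) h0.le, ?_, ?_⟩
  · change _ ≤ ((p.endPos (.firstHalf e)).2 - (p.endPos (.secondHalf e)).2) / D.wt e
    gcongr
  · change _ = p.endPos (.firstHalf e) + _ • latticeVec (0, -(D.wt e : ℤ))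
    refine Prod.ext ?_ ?_
    · simp [endPos, latticeVec, endX, endElevator]
    · simp only [latticeVec, Prod.snd_add, Prod.smul_snd, smul_eq_mul]
      push_cast
      field_simp
      ring

theorem point_leaf_mem (s : Σ v, Fin (D.leafCount v)) :
    p.point (.leaf s.1 s.2) ∈ p.curve.map '' p.curve.closedRay (.inl s) := by
  refine p.curve.mem_image_closedRay.2 ?_
  have h1 := p.lt_floorY (a := .leaf s.1 s.2) (v := s.1) (by simp) (p.leaf_lt s.1 s.2)
  change (_ < (p.endPos (.toLeaf s.1 s.2)).2) at h1
  refine ⟨(p.endPos (.toLeaf s.1 s.2)).2 - (p.point (.leaf s.1 s.2)).2, by linarith, ?_⟩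
  change _ = p.endPos (.toLeaf s.1 s.2) + _ • latticeVec (0, -1)
  refine Prod.ext ?_ ?_
  · simp [endPos, latticeVec, endX, endElevator]
  · simp [latticeVec]

theorem point_orig_mem (v : D.V) :
    p.point (.orig v) ∈ p.curve.map '' p.curve.floorSet (p.floorEquiv.symm v) := by
  have h1 := p.mem_image_floorSet v (p.point (.orig v)).1
  rwa [floorY_orig] at h1

theorem point_mem_range (a : D.ExtVertex) : p.point a ∈ Set.range p.curve.map := by
  rcases a with v | e | ⟨v, k⟩
  · exact Set.image_subset_range _ _ (p.point_orig_mem v)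
  · exact Set.image_subset_range _ _ (p.point_mid_mem e)
  · exact Set.image_subset_range _ _ (p.point_leaf_mem ⟨v, k⟩)

theorem isCurveThrough_curve {N : ℕ} {P : Fin N → ℝ × ℝ} {pt : D.ExtVertex → Fin N}
    (hpt : Function.Surjective pt) (hP : ∀ a, p.point a = P (pt a)) :
    p.curve.IsCurveThrough d g P := by
  refine ⟨p.isIrreducible_curve, p.degree_curve, p.genus_curve, fun i => ?_⟩
  obtain ⟨a, rfl⟩ := hpt i
  rw [← hP]
  exact p.point_mem_range a

end Placement

end LabeledFloorDiagram

namespace FloorMarking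

variable {d g : ℕ} (M : FloorMarking d g)

theorem card_extVertex : Fintype.card M.diagram.ExtVertex = 3 * d - 1 + g := by
  have h1 : Fintype.card M.diagram.ExtVertex = Fintype.card M.diagram.V +
      (Fintype.card M.diagram.E + ∑ v, M.diagram.leafCount v) := by
    rw [Fintype.card_congr M.diagram.extVertexEquiv, Fintype.card_sum, Fintype.card_sum,
      Fintype.card_sigma]
    simp
  have h2 : ∑ v, (M.diagram.leafCount v : ℤ) = d := by
    simp only [LabeledFloorDiagram.cast_leafCount, LabeledFloorDiagram.div_eq_sum]
    rw [Finset.sum_sub_distrib, Finset.sum_sub_distrib, Finset.sum_comm,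
      Finset.sum_comm (f := fun v e => if M.diagram.tgt e = v then (M.diagram.wt e : ℤ) else 0)]
    simp [M.diagram.card_V]
  have h3 : ∑ v, M.diagram.leafCount v = d := by exact_mod_cast h2
  have h4 := M.diagram.card_E
  have h5 := M.diagram.card_V
  have h6 := Fintype.card_pos_iff.2 M.diagram.connected.nonempty
  omega

/-- The bijection from the vertices of the extended graph to the points, which are listed from
bottom to top, that reverses the order of the marking. -/
theorem exists_pointEquiv : ∃ pt : M.diagram.ExtVertex ≃ Fin (3 * d - 1 + g),
    ∀ a b, M.order.lt a b ↔ pt b < pt a := by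
  let : LinearOrder M.diagram.ExtVertex := M.order
  let o := Fintype.orderIsoFinOfCardEq M.diagram.ExtVertex M.card_extVertex
  refine ⟨o.symm.toEquiv.trans Fin.revPerm, fun a b => ?_⟩
  exact o.symm.lt_iff_lt.symm.trans Fin.rev_lt_rev.symm

/-- The points of a stretched configuration as points for the floors and elevators. -/
theorem exists_placement (hd : 0 < d) {P : Fin (3 * d - 1 + g) → ℝ × ℝ}
    (hP : IsVerticallyStretched d g P) {pt : M.diagram.ExtVertex ≃ Fin (3 * d - 1 + g)}
    (hpt : ∀ a b, M.order.lt a b ↔ pt b < pt a) :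
    ∃ p : M.diagram.Placement, ∀ a, p.point a = P (pt a) := by
  obtain ⟨c, W, -, hx, hy⟩ := hP.exists_width hd
  have hlt : ∀ a b, M.order.lt a b → (P (pt b)).2 < (P (pt a)).2 :=
    fun a b hab => hP.2.1 ((hpt a b).1 hab)
  refine ⟨⟨fun a => P (pt a), W, hP.1.injective.comp pt.injective, fun a b => hx _ _,
    fun a b hab => hy _ _ (pt.injective.ne hab), fun e => hlt _ _ (M.src_lt_tgt (.firstHalf e)),
    fun e => hlt _ _ (M.src_lt_tgt (.secondHalf e)),
    fun v k => hlt _ _ (M.src_lt_tgt (.toLeaf v k))⟩, fun a => rfl⟩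

end FloorMarking

theorem LabeledFloorDiagram.Placement.inducesMarking_curve {d g : ℕ} (hd : 0 < d)
    {P : Fin (3 * d - 1 + g) → ℝ × ℝ} (hP : IsVerticallyStretched d g P) {M : FloorMarking d g}
    {pt : M.diagram.ExtVertex ≃ Fin (3 * d - 1 + g)}
    (hpt : ∀ a b, M.order.lt a b ↔ pt b < pt a) (p : M.diagram.Placement)
    (hp : ∀ a, p.point a = P (pt a)) : p.curve.InducesMarking P M := by
  have hh := p.isCurveThrough_curve pt.surjective hp
  have hfd := p.isNormalized_curve.isFloorDecomposed hd hP hh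
  obtain ⟨σ, hσ⟩ := hfd.exists_equiv hd hP hh
  have huniq : ∀ o a, p.point a ∈ p.curve.image o → ∀ i, P i ∈ p.curve.image o ↔ i = pt a := by
    intro o a ha i
    rw [hp] at ha
    rw [hσ, (hσ _ _).1 ha]
  refine ⟨p.floorDiagramIso, p.leafEquiv.symm, pt, fun u => ?_, fun u => ?_, fun F => ?_,
    fun e => ?_, fun u => ?_, fun a b => ?_⟩
  · obtain ⟨s, rfl⟩ := p.leafEquiv.surjective u
    rw [Equiv.symm_apply_apply]
    rfl
  · have h1 := hfd.rayDir_of_isUnboundedElevator u.2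
    unfold PlaneTropicalCurve.rayWeight
    rw [h1]
    exact ⟨rfl, by simp⟩
  · refine huniq (.inl F) (.orig (p.floorEquiv F)) ?_
    have h1 := p.point_orig_mem (p.floorEquiv F)
    rwa [Equiv.symm_apply_apply] at h1
  · obtain ⟨e, rfl⟩ := p.elevatorEquiv.surjective e
    have h1 := huniq (.inr (.inl (p.elevatorEquiv e))) (.mid e) (p.point_mid_mem e)
    have h2 : p.floorDiagramIso.onE (p.elevatorEquiv e) = e := Equiv.symm_apply_apply _ _
    rw [h2]
    exact h1
  · obtain ⟨s, rfl⟩ := p.leafEquiv.surjective u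
    rw [Equiv.symm_apply_apply]
    exact huniq (.inr (.inr (p.leafEquiv s))) (.leaf s.1 s.2) (p.point_leaf_mem s)
  · exact (hpt a b).trans hP.2.1.lt_iff_lt.symm

/-! ### Curves are determined by their floor diagrams and points -/

namespace PlaneTropicalCurve

variable {h : PlaneTropicalCurve} {d g : ℕ}

/-- The edge or ray that leaves a vertex to the right is unique. -/
theorem IsFloorDecomposed.right_unique (hfd : h.IsFloorDecomposed d g) {κ κ' : h.E ⊕ h.U}
    (hb : h.strandBase κ = h.strandBase κ') (h1 : 0 < (h.strandDir κ).1)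
    (h2 : 0 < (h.strandDir κ').1) : κ = κ' := by
  have hcr : ∀ κ : h.E ⊕ h.U, 0 < (h.strandDir κ).1 →
      h.Crosses κ (h.pos (h.strandBase κ)).1 := by
    rintro (e | u) h3
    · exact ⟨h3, le_rfl, fst_pos_lt_of_dir_pos h3⟩
    · exact Or.inl ⟨h3, le_rfl⟩
  refine hfd.eq_of_crosses (hcr κ h1) (congrArg _ hb) ?_
  rw [hb]
  exact hcr κ' h2

/-- Every vertex is an end of an elevator: apart from elevators there is just one edge or ray to
the right and one to the left, but there are at least three in total. -/
theorem IsFloorDecomposed.exists_elevator_at (hfd : h.IsFloorDecomposed d g) (v : h.V) :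
    (∃ e, h.IsElevator e ∧ (h.fst e = v ∨ h.snd e = v)) ∨
      ∃ u, h.IsUnboundedElevator u ∧ h.root u = v := by
  classical
  by_contra! hcon
  obtain ⟨hc1, hc2⟩ := hcon
  -- With `a` edges and rays to the right and `b` to the left, all of horizontal momentum `±1`,
  -- balancing gives `a = b`. Since `a ≤ 1`, the valency `a + b` is at most two.
  have h1 := h.sum_fst_over_set fun w => w = v
  have h2 := h.three_le_valency v
  rw [natCard_fiber, natCard_fiber, natCard_fiber] at h2
  have hr : (∑ e, if h.fst e = v then 1 else 0) +
      (∑ u, if h.root u = v ∧ 0 < (h.rayDir u).1 then 1 else 0) ≤ 1 := by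
    have h3 : Finset.card (Finset.univ.filter fun κ : h.E ⊕ h.U =>
        h.strandBase κ = v ∧ 0 < (h.strandDir κ).1) ≤ 1 := by
      rw [Finset.card_le_one]
      simp only [Finset.mem_filter, Finset.mem_univ, true_and]
      exact fun κ hκ κ' hκ' => hfd.right_unique (hκ.1.trans hκ'.1.symm) hκ.2 hκ'.2
    rw [Finset.card_filter, Fintype.sum_sum_type] at h3
    refine le_trans (add_le_add_left (Finset.sum_le_sum fun e _ => ?_) _) h3
    split_ifs with h4 h5 h5
    · exact le_rfl
    · exact absurd ⟨h4, hfd.normalized.dir_fst_pos fun h6 => (hc1 e h6).1 h4⟩ h5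
    · exact Nat.zero_le _
    · exact le_rfl
  have he : ∀ e, (((if h.fst e = v then 1 else 0) - (if h.snd e = v then 1 else 0) : ℤ)) *
      (h.dir e).1 = (if h.fst e = v then 1 else 0) - (if h.snd e = v then 1 else 0) := by
    intro e
    by_cases h3 : h.IsElevator e
    · simp [hc1 e h3]
    · rw [hfd.dir_fst_eq_one h3, mul_one]
  have hu : ∀ u, (if h.root u = v then 1 else 0 : ℤ) * (h.rayDir u).1 =
      2 * (if h.root u = v ∧ 0 < (h.rayDir u).1 then 1 else 0) -
        (if h.root u = v then 1 else 0) := by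
    intro u
    by_cases h4 : h.root u = v
    · rcases hfd.rayDir_cases u with h3 | h3 | h3
      · exact absurd h4 (hc2 u (by simp [IsUnboundedElevator, h3]))
      · simp [h3, h4]
      · simp [h3, h4]
    · simp [h4]
  simp only [he, hu, Finset.sum_sub_distrib, ← Finset.mul_sum] at h1
  zify at h2 hr
  omega

end PlaneTropicalCurve

open PlaneTropicalCurve LabeledFloorDiagram

/-- An identification of the floor diagram of a curve with a labeled floor diagram, such that each
floor and each elevator of the curve contains the point that is placed for it. -/
structure LabeledFloorDiagram.Placement.Realization {d g : ℕ} {D : LabeledFloorDiagram d g}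
    (p : D.Placement) (h : PlaneTropicalCurve) where
  decomposed : h.IsFloorDecomposed d g
  iso : h.floorDiagram.Iso D.toWeightedDigraph
  leaf : {u // h.IsUnboundedElevator u} ≃ Σ v : D.V, Fin (D.leafCount v)
  leaf_fst : ∀ u, (leaf u).1 = iso.onV (h.floorOf (h.root u))
  mem_floor : ∀ F, p.point (.orig (iso.onV F)) ∈ h.map '' h.floorSet F
  mem_edge : ∀ e : {e // h.IsElevator e}, p.point (.mid (iso.onE e)) ∈ h.map '' h.closedEdge e
  mem_ray : ∀ u : {u // h.IsUnboundedElevator u},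
    p.point (.leaf (leaf u).1 (leaf u).2) ∈ h.map '' h.closedRay u

namespace LabeledFloorDiagram.Placement.Realization

variable {d g : ℕ} {D : LabeledFloorDiagram d g} {p : D.Placement} {h : PlaneTropicalCurve}
  (r : p.Realization h)

/-- The elevator of the curve for an edge of the floor diagram. -/
def elevator (e : D.E) : {e // h.IsElevator e} := r.iso.onE.symm e

theorem onE_elevator (e : D.E) : r.iso.onE (r.elevator e) = e := r.iso.onE.apply_symm_apply e

theorem elevator_onE (e : {e // h.IsElevator e}) : r.elevator (r.iso.onE e) = e :=
  r.iso.onE.symm_apply_apply e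

/-- The vertex of the curve at an end of an elevator. -/
def vertex : D.ExtEdge → h.V
  | .firstHalf e => h.fst (r.elevator e)
  | .secondHalf e => h.snd (r.elevator e)
  | .toLeaf v k => h.root (r.leaf.symm ⟨v, k⟩)

theorem onV_floorOf_vertex (w : D.ExtEdge) :
    r.iso.onV (h.floorOf (r.vertex w)) = endFloor w := by
  rcases w with e | e | ⟨v, k⟩
  · have h1 := r.iso.src_eq (r.elevator e)
    have h2 := r.decomposed.normalized.upper_eq (r.elevator e).2
    exact (congrArg (r.iso.onV ∘ h.floorOf) h2).symm.trans
      (h1.symm.trans (congrArg D.src (r.onE_elevator e)))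
  · have h1 := r.iso.tgt_eq (r.elevator e)
    have h2 := r.decomposed.normalized.lower_eq (r.elevator e).2
    exact (congrArg (r.iso.onV ∘ h.floorOf) h2).symm.trans
      (h1.symm.trans (congrArg D.tgt (r.onE_elevator e)))
  · have h1 := r.leaf_fst (r.leaf.symm ⟨v, k⟩)
    rw [Equiv.apply_symm_apply] at h1
    exact h1.symm

theorem fst_pos_vertex (w : D.ExtEdge) : (h.pos (r.vertex w)).1 = p.endX w := by
  have h1 : ∀ e, p.endX (.firstHalf e) = (h.pos (h.fst (r.elevator e))).1 := by
    intro e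
    have h2 := r.mem_edge (r.elevator e)
    rw [onE_elevator] at h2
    exact fst_eq_elevatorX (κ := .inl (r.elevator e)) h2
  rcases w with e | e | ⟨v, k⟩
  · exact (h1 e).symm
  · exact (fst_pos_eq_of_isElevator (r.elevator e).2).trans (h1 e).symm
  · have h2 := r.mem_ray (r.leaf.symm ⟨v, k⟩)
    rw [Equiv.apply_symm_apply] at h2
    exact (fst_eq_elevatorX (κ := .inr (r.leaf.symm ⟨v, k⟩)) h2).symm

theorem floorOf_vertex_eq {w w' : D.ExtEdge} (hF : endFloor w = endFloor w') :
    h.floorOf (r.vertex w) = h.floorOf (r.vertex w') :=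
  r.iso.onV.injective ((r.onV_floorOf_vertex w).trans (hF.trans (r.onV_floorOf_vertex w').symm))

theorem endFloor_eq {w w' : D.ExtEdge} (hF : h.floorOf (r.vertex w) = h.floorOf (r.vertex w')) :
    endFloor w = endFloor w' :=
  (r.onV_floorOf_vertex w).symm.trans ((congrArg r.iso.onV hF).trans (r.onV_floorOf_vertex w'))

theorem vertex_injective : Function.Injective r.vertex := fun w w' hw =>
  p.eq_of_endX_eq (r.endFloor_eq (congrArg _ hw))
    (by rw [← r.fst_pos_vertex, ← r.fst_pos_vertex, hw])

theorem vertex_surjective : Function.Surjective r.vertex := by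
  intro v
  rcases r.decomposed.exists_elevator_at v with ⟨e, he, hv⟩ | ⟨u, hu, rfl⟩
  · have h1 : (r.elevator (r.iso.onE ⟨e, he⟩)).1 = e := congrArg Subtype.val (r.elevator_onE ⟨e, he⟩)
    rcases hv with rfl | rfl
    · exact ⟨.firstHalf (r.iso.onE ⟨e, he⟩), congrArg h.fst h1⟩
    · exact ⟨.secondHalf (r.iso.onE ⟨e, he⟩), congrArg h.snd h1⟩
  · refine ⟨.toLeaf (r.leaf ⟨u, hu⟩).1 (r.leaf ⟨u, hu⟩).2, ?_⟩
    exact congrArg (fun u : {u // h.IsUnboundedElevator u} => h.root u.1)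
      (r.leaf.symm_apply_apply ⟨u, hu⟩)

/-- The slopes of a floor are determined by the elevators. -/
theorem strandDir_snd_eq_slope {κ : h.E ⊕ h.U} {c : ℝ} (hκ : h.Crosses κ c) :
    (h.strandDir κ).2 = p.slope (r.iso.onV (h.floorOf (h.strandBase κ))) c := by
  classical
  have hS : ∀ w, (h.floorOf (r.vertex w) = h.floorOf (h.strandBase κ) ∧
      (h.pos (r.vertex w)).1 ≤ c) ↔
      (endFloor w = r.iso.onV (h.floorOf (h.strandBase κ)) ∧ p.endX w ≤ c) := by
    intro w
    rw [r.fst_pos_vertex, ← r.onV_floorOf_vertex w]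
    exact and_congr_left fun _ => r.iso.onV.injective.eq_iff.symm
  rw [r.decomposed.strandDir_snd_of_crosses hκ
    (S := fun v => h.floorOf v = h.floorOf (h.strandBase κ) ∧ (h.pos v).1 ≤ c) fun _ => Iff.rfl,
    slope, Finset.sum_filter, sum_extEdge, ← add_assoc, ← Finset.sum_add_distrib]
  refine congrArg₂ (· + ·) (Fintype.sum_equiv r.iso.onE _ _ ?_)
    (Fintype.sum_equiv r.leaf _ _ ?_)
  · intro (e : {e // h.IsElevator e})
    have h1 := hS (.firstHalf (r.iso.onE e))
    have h2 := hS (.secondHalf (r.iso.onE e))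
    rw [show r.vertex (.firstHalf (r.iso.onE e)) = h.fst e.1 from
      congrArg (fun e : {e // h.IsElevator e} => h.fst e.1) (r.elevator_onE e)] at h1
    rw [show r.vertex (.secondHalf (r.iso.onE e)) = h.snd e.1 from
      congrArg (fun e : {e // h.IsElevator e} => h.snd e.1) (r.elevator_onE e)] at h2
    simp only [h1, h2, endMomentum]
    rw [show D.wt (r.iso.onE e) = h.edgeWeight e.1 from r.iso.wt_eq e]
    split_ifs <;> simp
  · intro u
    have h1 := hS (.toLeaf (r.leaf u).1 (r.leaf u).2)
    simp only [vertex, Sigma.eta, Equiv.symm_apply_apply] at h1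
    simp only [h1, endMomentum]

theorem exists_right (w : D.ExtEdge) : ∃ κ, h.strandBase κ = r.vertex w ∧
    0 < (h.strandDir κ).1 ∧ h.Crosses κ (p.endX w) := by
  obtain ⟨κ, h1, h2⟩ := r.decomposed.normalized.exists_right
    (r.decomposed.not_onElevatorsOnly (r.vertex w))
  refine ⟨κ, h1, h2, ?_⟩
  rw [← r.fst_pos_vertex, ← h1]
  rcases κ with e | u
  · exact ⟨h2, le_rfl, fst_pos_lt_of_dir_pos h2⟩
  · exact Or.inl ⟨h2, le_rfl⟩

/-- The only edge or ray of the floor over an end of an elevator is the one that starts there. -/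
theorem base_eq_of_crosses {κ : h.E ⊕ h.U} {w : D.ExtEdge} (hc : h.Crosses κ (p.endX w))
    (hF : h.floorOf (h.strandBase κ) = h.floorOf (r.vertex w)) :
    h.strandBase κ = r.vertex w ∧ 0 < (h.strandDir κ).1 := by
  obtain ⟨κ', h1, h2, h3⟩ := r.exists_right w
  obtain rfl := r.decomposed.eq_of_crosses hc (hF.trans (congrArg _ h1.symm)) h3
  exact ⟨h1, h2⟩

/-- Over an interval that is covered by a single edge or ray, the floor of the curve is parallel
to the constructed floor. -/
theorem strandHeight_sub {κ : h.E ⊕ h.U} {c c' : ℝ} (hcc : c ≤ c')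
    (hκ : ∀ t, c ≤ t → t < c' → h.Crosses κ t) :
    h.strandHeight κ c' - h.strandHeight κ c =
      p.floorY (r.iso.onV (h.floorOf (h.strandBase κ))) c' -
        p.floorY (r.iso.onV (h.floorOf (h.strandBase κ))) c := by
  rcases hcc.eq_or_lt with rfl | hlt
  · rw [sub_self, sub_self]
  have hc := hκ c le_rfl hlt
  rw [p.floorY_sub _ hcc, ← r.strandDir_snd_eq_slope hc]
  · have h1 : ((h.strandDir κ).2 / (h.strandDir κ).1 : ℝ) = (h.strandDir κ).2 := by
      rcases κ with e | u
      · simp [strandDir, r.decomposed.dir_fst_eq_one hc.1.ne']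
      · have h3 := hc.fst_ne_zero
        rcases r.decomposed.rayDir_cases u with h2 | h2 | h2 <;> simp [strandDir, h2] at h3 ⊢
    unfold strandHeight
    rw [h1]
    ring
  · rintro w hw ⟨h1, h2⟩
    have hF : h.floorOf (h.strandBase κ) = h.floorOf (r.vertex w) :=
      r.iso.onV.injective (hw.symm.trans (r.onV_floorOf_vertex w).symm)
    obtain ⟨h3, h4⟩ := r.base_eq_of_crosses (hκ _ h1.le h2) hF
    refine not_lt.2 ?_ h1
    rw [← r.fst_pos_vertex, ← h3]
    rcases κ with e | u
    · exact hc.2.1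
    · rcases hc with h5 | h5
      · exact h5.2
      · exact absurd h4 (not_lt.2 h5.1.le)

/-- The difference of the heights of a vertex and of the constructed floor. -/
noncomputable def offset (v : h.V) : ℝ :=
  (h.pos v).2 - p.floorY (r.iso.onV (h.floorOf v)) (h.pos v).1

theorem offset_eq_of_floorOf_eq {v w : h.V} (hvw : h.floorOf v = h.floorOf w) :
    r.offset v = r.offset w := by
  refine eq_of_floorOf_eq (fun e he => ?_) hvw
  have hp := r.decomposed.normalized.dir_fst_pos he
  have h1 := r.strandHeight_sub (κ := .inl e) (fst_pos_lt_of_dir_pos hp).le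
    fun t h2 h3 => ⟨hp, h2, h3⟩
  rw [strandHeight_snd hp.ne', show (h.pos (h.fst e)).1 = (h.pos (h.strandBase (.inl e))).1
    from rfl, strandHeight_base] at h1
  unfold offset
  rw [← h.floorOf_fst_eq_snd he]
  simp only [strandBase, Sum.elim_inl] at h1
  linarith

/-- The offset is constant on the floor, and vanishes because both the floor and the constructed
floor pass through the same point. -/
theorem offset_eq_zero (v : h.V) : r.offset v = 0 := by
  have hP := r.mem_floor (h.floorOf v)
  set v' := r.iso.onV (h.floorOf v) with hv'
  have hY := p.floorY_orig v'
  rcases h.mem_image_floorSet.1 hP with ⟨e, he, hF, hmem⟩ | ⟨u, hu, hF, hmem⟩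
  · have hp := r.decomposed.normalized.dir_fst_pos he
    obtain ⟨h1, h2, h3⟩ := r.decomposed.normalized.point_on_edge he hmem
    have h4 := r.strandHeight_sub (κ := .inl e) h1 fun t h5 h6 => ⟨hp, h5, h6.trans_le h2⟩
    rw [h3, show (h.pos (h.fst e)).1 = (h.pos (h.strandBase (.inl e))).1
      from rfl, strandHeight_base] at h4
    rw [← r.offset_eq_of_floorOf_eq hF, offset]
    simp only [strandBase, Sum.elim_inl, hF, ← hv'] at h4 ⊢
    linarith
  · have h0 := strandHeight_base (h := h) (.inr u)
    rw [← r.offset_eq_of_floorOf_eq hF, offset]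
    obtain ⟨⟨hs, h5⟩ | ⟨hs, h5⟩, h3⟩ := point_on_ray hu hmem
    · have h4 := r.strandHeight_sub (κ := .inr u) h5 fun t h6 _ => Or.inl ⟨hs, h6⟩
      simp only [strandBase, Sum.elim_inr, hF, ← hv'] at h4 h0 ⊢
      linarith
    · have h4 := r.strandHeight_sub (κ := .inr u) h5 fun t _ h6 => Or.inr ⟨hs, h6⟩
      simp only [strandBase, Sum.elim_inr, hF, ← hv'] at h4 h0 ⊢
      linarith

theorem pos_vertex (w : D.ExtEdge) : h.pos (r.vertex w) = p.endPos w := by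
  have h1 := r.offset_eq_zero (r.vertex w)
  unfold offset at h1
  rw [r.onV_floorOf_vertex, r.fst_pos_vertex] at h1
  exact Prod.ext (r.fst_pos_vertex w) (sub_eq_zero.1 h1)

/-- The endpoints of an edge that is not an elevator are consecutive. -/
theorem consec_of_edge {e : h.E} (he : ¬ h.IsElevator e) {w w' : D.ExtEdge}
    (h1 : h.fst e = r.vertex w) (h2 : h.snd e = r.vertex w') : p.Consec w w' := by
  have hp := r.decomposed.normalized.dir_fst_pos he
  have hlt := fst_pos_lt_of_dir_pos hp
  have hF := h.floorOf_fst_eq_snd he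
  rw [h1, h2] at hF
  rw [h1, h2, r.fst_pos_vertex, r.fst_pos_vertex] at hlt
  refine ⟨r.endFloor_eq hF, hlt, ?_⟩
  rintro w₂ hw₂ ⟨h3, h4⟩
  have hc : h.Crosses (.inl e) (p.endX w₂) := by
    refine ⟨hp, ?_, ?_⟩
    · rw [h1, r.fst_pos_vertex]
      exact h3.le
    · rw [h2, r.fst_pos_vertex]
      exact h4
  obtain ⟨h5, -⟩ := r.base_eq_of_crosses hc
    ((congrArg h.floorOf h1).trans (r.floorOf_vertex_eq hw₂.symm))
  rw [r.vertex_injective (h1.symm.trans h5)] at h3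
  exact lt_irrefl _ h3

/-- A ray to the right starts at a last end. -/
theorem isLast_of_ray {u : h.U} (hu : 0 < (h.rayDir u).1) {w : D.ExtEdge}
    (h1 : h.root u = r.vertex w) : p.IsLast w := by
  intro w' hw'
  by_contra! hlt
  have hc : h.Crosses (.inr u) (p.endX w') := Or.inl ⟨hu, by
    rw [h1, r.fst_pos_vertex]
    exact hlt.le⟩
  obtain ⟨h2, -⟩ := r.base_eq_of_crosses hc
    ((congrArg h.floorOf h1).trans (r.floorOf_vertex_eq hw'.symm))
  rw [r.vertex_injective (h1.symm.trans h2)] at hlt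
  exact lt_irrefl _ hlt

/-- A ray to the left starts at a first end. -/
theorem isFirst_of_ray {u : h.U} (hu : (h.rayDir u).1 < 0) {w : D.ExtEdge}
    (h1 : h.root u = r.vertex w) : p.IsFirst w := by
  intro w' hw'
  by_contra! hlt
  have hc : h.Crosses (.inr u) (p.endX w') := Or.inr ⟨hu, by
    rw [h1, r.fst_pos_vertex]
    exact hlt⟩
  obtain ⟨-, h2⟩ := r.base_eq_of_crosses hc
    ((congrArg h.floorOf h1).trans (r.floorOf_vertex_eq hw'.symm))
  exact absurd h2 (not_lt.2 hu.le)

theorem exists_edge (q : p.Gap) :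
    ∃ e, ¬ h.IsElevator e ∧ h.fst e = r.vertex q.1.1 ∧ h.snd e = r.vertex q.1.2 := by
  obtain ⟨e | u, h1, h2, -⟩ := r.exists_right q.1.1
  · obtain ⟨w', hw'⟩ := r.vertex_surjective (h.snd e)
    have h3 := r.consec_of_edge h2.ne' h1 hw'.symm
    exact ⟨e, h2.ne', h1, by rw [← hw', h3.right_unique q.2]⟩
  · exact absurd (r.isLast_of_ray h2 h1) q.2.not_isLast

theorem exists_leftRay (w : {w // p.IsFirst w}) :
    ∃ u, h.rayDir u = (-1, 0) ∧ h.root u = r.vertex w.1 := by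
  rcases r.decomposed.normalized.exists_left
    (r.decomposed.not_onElevatorsOnly (r.vertex w.1)) with ⟨e, h1, he⟩ | ⟨u, h1, hu⟩
  · obtain ⟨w', hw'⟩ := r.vertex_surjective (h.fst e)
    exact absurd w.2 (r.consec_of_edge he hw'.symm h1).not_isFirst
  · refine ⟨u, ?_, h1⟩
    rcases r.decomposed.rayDir_cases u with h2 | h2 | h2
    · simp [h2] at hu
    · exact h2
    · simp [h2] at hu

theorem exists_rightRay (w : {w // p.IsLast w}) :
    ∃ u, h.rayDir u = (1, 1) ∧ h.root u = r.vertex w.1 := by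
  obtain ⟨e | u, h1, h2, -⟩ := r.exists_right w.1
  · obtain ⟨w', hw'⟩ := r.vertex_surjective (h.snd e)
    exact absurd w.2 (r.consec_of_edge h2.ne' h1 hw'.symm).not_isLast
  · refine ⟨u, ?_, h1⟩
    change 0 < (h.rayDir u).1 at h2
    rcases r.decomposed.rayDir_cases u with h3 | h3 | h3
    · simp [h3] at h2
    · simp [h3] at h2
    · exact h3

/-- A curve through the given points with the given floor diagram is the constructed one. -/
theorem nonempty_iso (r : p.Realization h) : Nonempty (p.curve.Iso h) := by
  choose fE hE1 hE2 hE3 using r.exists_edge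
  choose fL hL1 hL2 using r.exists_leftRay
  choose fR hR1 hR2 using r.exists_rightRay
  -- Edges of the constructed curve are elevators and gaps.
  have hbijE : Function.Bijective (Sum.elim (fun e => (r.elevator e).1) fE) := by
    constructor
    · refine Function.Injective.sumElim (fun e e' hee => ?_) (fun q q' hqq => ?_) fun e q hq => ?_
      · exact r.iso.onE.symm.injective (Subtype.ext hee)
      · refine Subtype.ext (Prod.ext (r.vertex_injective ?_) (r.vertex_injective ?_))
        · rw [← hE2, ← hE2, hqq]
        · rw [← hE3, ← hE3, hqq]
      · exact hE1 q (hq ▸ (r.elevator e).2)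
    · intro e
      by_cases he : h.IsElevator e
      · exact ⟨.inl (r.iso.onE ⟨e, he⟩), congrArg Subtype.val (r.elevator_onE ⟨e, he⟩)⟩
      · obtain ⟨w, hw⟩ := r.vertex_surjective (h.fst e)
        obtain ⟨w', hw'⟩ := r.vertex_surjective (h.snd e)
        let q : p.Gap := ⟨(w, w'), r.consec_of_edge he hw.symm hw'.symm⟩
        refine ⟨.inr q, Sum.inl_injective (r.decomposed.right_unique (h := h)
          (κ := .inl (fE q)) (κ' := .inl e) ((hE2 q).trans hw) ?_ ?_)⟩
        · exact r.decomposed.normalized.dir_fst_pos (hE1 q)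
        · exact r.decomposed.normalized.dir_fst_pos he
  -- Rays of the constructed curve are leaves, rays to the left and rays to the right.
  have hbijU : Function.Bijective
      (Sum.elim (fun s => (r.leaf.symm s).1) (Sum.elim fL fR)) := by
    have hdir := fun s => r.decomposed.rayDir_of_isUnboundedElevator (r.leaf.symm s).2
    constructor
    · refine Function.Injective.sumElim (fun s s' hss => ?_)
        (Function.Injective.sumElim (fun w w' hww => ?_) (fun w w' hww => ?_) fun w w' hww => ?_) ?_
      · exact r.leaf.symm.injective (Subtype.ext hss)
      · exact Subtype.ext (r.vertex_injective (by rw [← hL2, ← hL2, hww]))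
      · exact Subtype.ext (r.vertex_injective (by rw [← hR2, ← hR2, hww]))
      · have h1 := hL1 w
        rw [hww, hR1 w'] at h1
        simp at h1
      · rintro s (w | w) hw
        · have h1 := hdir s
          rw [hw] at h1
          simp [hL1] at h1
        · have h1 := hdir s
          rw [hw] at h1
          simp [hR1] at h1
    · intro u
      by_cases hu : h.IsUnboundedElevator u
      · exact ⟨.inl (r.leaf ⟨u, hu⟩), congrArg Subtype.val (r.leaf.symm_apply_apply ⟨u, hu⟩)⟩
      obtain ⟨w, hw⟩ := r.vertex_surjective (h.root u)
      rcases lt_or_gt_of_ne (show (h.rayDir u).1 ≠ 0 from hu) with hs | hs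
      · let w₁ : {w // p.IsFirst w} := ⟨w, r.isFirst_of_ray hs hw.symm⟩
        have hroot : h.root (fL w₁) = h.root u := (hL2 w₁).trans hw
        refine ⟨.inr (.inl w₁), Sum.inr_injective (r.decomposed.eq_of_crosses (h := h)
          (κ := .inr (fL w₁)) (κ' := .inr u) (c := (h.pos (h.root u)).1 - 1)
          (Or.inr ⟨by simp [hL1], ?_⟩) (congrArg h.floorOf hroot) (Or.inr ⟨hs, by linarith⟩))⟩
        rw [hroot]
        linarith
      · let w₁ : {w // p.IsLast w} := ⟨w, r.isLast_of_ray hs hw.symm⟩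
        refine ⟨.inr (.inr w₁), Sum.inr_injective (r.decomposed.right_unique (h := h)
          (κ := .inr (fR w₁)) (κ' := .inr u) ((hR2 w₁).trans hw) ?_ hs)⟩
        simp [strandDir, hR1]
  have hpos := r.pos_vertex
  refine ⟨⟨Equiv.ofBijective r.vertex ⟨r.vertex_injective, r.vertex_surjective⟩,
    Equiv.ofBijective _ hbijE, Equiv.ofBijective _ hbijU, ?_, ?_, ?_, hpos, ?_⟩⟩
  · rintro (e | q)
    · rfl
    · exact congrArg₂ (fun a b => s(a, b)) (hE2 q) (hE3 q)
  · rintro (s | w | w)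
    · rfl
    · exact hL2 w
    · exact hR2 w
  · rintro (e | q)
    · change h.len (r.elevator e) = ((p.endPos (.firstHalf e)).2 -
        (p.endPos (.secondHalf e)).2) / D.wt e
      have h1 : (0 : ℝ) < D.wt e := by exact_mod_cast D.wt_pos e
      have h2 := h.snd_pos_snd (r.elevator e)
      have h3 := r.decomposed.normalized.edgeWeight_eq (r.elevator e).2
      have h4 : D.wt e = h.edgeWeight (r.elevator e) :=
        (congrArg D.wt (r.onE_elevator e)).symm.trans (r.iso.wt_eq (r.elevator e))
      have h5 : ((h.dir (r.elevator e)).2 : ℝ) = -D.wt e := by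
        have h6 : (h.dir (r.elevator e)).2 = -(D.wt e : ℤ) := by omega
        rw [h6]
        simp
      rw [h5] at h2
      rw [eq_div_iff h1.ne', ← hpos, ← hpos]
      change _ = (h.pos (h.fst (r.elevator e))).2 - (h.pos (h.snd (r.elevator e))).2
      rw [h2]
      ring
    · change h.len (fE q) = p.endX q.1.2 - p.endX q.1.1
      have h2 := h.fst_pos_snd (fE q)
      rw [hE2, hE3, r.fst_pos_vertex, r.fst_pos_vertex,
        r.decomposed.dir_fst_eq_one (hE1 q)] at h2
      push_cast at h2
      linarith
  · rintro (s | w | w)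
    · exact r.decomposed.rayDir_of_isUnboundedElevator (r.leaf.symm s).2
    · exact hL1 w
    · exact hR1 w

end LabeledFloorDiagram.Placement.Realization

/-! ### The bijection -/

namespace FloorMarking

variable {d g : ℕ} {M : FloorMarking d g}

/-- There is only one order-reversing bijection between finite linear orders. -/
theorem pointEquiv_unique {pt : M.diagram.ExtVertex ≃ Fin (3 * d - 1 + g)}
    (hpt : ∀ a b, M.order.lt a b ↔ pt b < pt a) {pt' : M.diagram.ExtVertex → Fin (3 * d - 1 + g)}
    (hpt' : ∀ a b, M.order.lt a b ↔ pt' b < pt' a) : pt' = pt := by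
  have h1 : StrictMono fun i => pt' (pt.symm i) := fun i j hij =>
    (hpt' _ _).1 ((hpt _ _).2 (by simpa using hij))
  have h2 := (h1.range_inj strictMono_id).1
    ((Finite.injective_iff_surjective.1 h1.injective).range_eq.trans Set.range_id.symm)
  funext a
  simpa using congrFun h2 (pt a)

end FloorMarking

namespace PlaneTropicalCurve

variable {h : PlaneTropicalCurve} {d g : ℕ} {P : Fin (3 * d - 1 + g) → ℝ × ℝ}

theorem IsCurveThrough.exists_inducesMarking (hh : h.IsCurveThrough d g P) (hd : 0 < d)
    (hP : IsVerticallyStretched d g P) : ∃ M : FloorMarking d g, h.InducesMarking P M := by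
  obtain ⟨M, hM⟩ := (h.isNormalized_reorient.isFloorDecomposed hd hP
    hh.reorient).exists_inducesMarking hd hP hh.reorient
  obtain ⟨f⟩ := PlaneTropicalCurve.setoid.symm ⟨h.isoReorient⟩
  exact ⟨M, f.inducesMarking hM⟩

theorem InducesMarking.nonempty_iso_curve (hd : 0 < d) (hP : IsVerticallyStretched d g P)
    (hh : h.IsCurveThrough d g P) {M : FloorMarking d g} (hM : h.InducesMarking P M)
    {pt : M.diagram.ExtVertex ≃ Fin (3 * d - 1 + g)}
    (hpt : ∀ a b, M.order.lt a b ↔ pt b < pt a) (p : M.diagram.Placement)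
    (hp : ∀ a, p.point a = P (pt a)) : Nonempty (p.curve.Iso h) := by
  have hfd := h.isNormalized_reorient.isFloorDecomposed hd hP hh.reorient
  obtain ⟨f, l, pt', h1, -, h3, h4, h5, h6⟩ := h.isoReorient.inducesMarking hM
  obtain rfl := FloorMarking.pointEquiv_unique hpt fun a b =>
    (h6 a b).trans hP.2.1.lt_iff_lt
  let r : p.Realization h.reorient :=
    { decomposed := hfd
      iso := f
      leaf := l
      leaf_fst := h1
      mem_floor := fun F => by rw [hp]; exact (h3 F _).2 rfl
      mem_edge := fun e => by rw [hp]; exact (h4 e _).2 rfl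
      mem_ray := fun u => by rw [hp]; exact (h5 u _).2 rfl }
  exact PlaneTropicalCurve.setoid.trans r.nonempty_iso
    (PlaneTropicalCurve.setoid.symm ⟨h.isoReorient⟩)

end PlaneTropicalCurve

/-- For every vertically stretched `(d, g)`-configuration `P`, each irreducible plane tropical
curve `h` of degree `d` and genus `g` through `P` induces a marking of its floor diagram, which is a
marked floor diagram `Φ h` of degree `d` and genus `g`, well defined and depending only on the
isomorphism class of `h`; and the map `Φ` is a bijection. -/
theorem mainTheorem9 (d g : ℕ) (hd : 0 < d) (P : Fin (3 * d - 1 + g) → ℝ × ℝ)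
    (hP : IsVerticallyStretched d g P) :
    ∃ Φ : tropicalCurvesThrough d g P → MarkedFloorDiagram d g,
      (∀ (h : PlaneTropicalCurve) (hh : h.IsCurveThrough d g P) (M : FloorMarking d g),
        h.InducesMarking P M ↔
          Φ ⟨Quotient.mk PlaneTropicalCurve.setoid h, h, hh, rfl⟩ =
            Quotient.mk (FloorMarking.setoid d g) M) ∧
      Function.Bijective Φ := by
  -- A marking induced by a chosen representative of each class of curves.
  choose m hm using fun H : tropicalCurvesThrough d g P =>
    H.2.choose_spec.1.exists_inducesMarking hd hP
  have hiff : ∀ (h : PlaneTropicalCurve) (hh : h.IsCurveThrough d g P) (M : FloorMarking d g),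
      h.InducesMarking P M ↔ Quotient.mk (FloorMarking.setoid d g)
        (m ⟨Quotient.mk PlaneTropicalCurve.setoid h, h, hh, rfl⟩) =
          Quotient.mk (FloorMarking.setoid d g) M := by
    intro h hh M
    set H : tropicalCurvesThrough d g P := ⟨Quotient.mk PlaneTropicalCurve.setoid h, h, hh, rfl⟩
    obtain ⟨f⟩ : Nonempty (H.2.choose.Iso h) := Quotient.exact H.2.choose_spec.2
    have h1 := f.inducesMarking (hm H)
    exact ⟨fun h2 => Quotient.sound (h1.equivalent h2), fun h2 =>
      h1.of_equivalent (Quotient.exact h2)⟩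
  refine ⟨fun H => Quotient.mk _ (m H), hiff, ?_, ?_⟩
  · rintro ⟨_, h, hh, rfl⟩ ⟨_, k, hk, rfl⟩ heq
    -- Two curves with the same marking are both isomorphic to the curve constructed from it.
    obtain ⟨M, hM⟩ := hh.exists_inducesMarking hd hP
    have hM' : k.InducesMarking P M := (hiff k hk M).2 (heq.symm.trans ((hiff h hh M).1 hM))
    obtain ⟨pt, hpt⟩ := M.exists_pointEquiv
    obtain ⟨p, hp⟩ := M.exists_placement hd hP hpt
    exact Subtype.ext (Quotient.sound (PlaneTropicalCurve.setoid.trans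
      (PlaneTropicalCurve.setoid.symm (hM.nonempty_iso_curve hd hP hh hpt p hp))
      (hM'.nonempty_iso_curve hd hP hk hpt p hp)))
  · intro 𝓜
    induction 𝓜 using Quotient.inductionOn with
    | h M =>
      obtain ⟨pt, hpt⟩ := M.exists_pointEquiv
      obtain ⟨p, hp⟩ := M.exists_placement hd hP hpt
      have hh := p.isCurveThrough_curve pt.surjective hp
      exact ⟨⟨_, p.curve, hh, rfl⟩, (hiff _ hh M).1 (p.inducesMarking_curve hd hP hpt hp)⟩
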